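/- Let $0<n\le d$ be integers and let $\mu$ be a Radon measure on $\mathbb R^d$ of $n$-polynomial growth: $\mu(B(x,r))\le C_\mu r^n$ for $\mu$-almost every $x$ and all $r>0$. Let $(\Sigma_k)_{k\in\mathbb Z}$ be a two-sided filtration for $\mu$ of the type constructed by Conde-Alonso and Parcet. That is, the $\Sigma_k$ are nested atomic $\sigma$-algebras of $\mathrm{supp}(\mu)$, increasing in $k$ (atoms have positive measure and cover $\mathrm{supp}(\mu)$ up to null sets); $\bigcup_k L_\infty(\Sigma_k,\mu)$ is weak-$*$ dense in $L_\infty(\mu)$; the atoms exhaust $\mu$ as $k\to-\infty$, i.e. there is $c>0$ such that $\sup\{\mu(R): R\supseteq Q \text{ an atom}\}\ge c\,\mu(\mathbb R^d)$ for every atom $Q$; and there are constants $\alpha,\beta>100$ and, for every atom $Q$, an open ball $B_Q$ with centre $c_{B_Q}$ and radius $r(B_Q)$ such that - $\mu(\alpha B_Q)\le\beta\,\mu(B_Q)$ and $B_Q\cap \mathrm{supp}(\mu)\subset Q\subset 28B_Q$; - if $x\in Q$ and $R$ is the smallest atom strictly containing $Q$, then $\int_{\alpha B_R\setminus 56B_Q}|x-y|^{-n}\,d\mu(y)\le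 C$, with $C$ independent of $x$, $Q$ and $R$. Let $T_k$ be a bounded operator on $L_2(\mu)$ with a measurable kernel $k:\{(x,y)\in\mathbb R^{d}\times\mathbb R^d: x\ne y\}\to\mathbb C$, i.e. $T_kf(x)=\int k(x,y)f(y)\,d\mu(y)$ for almost every $x\notin\mathrm{supp} f$ whenever $f\in L_2(\mu)$ has compact support. Assume that $|k(x,y)|\le A|x-y|^{-n}$ for all $x\neq y$ and some constant $A$, and that, with $\mathcal C_{Q,j}=\{x: 2^jr(B_Q)\le|x-c_{B_Q}|\le2^{j+1}r(B_Q)\}$, $$\sup_{Q\ \mathrm{atom}}\ \sum_{j\ge1}\ \sup_{y\in Q}\Big(\mu(\mathcal C_{Q,j})\int_{\mathcal C_{Q,j}\setminus\alpha B_Q}|k(x,y)-k(x,c_{B_Q})|^2\,d\mu(x)\Big)^{1/2}<\infty .$$ Then $T_k$, restricted to $L_1(\mu)\cap L_2(\mu)$, extends to a linear map from $L_1(\mu)$ to (classes of) measurable functions, again denoted by $T_k$, and there is a constant $C_\Omega$ such that for every $m$ and every integrable $f=(f_{ij}):\mathbb R^d\to M_m(\mathbb C)$, with $T_kf=(T_kf_{ij})$,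 $$\sup_{\lambda>0}\ \lambda\int_{\mathbb R^d}\mathrm{tr}\{|T_kf(\omega)|>\lambda\}\,d\mu(\omega)\ \le\ C_\Omega\int_{\mathbb R^d}\mathrm{tr}\,|f(\omega)|\,d\mu(\omega).$$ Here $\mathrm{tr}\{|A|>\lambda\}$ is the trace of the spectral projection of $|A|=(A^*A)^{1/2}$ for $(\lambda,\infty)$. The constant $C_\Omega$ does not depend on $m$. -/

import Mathlib

open MeasureTheory Set
open scoped ENNReal NNReal Matrix

noncomputable section

/-- A Borel measure on `ℝ^d` has `n`-polynomial growth: `0 < n ≤ d` and, for some constant `C`,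
`μ (B(x, r)) ≤ C r ^ n` for `μ`-almost every `x` and all `r > 0`. -/
def PolynomialGrowth {d : ℕ} (n : ℕ) (μ : Measure (EuclideanSpace ℝ (Fin d))) : Prop :=
  0 < n ∧ n ≤ d ∧
    ∃ C : ℝ, ∀ᵐ x ∂μ, ∀ r : ℝ, 0 < r → μ (Metric.ball x r) ≤ ENNReal.ofReal (C * r ^ n)

/-- A two-sided (in general nonregular) filtration `(Σ_k)_{k ∈ ℤ}` of atomic `σ`-algebras of
`supp μ`, adapted to a measure `μ` and to the exponent `n`. The `σ`-algebra `Σ_k` is given by its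
set of atoms `atoms k`, and `B_Q` is the open ball with centre `center Q` and radius `radius Q`. -/
structure NonregularFiltration {d : ℕ} (n : ℕ) (μ : Measure (EuclideanSpace ℝ (Fin d))) where
  /-- the atoms of `Σ_k` -/
  atoms : ℤ → Set (Set (EuclideanSpace ℝ (Fin d)))
  /-- dilation parameter of the doubling balls -/
  α : ℝ
  /-- doubling constant of the doubling balls -/
  β : ℝ
  /-- centre of `B_Q` -/
  center : Set (EuclideanSpace ℝ (Fin d)) → EuclideanSpace ℝ (Fin d)
  /-- radius of `B_Q` -/
  radius : Set (EuclideanSpace ℝ (Fin d)) → ℝ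
  α_gt : 100 < α
  β_gt : 100 < β
  measurableSet_atom : ∀ k, ∀ Q ∈ atoms k, MeasurableSet Q
  atom_subset_support : ∀ k, ∀ Q ∈ atoms k, Q ⊆ μ.support
  measure_atom_pos : ∀ k, ∀ Q ∈ atoms k, 0 < μ Q
  disjoint_atoms : ∀ k, (atoms k).PairwiseDisjoint id
  /-- the atoms of each `Σ_k` cover `supp μ`, up to a null set -/
  cover : ∀ k, ∀ᵐ x ∂μ, ∃ Q ∈ atoms k, x ∈ Q
  /-- `Σ_k ⊆ Σ_{k+1}` -/
  nested : ∀ k, ∀ Q ∈ atoms (k + 1), ∃ R ∈ atoms k, Q ⊆ R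
  /-- the bounded functions that are `Σ_k`-measurable for some `k` are weak-* dense in `L_∞(μ)` -/
  weakStar_dense : ∀ φ : EuclideanSpace ℝ (Fin d) → ℂ, Measurable φ → (∃ b : ℝ, ∀ x, ‖φ x‖ ≤ b) →
    ∀ (N : ℕ) (g : Fin N → EuclideanSpace ℝ (Fin d) → ℂ), (∀ i, Integrable (g i) μ) →
    ∀ ε : ℝ, 0 < ε → ∃ (k : ℤ) (ψ : EuclideanSpace ℝ (Fin d) → ℂ),
      (∃ b : ℝ, ∀ x, ‖ψ x‖ ≤ b) ∧ (∀ Q ∈ atoms k, ∀ x ∈ Q, ∀ y ∈ Q, ψ x = ψ y) ∧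
      ∀ i, ‖∫ x, (φ x - ψ x) * g i x ∂μ‖ < ε
  /-- the filtration is two-sided: as `k → -∞` the atoms exhaust `μ` in measure, up to a constant
  (if `μ` is infinite, the measures of the ancestors of an atom tend to infinity) -/
  exhaust : ∃ c : ℝ≥0, 0 < c ∧ ∀ k, ∀ Q ∈ atoms k,
    (c : ℝ≥0∞) * μ univ ≤ ⨆ R ∈ {R | (∃ j, R ∈ atoms j) ∧ Q ⊆ R}, μ R
  radius_pos : ∀ k, ∀ Q ∈ atoms k, 0 < radius Q
  /-- `B_Q` is `(α, β)`-doubling -/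
  doubling : ∀ k, ∀ Q ∈ atoms k, μ (Metric.ball (center Q) (α * radius Q)) ≤
    ENNReal.ofReal β * μ (Metric.ball (center Q) (radius Q))
  /-- `B_Q ⊆ Q`, as subsets of `supp μ` -/
  ball_subset_atom : ∀ k, ∀ Q ∈ atoms k, Metric.ball (center Q) (radius Q) ∩ μ.support ⊆ Q
  /-- `Q ⊆ 28 B_Q` -/
  atom_subset_ball : ∀ k, ∀ Q ∈ atoms k, Q ⊆ Metric.ball (center Q) (28 * radius Q)
  /-- if `x ∈ Q` and `R` is the smallest atom that strictly contains `Q`, then the integral of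
  `|x - y| ^ (-n)` over `α B_R \ 56 B_Q` is bounded uniformly in `x`, `Q` -/
  parent_integral : ∃ C : ℝ≥0, ∀ Q R : Set (EuclideanSpace ℝ (Fin d)),
    (∃ k, Q ∈ atoms k) → (∃ k, R ∈ atoms k) → Q ⊂ R →
    R = ⋂₀ {S | (∃ k, S ∈ atoms k) ∧ Q ⊂ S} → ∀ x ∈ Q,
    ∫⁻ y in Metric.ball (center R) (α * radius R) \ Metric.ball (center Q) (56 * radius Q),
      ENNReal.ofReal (1 / ‖x - y‖ ^ n) ∂μ ≤ C

/-- The annulus `C_{Q,j} = {2^j r(B_Q) ≤ |x - c_{B_Q}| ≤ 2^(j+1) r(B_Q)}`. -/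
def NonregularFiltration.annulus {d n : ℕ} {μ : Measure (EuclideanSpace ℝ (Fin d))}
    (F : NonregularFiltration n μ) (Q : Set (EuclideanSpace ℝ (Fin d))) (j : ℕ) :
    Set (EuclideanSpace ℝ (Fin d)) :=
  {x | 2 ^ j * F.radius Q ≤ ‖x - F.center Q‖ ∧ ‖x - F.center Q‖ ≤ 2 ^ (j + 1) * F.radius Q}

/-- The dilated ball `α B_Q`. -/
def NonregularFiltration.dilatedBall {d n : ℕ} {μ : Measure (EuclideanSpace ℝ (Fin d))}
    (F : NonregularFiltration n μ) (Q : Set (EuclideanSpace ℝ (Fin d))) :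
    Set (EuclideanSpace ℝ (Fin d)) :=
  Metric.ball (F.center Q) (F.α * F.radius Q)

/-- The size condition `|k(x,y)| ≲ |x - y| ^ (-n)` off the diagonal. -/
def KernelSize {d : ℕ} (n : ℕ)
    (k : EuclideanSpace ℝ (Fin d) → EuclideanSpace ℝ (Fin d) → ℂ) : Prop :=
  ∃ A : ℝ, ∀ x y, x ≠ y → ‖k x y‖ ≤ A / ‖x - y‖ ^ n

/-- The `L_2`-Hörmander condition on the annuli around the balls `B_Q`:
`sup_Q ∑_{j ≥ 1} sup_{y ∈ Q}
  (μ(C_{Q,j}) ∫_{C_{Q,j} \ α B_Q} |k(x,y) - k(x,c_{B_Q})|^2 dμ(x))^(1/2) < ∞`. -/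
def L2Hormander {d n : ℕ} {μ : Measure (EuclideanSpace ℝ (Fin d))}
    (F : NonregularFiltration n μ)
    (k : EuclideanSpace ℝ (Fin d) → EuclideanSpace ℝ (Fin d) → ℂ) : Prop :=
  ∃ H : ℝ≥0, ∀ i, ∀ Q ∈ F.atoms i,
    ∑' j : ℕ, ⨆ y ∈ Q, (μ (F.annulus Q (j + 1)) *
      ∫⁻ x in F.annulus Q (j + 1) \ F.dilatedBall Q,
        ‖k x y - k x (F.center Q)‖ₑ ^ 2 ∂μ) ^ (1 / 2 : ℝ) ≤ H

/-- The `L_2(μ)`-bounded operator `T` is a Calderón-Zygmund operator with kernel `k`: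
`T f(x) = ∫ k(x,y) f(y) dμ(y)` away from the support of `f`, for compactly supported `f`. -/
def HasKernel {d : ℕ} {μ : Measure (EuclideanSpace ℝ (Fin d))}
    (T : Lp ℂ 2 μ →L[ℂ] Lp ℂ 2 μ)
    (k : EuclideanSpace ℝ (Fin d) → EuclideanSpace ℝ (Fin d) → ℂ) : Prop :=
  ∀ (f : Lp ℂ 2 μ) (K : Set (EuclideanSpace ℝ (Fin d))), IsCompact K →
    (∀ᵐ y ∂μ, y ∉ K → f y = 0) →
    ∀ᵐ x ∂μ, x ∉ K → T f x = ∫ y, k x y * f y ∂μ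

/-- The modulus `|A| = (A* A)^(1/2)` of a matrix, by functional calculus. -/
def matrixAbs {m : ℕ} (A : Matrix (Fin m) (Fin m) ℂ) : Matrix (Fin m) (Fin m) ℂ :=
  cfc Real.sqrt (Aᴴ * A)

/-- `tr |A|`. -/
def traceAbs {m : ℕ} (A : Matrix (Fin m) (Fin m) ℂ) : ℝ :=
  (matrixAbs A).trace.re

/-- `tr {|A| > s}`: the trace of the spectral projection of `|A|` for the interval `(s, ∞)`. -/
def traceLevel {m : ℕ} (A : Matrix (Fin m) (Fin m) ℂ) (s : ℝ) : ℝ :=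
  (cfc (indicator (Ioi s) (fun _ : ℝ => (1 : ℝ))) (matrixAbs A)).trace.re

end

/-!
The proof is a Calderón-Zygmund decomposition for matrix-valued functions that is adapted to the
given filtration, so that no doubling property of `μ` beyond that of the balls `B_Q` is needed.

*Reduction to finite sums.* It suffices to treat `f = ∑ A_Q 1_Q`, a finite sum over atoms `Q` of
one generation. By duality the bounded functions constant on atoms are dense in `L_2`, and the
density is arranged in `L_1` and `L_2` at once and with a common generation for all entries
(`NonregularFiltration.exists_atomic_approx`). Estimates of the level function survive convergence
in measure of the entries (`mul_lintegral_traceLevel_le_of_tendsto`), which passes the bound from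
finite sums to `L_1 ∩ L_2`, and from there to `L_1`; the extension of `T` to `L_1` is the limit in
measure along `L_1`-approximations, and exists because of the scalar case of the bound. By
polarization (`exists_polarization`) each `A_Q` may be taken of the form `Bᴴ * B`.

*The decomposition.* A finite sum of this kind is a finite tree (`MassTree`), whose nodes are the
ancestors of the atoms of `f`. Going down the tree from a generation of large atoms, Cuculescu's
construction provides for every node `Q` a spectral cut `bad Q` of the average `f_Q`, compressed to
the projection which is left over from the ancestors: there `f_Q` is larger than the level `s`, and
on the remaining projection `good Q` it is at most `s`, and the compressed average has no
off-diagonal part between the two. By Chebyshev, the sum of `μ(Q) tr (bad Q)` is at most `‖f‖₁ / s`.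
Then (`MassTree.sum_leaves_eq`) `f` is the sum of four kinds of terms.

* A martingale, whose coefficients are the compressed averages; its `L_2` norm is at most
  `(3 s ‖f‖₁) ^ (1/2)`, by orthogonality (`MassTree.sum_norm_sq_martingalePart_le`), and `T` is
  bounded on `L_2`.
* The averages of `f` over `Q`, compressed to `bad Q`, times the function
  `1_Q - μ(Q)/μ(R) 1_R`, where `R` is the parent of `Q`. The image under `T` of this function has
  `L_1` norm at most a multiple of `μ(Q)` (`lintegral_parent_sub_le`): the doubling of `B_Q` and of
  `B_R` controls it near these balls, the integral condition on the filtration controls it in the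
  gap between them, and the Hörmander condition controls it far away.
* The same for the first generation, where there is no parent. If `μ` is infinite, the first
  generation is chosen so early that the bad projections vanish; if `μ` is finite, then so early
  that the measures of its atoms are comparable with that of the whole space.
* For each node, the rest of the compression to `bad Q` on the left, on the right, or on both sides.
  It has mean zero on `Q`. In the ball `α B_Q` its image is counted by its rank, which is at most
  `3 tr (bad Q)`. Outside, the kernel may be replaced with `k(x, y) - k(x, c_{B_Q})`, and the trace
  norm is estimated by a Cauchy-Schwarz inequality for matrices (`traceAbs_offDiag_le`), which calls
  exactly for the `L_2` form of the Hörmander condition (`lintegral_far_sqrt_le`). The trace norm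
  and the rank mix well, as `tr {|A + B| > s}` is at most `rank A + tr {|B| > s}`.

All constants are independent of the size of the matrices.
-/

noncomputable section

/-! ### Singular values, the Hilbert-Schmidt norm and the trace norm -/

open scoped ComplexOrder in
/-- A singular value decomposition without the left singular vectors: `σ` lists the singular
values, the columns of `U` are right singular vectors. -/
theorem exists_svd {m : ℕ} (A : Matrix (Fin m) (Fin m) ℂ) :
    ∃ (U : Matrix (Fin m) (Fin m) ℂ) (σ : Fin m → ℝ), Uᴴ * U = 1 ∧ U * Uᴴ = 1 ∧ (∀ i, 0 ≤ σ i) ∧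
      Aᴴ * A = U * Matrix.diagonal (fun i => ((σ i ^ 2 : ℝ) : ℂ)) * Uᴴ ∧
      traceAbs A = ∑ i, σ i ∧
      ∀ s, traceLevel A s = ((Finset.univ.filter fun i => s < σ i).card : ℝ) := by
  have hP : (Aᴴ * A).PosSemidef := Matrix.posSemidef_conjTranspose_mul_self A
  set H := hP.1 with hH
  have key : ∀ f : ℝ → ℝ, cfc f (Aᴴ * A) =
      (H.eigenvectorUnitary : Matrix (Fin m) (Fin m) ℂ) *
        Matrix.diagonal (fun i => ((f (H.eigenvalues i) : ℝ) : ℂ)) *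
        (H.eigenvectorUnitary : Matrix (Fin m) (Fin m) ℂ)ᴴ := by
    intro f
    rw [H.cfc_eq, Matrix.IsHermitian.cfc, Unitary.conjStarAlgAut_apply]
    rfl
  have hU1 : (H.eigenvectorUnitary : Matrix (Fin m) (Fin m) ℂ)ᴴ *
      (H.eigenvectorUnitary : Matrix (Fin m) (Fin m) ℂ) = 1 :=
    (Matrix.mem_unitaryGroup_iff'.1 H.eigenvectorUnitary.2)
  have tr : ∀ f : ℝ → ℝ, (cfc f (Aᴴ * A)).trace.re = ∑ i, f (H.eigenvalues i) := by
    intro f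
    rw [key, Matrix.trace_mul_cycle, hU1, one_mul, Matrix.trace_diagonal]
    simp
  refine ⟨H.eigenvectorUnitary, fun i => Real.sqrt (H.eigenvalues i), hU1,
    (Matrix.mem_unitaryGroup_iff.1 H.eigenvectorUnitary.2), fun i => Real.sqrt_nonneg _, ?_, ?_, ?_⟩
  · conv_lhs => rw [← cfc_id ℝ (Aᴴ * A) H.isSelfAdjoint, key]
    simp only [Real.sq_sqrt (hP.eigenvalues_nonneg _), id]
  · rw [traceAbs, matrixAbs, tr]
  · intro s
    have hfin : (spectrum ℝ (Aᴴ * A)).Finite := Matrix.finite_real_spectrum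
    rw [traceLevel, matrixAbs,
      ← cfc_comp _ _ _ H.isSelfAdjoint ((hfin.image _).continuousOn _) (hfin.continuousOn _), tr]
    simp [Set.indicator_apply]

/-- The squared Hilbert-Schmidt norm of a matrix. -/
def frobSq {m : ℕ} (A : Matrix (Fin m) (Fin m) ℂ) : ℝ := ∑ i, ∑ j, ‖A i j‖ ^ 2

section frob
variable {m : ℕ} (A B : Matrix (Fin m) (Fin m) ℂ)

theorem frobSq_nonneg : 0 ≤ frobSq A := by unfold frobSq; positivity

theorem frobSq_conjTranspose : frobSq Aᴴ = frobSq A := by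
  unfold frobSq
  rw [Finset.sum_comm]
  simp

theorem trace_conjTranspose_mul_self : (Aᴴ * A).trace = (frobSq A : ℂ) := by
  unfold frobSq
  rw [Finset.sum_comm]
  simp [Matrix.trace, Matrix.mul_apply, Complex.conj_mul', Matrix.conjTranspose_apply]

theorem frobSq_eq_re_trace : frobSq A = (Aᴴ * A).trace.re := by
  rw [trace_conjTranspose_mul_self, Complex.ofReal_re]

theorem frobSq_eq_re_trace' : frobSq A = (A * Aᴴ).trace.re := by
  rw [Matrix.trace_mul_comm, trace_conjTranspose_mul_self, Complex.ofReal_re]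

/-- The Cauchy-Schwarz inequality of the Hilbert-Schmidt inner product. -/
theorem norm_trace_mul_le : ‖(A * B).trace‖ ≤ Real.sqrt (frobSq A) * Real.sqrt (frobSq B) := by
  have h : (A * B).trace = ∑ x : Fin m × Fin m, A x.1 x.2 * B x.2 x.1 := by
    rw [Fintype.sum_prod_type]; simp [Matrix.trace, Matrix.mul_apply]
  have hA : frobSq A = ∑ x : Fin m × Fin m, ‖A x.1 x.2‖ ^ 2 := by
    rw [Fintype.sum_prod_type]; rfl
  have hB : frobSq B = ∑ x : Fin m × Fin m, ‖B x.2 x.1‖ ^ 2 := by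
    rw [Fintype.sum_prod_type, Finset.sum_comm]; rfl
  rw [h, hA, hB]
  refine (norm_sum_le _ _).trans ?_
  simp only [norm_mul]
  exact Real.sum_mul_le_sqrt_mul_sqrt _ _ _

theorem eq_zero_of_frobSq_eq_zero {A : Matrix (Fin m) (Fin m) ℂ} (h : frobSq A = 0) : A = 0 := by
  unfold frobSq at h
  ext i j
  have h1 := (Finset.sum_eq_zero_iff_of_nonneg (fun i _ => by positivity)).1 h i (by simp)
  have h2 := (Finset.sum_eq_zero_iff_of_nonneg (fun i _ => by positivity)).1 h1 j (by simp)
  simpa using h2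

theorem frobSq_smul (c : ℂ) : frobSq (c • A) = ‖c‖ ^ 2 * frobSq A := by
  unfold frobSq
  simp [mul_pow, Finset.mul_sum]

theorem frobSq_add_le : frobSq (A + B) ≤ 2 * frobSq A + 2 * frobSq B := by
  unfold frobSq
  simp only [Finset.mul_sum, ← Finset.sum_add_distrib]
  gcongr with i _ j _
  have := norm_add_le (A i j) (B i j)
  calc ‖(A + B) i j‖ ^ 2 ≤ (‖A i j‖ + ‖B i j‖) ^ 2 := by
        rw [Matrix.add_apply]; gcongr
    _ ≤ _ := by nlinarith [sq_nonneg (‖A i j‖ - ‖B i j‖)]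

end frob

/-- A matrix `P` is an orthogonal projection: hermitian and idempotent. -/
def IsProj {m : ℕ} (P : Matrix (Fin m) (Fin m) ℂ) : Prop := Pᴴ = P ∧ P * P = P

namespace IsProj
variable {m : ℕ} {P Q : Matrix (Fin m) (Fin m) ℂ}

theorem one : IsProj (1 : Matrix (Fin m) (Fin m) ℂ) := ⟨by simp, by simp⟩

theorem sub (hP : IsProj P) (hQ : IsProj Q) (h : Q * P = Q) (h' : P * Q = Q) :
    IsProj (P - Q) := by
  refine ⟨by rw [Matrix.conjTranspose_sub, hP.1, hQ.1], ?_⟩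
  rw [Matrix.sub_mul, Matrix.mul_sub, Matrix.mul_sub, hP.2, hQ.2, h, h']; simp

theorem frobSq_mul_add (hP : IsProj P) (B : Matrix (Fin m) (Fin m) ℂ) :
    frobSq (P * B) + frobSq ((1 - P) * B) = frobSq B := by
  have hP' : IsProj (1 - P) := one.sub hP (by simp) (by simp)
  simp only [frobSq_eq_re_trace, Matrix.conjTranspose_mul, hP.1, hP'.1]
  have e1 : Bᴴ * P * (P * B) = Bᴴ * P * B := by
    rw [Matrix.mul_assoc, ← Matrix.mul_assoc P, hP.2, Matrix.mul_assoc]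
  have e2 : Bᴴ * (1 - P) * ((1 - P) * B) = Bᴴ * B - Bᴴ * P * B := by
    rw [Matrix.mul_assoc, ← Matrix.mul_assoc (1 - P), hP'.2, Matrix.sub_mul, Matrix.mul_sub,
      Matrix.one_mul, Matrix.mul_assoc]
  rw [e1, e2, Matrix.trace_sub, Complex.sub_re]; ring

theorem frobSq_mul_le (hP : IsProj P) (B : Matrix (Fin m) (Fin m) ℂ) :
    frobSq (P * B) ≤ frobSq B := by
  have := hP.frobSq_mul_add B
  linarith [frobSq_nonneg ((1 - P) * B)]

theorem frobSq_eq (hP : IsProj P) : frobSq P = P.trace.re := by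
  rw [frobSq_eq_re_trace, hP.1, hP.2]

end IsProj

/-- A matrix is a contraction when multiplication by it, on either side, does not increase the
Hilbert-Schmidt norm. -/
def IsContr {m : ℕ} (X : Matrix (Fin m) (Fin m) ℂ) : Prop :=
  ∀ B, frobSq (X * B) ≤ frobSq B ∧ frobSq (B * X) ≤ frobSq B

theorem isContr_of_isProj {m : ℕ} {X : Matrix (Fin m) (Fin m) ℂ} (h : IsProj (X * Xᴴ)) :
    IsContr X := by
  have h0 : (1 - X * Xᴴ) * X = 0 := by
    have : frobSq ((1 - X * Xᴴ) * X) = 0 := by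
      rw [frobSq_eq_re_trace', Matrix.conjTranspose_mul, Matrix.conjTranspose_sub, h.1]
      have : (1 - X * Xᴴ) * X * (Xᴴ * (1ᴴ - X * Xᴴ)) = (1 - X * Xᴴ) * (X * Xᴴ) * (1 - X * Xᴴ) := by
        simp only [Matrix.mul_assoc, Matrix.conjTranspose_one]
      rw [this, Matrix.sub_mul, h.2]; simp
    exact eq_zero_of_frobSq_eq_zero this
  have h1 : X * Xᴴ * X = X := by
    rw [Matrix.sub_mul, Matrix.one_mul, sub_eq_zero] at h0; exact h0.symm
  have h2 : IsProj (Xᴴ * X) := ⟨by simp, by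
    rw [Matrix.mul_assoc, ← Matrix.mul_assoc X, h1]⟩
  intro B
  constructor
  · have e : frobSq (X * B) = frobSq (Xᴴ * X * B) := by
      simp only [frobSq_eq_re_trace, Matrix.conjTranspose_mul, Matrix.conjTranspose_conjTranspose]
      have : Bᴴ * (Xᴴ * X) * (Xᴴ * X * B) = Bᴴ * (Xᴴ * X * (Xᴴ * X)) * B := by
        simp only [Matrix.mul_assoc]
      rw [this, h2.2]; simp only [Matrix.mul_assoc]
    rw [e]; exact h2.frobSq_mul_le B
  · have e : frobSq (B * X) = frobSq (X * Xᴴ * Bᴴ) := by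
      rw [frobSq_eq_re_trace', frobSq_eq_re_trace]
      simp only [Matrix.conjTranspose_mul, Matrix.conjTranspose_conjTranspose]
      have : B * (X * Xᴴ) * (X * Xᴴ * Bᴴ) = B * (X * Xᴴ * (X * Xᴴ)) * Bᴴ := by
        simp only [Matrix.mul_assoc]
      rw [this, h.2]; simp only [Matrix.mul_assoc]
    rw [e, ← frobSq_conjTranspose B]
    exact h.frobSq_mul_le _

section traceAbs
variable {m : ℕ}

theorem traceAbs_nonneg (A : Matrix (Fin m) (Fin m) ℂ) : 0 ≤ traceAbs A := by
  obtain ⟨U, σ, -, -, h0, -, h, -⟩ := exists_svd A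
  rw [h]; exact Finset.sum_nonneg fun i _ => h0 i

/-- The trace norm is attained by duality at a partial isometry. -/
theorem exists_isContr_trace_eq (A : Matrix (Fin m) (Fin m) ℂ) :
    ∃ X, IsContr X ∧ (X * A).trace = (traceAbs A : ℂ) := by
  obtain ⟨U, σ, hU, hU', h0, hA, h, -⟩ := exists_svd A
  -- the inverse vanishes at zero, so that `X` vanishes on the kernel of `A`
  refine ⟨U * Matrix.diagonal (fun i => ((σ i)⁻¹ : ℂ)) * Uᴴ * Aᴴ, isContr_of_isProj ?_, ?_⟩
  · have e : U * Matrix.diagonal (fun i => ((σ i)⁻¹ : ℂ)) * Uᴴ * Aᴴ *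
        (U * Matrix.diagonal (fun i => ((σ i)⁻¹ : ℂ)) * Uᴴ * Aᴴ)ᴴ =
        U * Matrix.diagonal (fun i => if σ i = 0 then (0 : ℂ) else 1) * Uᴴ := by
      calc _ = U * Matrix.diagonal (fun i => ((σ i)⁻¹ : ℂ)) * Uᴴ * (Aᴴ * A) *
            (U * Matrix.diagonal (fun i => ((σ i)⁻¹ : ℂ)) * Uᴴ) := by
            have : (Matrix.diagonal (fun i => ((σ i)⁻¹ : ℂ)))ᴴ =
                Matrix.diagonal (fun i => ((σ i)⁻¹ : ℂ)) := by
              rw [Matrix.diagonal_conjTranspose]; congr 1; ext i; simp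
            simp only [Matrix.conjTranspose_mul, Matrix.conjTranspose_conjTranspose, this,
              Matrix.mul_assoc]
        _ = U * (Matrix.diagonal (fun i => ((σ i)⁻¹ : ℂ)) * ((Uᴴ * U) *
            Matrix.diagonal (fun i => ((σ i ^ 2 : ℝ) : ℂ)) * (Uᴴ * U)) *
            Matrix.diagonal (fun i => ((σ i)⁻¹ : ℂ))) * Uᴴ := by
            rw [hA]; simp only [Matrix.mul_assoc]
        _ = _ := by
            rw [hU, Matrix.one_mul, Matrix.mul_one, Matrix.diagonal_mul_diagonal,
              Matrix.diagonal_mul_diagonal]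
            congr 3
            ext i
            split_ifs with hi
            · simp [hi]
            · have : (σ i : ℂ) ≠ 0 := by exact_mod_cast hi
              push_cast; field_simp
    rw [e]
    constructor
    · rw [Matrix.conjTranspose_mul, Matrix.conjTranspose_mul, Matrix.diagonal_conjTranspose,
        Matrix.conjTranspose_conjTranspose, ← Matrix.mul_assoc]
      congr 3; ext i; simp only [Pi.star_apply]; split_ifs <;> simp
    · have : U * Matrix.diagonal (fun i => if σ i = 0 then (0 : ℂ) else 1) * Uᴴ *
          (U * Matrix.diagonal (fun i => if σ i = 0 then (0 : ℂ) else 1) * Uᴴ) =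
          U * (Matrix.diagonal (fun i => if σ i = 0 then (0 : ℂ) else 1) * (Uᴴ * U) *
          Matrix.diagonal (fun i => if σ i = 0 then (0 : ℂ) else 1)) * Uᴴ := by
        simp only [Matrix.mul_assoc]
      rw [this, hU, Matrix.mul_one, Matrix.diagonal_mul_diagonal]
      congr 3; ext i; split_ifs <;> simp
  · calc _ = (U * (Matrix.diagonal (fun i => ((σ i)⁻¹ : ℂ)) * (Uᴴ * U) *
            Matrix.diagonal (fun i => ((σ i ^ 2 : ℝ) : ℂ))) * Uᴴ).trace := by
            rw [Matrix.mul_assoc _ Aᴴ A, hA]; simp only [Matrix.mul_assoc]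
      _ = _ := by
        rw [Matrix.trace_mul_cycle, hU, Matrix.one_mul, Matrix.mul_one,
          Matrix.diagonal_mul_diagonal, Matrix.trace_diagonal, h]
        push_cast
        refine Finset.sum_congr rfl fun i _ => ?_
        by_cases hi : (σ i : ℂ) = 0
        · simp [hi]
        · field_simp

/-- Every matrix is a product of two matrices with squared Hilbert-Schmidt norm `tr |A|`. -/
theorem exists_factorization (A : Matrix (Fin m) (Fin m) ℂ) :
    ∃ B C, A = B * C ∧ frobSq B = traceAbs A ∧ frobSq C = traceAbs A := by
  obtain ⟨U, σ, hU, hU', h0, hA, h, -⟩ := exists_svd A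
  have hs : ∀ i, (Real.sqrt (σ i) : ℂ) * (Real.sqrt (σ i) : ℂ) = σ i := fun i => by
    exact_mod_cast Real.mul_self_sqrt (h0 i)
  have hd : ∀ f : Fin m → ℝ, (Matrix.diagonal (fun i => (f i : ℂ)))ᴴ =
      Matrix.diagonal (fun i => (f i : ℂ)) := fun f => by
    rw [Matrix.diagonal_conjTranspose]; congr 1; ext i; simp
  refine ⟨A * U * Matrix.diagonal (fun i => (((Real.sqrt (σ i))⁻¹ : ℝ) : ℂ)),
    Matrix.diagonal (fun i => (Real.sqrt (σ i) : ℂ)) * Uᴴ, ?_, ?_, ?_⟩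
  · -- columns of `A * U` with vanishing singular value vanish
    have hz : A * U * Matrix.diagonal (fun i => if σ i = 0 then (1 : ℂ) else 0) = 0 := by
      refine eq_zero_of_frobSq_eq_zero ?_
      rw [frobSq_eq_re_trace]
      have hd' : (Matrix.diagonal (fun i => if σ i = 0 then (1 : ℂ) else 0))ᴴ =
          Matrix.diagonal (fun i => if σ i = 0 then (1 : ℂ) else 0) := by
        rw [Matrix.diagonal_conjTranspose]; congr 1; ext i
        simp only [Pi.star_apply]; split_ifs <;> simp
      calc _ = (Matrix.diagonal (fun i => if σ i = 0 then (1 : ℂ) else 0) *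
          (Uᴴ * (Aᴴ * A) * U) *
          Matrix.diagonal (fun i => if σ i = 0 then (1 : ℂ) else 0)).trace.re := by
            simp only [Matrix.conjTranspose_mul, hd', Matrix.mul_assoc]
        _ = (Matrix.diagonal (fun i => if σ i = 0 then (1 : ℂ) else 0) *
            ((Uᴴ * U) * Matrix.diagonal (fun i => ((σ i ^ 2 : ℝ) : ℂ)) * (Uᴴ * U)) *
            Matrix.diagonal (fun i => if σ i = 0 then (1 : ℂ) else 0)).trace.re := by
            rw [hA]; simp only [Matrix.mul_assoc]
        _ = 0 := by
            rw [hU, Matrix.one_mul, Matrix.mul_one, Matrix.diagonal_mul_diagonal,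
              Matrix.diagonal_mul_diagonal, Matrix.trace_diagonal, Complex.re_sum]
            refine Finset.sum_eq_zero fun i _ => ?_
            by_cases hi : σ i = 0 <;> simp [hi]
    have e : Matrix.diagonal (fun i => (((Real.sqrt (σ i))⁻¹ : ℝ) : ℂ)) *
        Matrix.diagonal (fun i => (Real.sqrt (σ i) : ℂ)) =
        1 - Matrix.diagonal (fun i => if σ i = 0 then (1 : ℂ) else 0) := by
      rw [Matrix.diagonal_mul_diagonal, ← Matrix.diagonal_one, Matrix.diagonal_sub]
      congr 1; ext i
      by_cases hi : σ i = 0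
      · simp [hi]
      · have : (Real.sqrt (σ i) : ℂ) ≠ 0 := by
          exact_mod_cast (Real.sqrt_pos.2 (lt_of_le_of_ne (h0 i) (Ne.symm hi))).ne'
        simp [hi, this]
    calc A = A * (U * Uᴴ) := by rw [hU', Matrix.mul_one]
      _ = A * U * (Matrix.diagonal (fun i => (((Real.sqrt (σ i))⁻¹ : ℝ) : ℂ)) *
        Matrix.diagonal (fun i => (Real.sqrt (σ i) : ℂ))) * Uᴴ := by
          rw [e, Matrix.mul_sub, hz, Matrix.mul_one, sub_zero, Matrix.mul_assoc]
      _ = _ := by simp only [Matrix.mul_assoc]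
  · rw [frobSq_eq_re_trace]
    have : (A * U * Matrix.diagonal (fun i => (((Real.sqrt (σ i))⁻¹ : ℝ) : ℂ)))ᴴ *
        (A * U * Matrix.diagonal (fun i => (((Real.sqrt (σ i))⁻¹ : ℝ) : ℂ))) =
        Matrix.diagonal (fun i => (σ i : ℂ)) := by
      calc _ = Matrix.diagonal (fun i => (((Real.sqrt (σ i))⁻¹ : ℝ) : ℂ)) *
            (Uᴴ * (Aᴴ * A) * U) *
            Matrix.diagonal (fun i => (((Real.sqrt (σ i))⁻¹ : ℝ) : ℂ)) := by
            simp only [Matrix.conjTranspose_mul, hd (fun i => (Real.sqrt (σ i))⁻¹),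
              Matrix.mul_assoc]
        _ = Matrix.diagonal (fun i => (((Real.sqrt (σ i))⁻¹ : ℝ) : ℂ)) *
            ((Uᴴ * U) * Matrix.diagonal (fun i => ((σ i ^ 2 : ℝ) : ℂ)) * (Uᴴ * U)) *
            Matrix.diagonal (fun i => (((Real.sqrt (σ i))⁻¹ : ℝ) : ℂ)) := by
            rw [hA]; simp only [Matrix.mul_assoc]
        _ = _ := by
            rw [hU, Matrix.one_mul, Matrix.mul_one, Matrix.diagonal_mul_diagonal,
              Matrix.diagonal_mul_diagonal]
            congr 1; ext i
            rw [← Complex.ofReal_mul, ← Complex.ofReal_mul]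
            congr 1
            have h2 := Real.mul_self_sqrt (h0 i)
            by_cases hi : Real.sqrt (σ i) = 0
            · rw [hi] at h2 ⊢; simp [← h2]
            · field_simp; nlinarith [h2]
    rw [this, Matrix.trace_diagonal, h]; simp
  · rw [frobSq_eq_re_trace']
    have : Matrix.diagonal (fun i => (Real.sqrt (σ i) : ℂ)) * Uᴴ *
        (Matrix.diagonal (fun i => (Real.sqrt (σ i) : ℂ)) * Uᴴ)ᴴ =
        Matrix.diagonal (fun i => (σ i : ℂ)) := by
      calc _ = Matrix.diagonal (fun i => (Real.sqrt (σ i) : ℂ)) * (Uᴴ * U) *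
            Matrix.diagonal (fun i => (Real.sqrt (σ i) : ℂ)) := by
            simp only [Matrix.conjTranspose_mul, hd, Matrix.conjTranspose_conjTranspose,
              Matrix.mul_assoc]
        _ = _ := by
            rw [hU, Matrix.mul_one, Matrix.diagonal_mul_diagonal]; simp only [hs]
    rw [this, Matrix.trace_diagonal, h]; simp

/-- One half of the duality between the trace norm and contractions. -/
theorem IsContr.norm_trace_mul_le {X : Matrix (Fin m) (Fin m) ℂ} (hX : IsContr X)
    (A : Matrix (Fin m) (Fin m) ℂ) : ‖(X * A).trace‖ ≤ traceAbs A := by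
  obtain ⟨B, C, rfl, hB, hC⟩ := exists_factorization A
  rw [← Matrix.mul_assoc]
  refine (_root_.norm_trace_mul_le _ _).trans ?_
  calc _ ≤ Real.sqrt (frobSq B) * Real.sqrt (frobSq C) := by
        gcongr; exact (hX B).1
    _ = _ := by rw [hB, hC, Real.mul_self_sqrt (traceAbs_nonneg _)]

/-- The other half of the duality: trace norms are estimated by testing against contractions. -/
theorem traceAbs_le_of_forall {A : Matrix (Fin m) (Fin m) ℂ} {c : ℝ}
    (h : ∀ X, IsContr X → ‖(X * A).trace‖ ≤ c) : traceAbs A ≤ c := by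
  obtain ⟨X, hX, hXA⟩ := exists_isContr_trace_eq A
  have := h X hX
  rw [hXA, Complex.norm_real, Real.norm_of_nonneg (traceAbs_nonneg A)] at this
  exact this

theorem traceAbs_add_le (A B : Matrix (Fin m) (Fin m) ℂ) :
    traceAbs (A + B) ≤ traceAbs A + traceAbs B := by
  refine traceAbs_le_of_forall fun X hX => ?_
  rw [Matrix.mul_add, Matrix.trace_add]
  exact (norm_add_le _ _).trans (add_le_add (hX.norm_trace_mul_le A) (hX.norm_trace_mul_le B))

theorem traceAbs_smul_le (c : ℂ) (A : Matrix (Fin m) (Fin m) ℂ) :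
    traceAbs (c • A) ≤ ‖c‖ * traceAbs A := by
  refine traceAbs_le_of_forall fun X hX => ?_
  rw [Matrix.mul_smul, Matrix.trace_smul, smul_eq_mul, norm_mul]
  gcongr; exact hX.norm_trace_mul_le A

theorem traceAbs_zero : traceAbs (0 : Matrix (Fin m) (Fin m) ℂ) = 0 :=
  le_antisymm (traceAbs_le_of_forall fun X _ => by simp) (traceAbs_nonneg _)

theorem traceAbs_sum_le {ι : Type*} (s : Finset ι) (A : ι → Matrix (Fin m) (Fin m) ℂ) :
    traceAbs (∑ i ∈ s, A i) ≤ ∑ i ∈ s, traceAbs (A i) :=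
  Finset.le_sum_of_subadditive _ traceAbs_zero.le traceAbs_add_le _ _

theorem traceAbs_conjTranspose_mul_self_le (B : Matrix (Fin m) (Fin m) ℂ) :
    traceAbs (Bᴴ * B) ≤ frobSq B := by
  refine traceAbs_le_of_forall fun X hX => ?_
  rw [← Matrix.mul_assoc]
  refine (_root_.norm_trace_mul_le _ _).trans ?_
  calc _ ≤ Real.sqrt (frobSq B) * Real.sqrt (frobSq B) := by
        gcongr; rw [← frobSq_conjTranspose B]; exact (hX _).1
    _ = _ := Real.mul_self_sqrt (frobSq_nonneg _)

theorem traceAbs_le_sum_entries (A : Matrix (Fin m) (Fin m) ℂ) :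
    traceAbs A ≤ ∑ i, ∑ j, ‖A i j‖ := by
  have hA : A = ∑ i, ∑ j, A i j • Matrix.single i j (1 : ℂ) := by
    conv_lhs => rw [Matrix.matrix_eq_sum_single A]
    simp
  conv_lhs => rw [hA]
  refine (traceAbs_sum_le _ _).trans (Finset.sum_le_sum fun i _ => ?_)
  refine (traceAbs_sum_le _ _).trans (Finset.sum_le_sum fun j _ => ?_)
  refine (traceAbs_smul_le _ _).trans (mul_le_of_le_one_right (norm_nonneg _) ?_)
  have : Matrix.single i j (1 : ℂ) = Matrix.single i i 1 * Matrix.single i j 1 := by simp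
  refine traceAbs_le_of_forall fun X hX => ?_
  rw [this, ← Matrix.mul_assoc]
  refine (_root_.norm_trace_mul_le _ _).trans ?_
  have e : ∀ a b : Fin m, frobSq (Matrix.single a b (1 : ℂ)) = 1 := by
    intro a b
    rw [frobSq_eq_re_trace]; simp
  calc _ ≤ Real.sqrt (frobSq (Matrix.single i i (1 : ℂ))) *
        Real.sqrt (frobSq (Matrix.single i j (1 : ℂ))) := by
        gcongr; exact (hX _).1
    _ ≤ 1 := by simp [e]

end traceAbs

/-! ### The level function, polarization and spectral cuts -/

section level
variable {m : ℕ}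

theorem frobSq_unitary_conj {U : Matrix (Fin m) (Fin m) ℂ} (hU : U * Uᴴ = 1)
    (Z : Matrix (Fin m) (Fin m) ℂ) : frobSq (Uᴴ * Z) = frobSq Z := by
  rw [frobSq_eq_re_trace, frobSq_eq_re_trace, Matrix.conjTranspose_mul,
    Matrix.conjTranspose_conjTranspose, Matrix.mul_assoc, ← Matrix.mul_assoc U, hU, Matrix.one_mul]

theorem traceLevel_nonneg (A : Matrix (Fin m) (Fin m) ℂ) (s : ℝ) : 0 ≤ traceLevel A s := by
  obtain ⟨U, σ, hU, hU', h0, hA, -, h⟩ := exists_svd A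
  rw [h]; positivity

theorem traceLevel_le (A : Matrix (Fin m) (Fin m) ℂ) (s : ℝ) : traceLevel A s ≤ m := by
  obtain ⟨U, σ, hU, hU', h0, hA, -, h⟩ := exists_svd A
  rw [h]
  exact_mod_cast (Finset.card_filter_le _ _).trans (by simp)

/-- Chebyshev's inequality for the trace norm. -/
theorem mul_traceLevel_le_traceAbs (A : Matrix (Fin m) (Fin m) ℂ) (s : ℝ) :
    s * traceLevel A s ≤ traceAbs A := by
  obtain ⟨U, σ, hU, hU', h0, hA, h', h⟩ := exists_svd A
  rw [h, h', mul_comm, ← nsmul_eq_mul]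
  refine (Finset.card_nsmul_le_sum _ _ _ fun i hi => (Finset.mem_filter.1 hi).2.le).trans ?_
  exact Finset.sum_le_sum_of_subset_of_nonneg (Finset.filter_subset _ _) fun i _ _ => h0 i

theorem exists_singular (A : Matrix (Fin m) (Fin m) ℂ) : ∃ σ : Fin m → ℝ, (∀ i, 0 ≤ σ i) ∧
    frobSq A = ∑ i, σ i ^ 2 ∧
    ∀ s, traceLevel A s = ((Finset.univ.filter fun i => s < σ i).card : ℝ) := by
  obtain ⟨U, σ, hU, hU', h0, hA, h', h⟩ := exists_svd A
  refine ⟨σ, h0, ?_, h⟩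
  rw [frobSq_eq_re_trace, hA, Matrix.trace_mul_cycle, hU, Matrix.one_mul, Matrix.trace_diagonal,
    Complex.re_sum]
  simp only [Complex.ofReal_re]

/-- Chebyshev's inequality for the Hilbert-Schmidt norm. -/
theorem sq_mul_traceLevel_le_frobSq (A : Matrix (Fin m) (Fin m) ℂ) {s : ℝ} (hs : 0 ≤ s) :
    s ^ 2 * traceLevel A s ≤ frobSq A := by
  obtain ⟨σ, h0, h', h⟩ := exists_singular A
  rw [h, h', mul_comm, ← nsmul_eq_mul]
  refine (Finset.card_nsmul_le_sum _ (fun i => σ i ^ 2) _ fun i hi => ?_).trans ?_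
  · have := (Finset.mem_filter.1 hi).2
    gcongr
  · exact Finset.sum_le_sum_of_subset_of_nonneg (Finset.filter_subset _ _)
      fun i _ _ => sq_nonneg _

theorem traceLevel_eq_zero {A : Matrix (Fin m) (Fin m) ℂ} {s : ℝ} (hs : 0 ≤ s)
    (hA : frobSq A ≤ s ^ 2) : traceLevel A s = 0 := by
  obtain ⟨σ, h0, h', h⟩ := exists_singular A
  rw [h, Nat.cast_eq_zero, Finset.card_eq_zero, Finset.filter_eq_empty_iff]
  intro i _ hi
  have : σ i ^ 2 ≤ frobSq A := by
    rw [h']; exact Finset.single_le_sum (fun i _ => sq_nonneg (σ i)) (Finset.mem_univ i)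
  nlinarith

theorem one_le_traceLevel_of_lt {a : ℂ} {s : ℝ} (h : s < ‖a‖) :
    1 ≤ traceLevel (Matrix.of fun _ _ : Fin 1 => a) s := by
  obtain ⟨σ, h0, h', hl⟩ := exists_singular (Matrix.of fun _ _ : Fin 1 => a)
  rw [hl]
  have : ‖a‖ = σ 0 := by
    simp only [frobSq, Finset.univ_unique, Finset.sum_singleton, Matrix.of_apply] at h'
    exact (sq_eq_sq₀ (norm_nonneg _) (h0 _)).1 h'
  have : (Finset.univ.filter fun i => s < σ i) = Finset.univ := by
    refine Finset.filter_true_of_mem fun i _ => ?_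
    rw [Subsingleton.elim i 0, ← this]; exact h
  rw [this]; simp

/-- The Euclidean norm of a vector of coordinates. -/
def vecNorm (v : Fin m → ℂ) : ℝ := ‖WithLp.toLp 2 v‖

theorem vecNorm_sq (v : Fin m → ℂ) : vecNorm v ^ 2 = ∑ i, ‖v i‖ ^ 2 := by
  rw [vecNorm, EuclideanSpace.norm_sq_eq]

/-- The vectors whose coordinates in the basis of the columns of `U` vanish on `P` form a subspace
of codimension at most the cardinality of `P`. -/
theorem finrank_coords_ge (U : Matrix (Fin m) (Fin m) ℂ) (P : Fin m → Prop) [DecidablePred P] :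
    ∃ K : Submodule ℂ (Fin m → ℂ), (∀ v, v ∈ K ↔ ∀ i, P i → (Uᴴ *ᵥ v) i = 0) ∧
      m ≤ Module.finrank ℂ K + (Finset.univ.filter P).card := by
  let φ : (Fin m → ℂ) →ₗ[ℂ] ({i // P i} → ℂ) :=
    (LinearMap.funLeft ℂ ℂ (Subtype.val : {i // P i} → Fin m)) ∘ₗ Matrix.mulVecLin Uᴴ
  refine ⟨LinearMap.ker φ, fun v => ?_, ?_⟩
  · rw [LinearMap.mem_ker, funext_iff]
    simp [φ, LinearMap.funLeft_apply]
  · have h1 := φ.finrank_range_add_finrank_ker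
    have h2 := (LinearMap.range φ).finrank_le
    simp only [Module.finrank_fintype_fun_eq_card, Fintype.card_fin] at h1 h2
    have h3 : Fintype.card {i // P i} = (Finset.univ.filter P).card := by
      rw [Fintype.card_subtype]
    rw [h3] at h2
    omega

theorem vecNorm_sq_of_svd {A U : Matrix (Fin m) (Fin m) ℂ} {σ : Fin m → ℝ}
    (hA : Aᴴ * A = U * Matrix.diagonal (fun i => ((σ i ^ 2 : ℝ) : ℂ)) * Uᴴ) (v : Fin m → ℂ) :
    vecNorm (A *ᵥ v) ^ 2 = ∑ i, σ i ^ 2 * ‖(Uᴴ *ᵥ v) i‖ ^ 2 := by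
  have h0 : ∀ w : Fin m → ℂ, (vecNorm w ^ 2 : ℝ) = (star w ⬝ᵥ w).re := by
    intro w
    rw [vecNorm_sq]; simp [dotProduct, Complex.conj_mul', ← Complex.ofReal_pow]
  have e : star (A *ᵥ v) ⬝ᵥ (A *ᵥ v) =
      star (Uᴴ *ᵥ v) ⬝ᵥ (Matrix.diagonal (fun i => ((σ i ^ 2 : ℝ) : ℂ)) *ᵥ (Uᴴ *ᵥ v)) := by
    rw [Matrix.star_mulVec, Matrix.star_mulVec, Matrix.conjTranspose_conjTranspose,
      ← Matrix.dotProduct_mulVec, ← Matrix.dotProduct_mulVec, Matrix.mulVec_mulVec,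
      Matrix.mulVec_mulVec, Matrix.mulVec_mulVec, hA]
  rw [h0, e]
  simp only [dotProduct, Matrix.mulVec_diagonal, Complex.re_sum]
  refine Finset.sum_congr rfl fun i _ => ?_
  have : star (Uᴴ *ᵥ v) i * (((σ i ^ 2 : ℝ) : ℂ) * (Uᴴ *ᵥ v) i) =
      ((σ i ^ 2 * ‖(Uᴴ *ᵥ v) i‖ ^ 2 : ℝ) : ℂ) := by
    rw [Pi.star_apply, mul_left_comm, Complex.star_def, Complex.conj_mul']; push_cast; ring
  rw [this, Complex.ofReal_re]

theorem vecNorm_sq_unitary {U : Matrix (Fin m) (Fin m) ℂ} (hU' : U * Uᴴ = 1) (v : Fin m → ℂ) :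
    vecNorm v ^ 2 = ∑ i, ‖(Uᴴ *ᵥ v) i‖ ^ 2 := by
  have := vecNorm_sq_of_svd (A := 1) (U := U) (σ := fun _ => 1) (by
    have : (Matrix.diagonal fun _ : Fin m => (((1 : ℝ) ^ 2 : ℝ) : ℂ)) = 1 := by
      ext i j; simp [Matrix.one_apply, Matrix.diagonal_apply]
    rw [this]; simp [hU']) v
  simpa using this

/-- The subspace spanned by the small singular directions. -/
theorem exists_small_subspace (A : Matrix (Fin m) (Fin m) ℂ) {s : ℝ} (hs : 0 ≤ s) :
    ∃ K : Submodule ℂ (Fin m → ℂ), (∀ v ∈ K, vecNorm (A *ᵥ v) ≤ s * vecNorm v) ∧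
      (m : ℝ) ≤ Module.finrank ℂ K + traceLevel A s := by
  obtain ⟨U, σ, hU, hU', h0, hA, -, h⟩ := exists_svd A
  obtain ⟨K, hK, hm⟩ := finrank_coords_ge U (fun i => s < σ i)
  refine ⟨K, fun v hv => ?_, by rw [h]; exact_mod_cast hm⟩
  refine (pow_le_pow_iff_left₀ (norm_nonneg _) (mul_nonneg hs (norm_nonneg _)) two_ne_zero).1 ?_
  change vecNorm (A *ᵥ v) ^ 2 ≤ (s * vecNorm v) ^ 2
  rw [mul_pow, vecNorm_sq_of_svd hA, vecNorm_sq_unitary hU', Finset.mul_sum]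
  refine Finset.sum_le_sum fun i _ => ?_
  by_cases hi : s < σ i
  · rw [(hK v).1 hv i hi]; simp
  · have := h0 i
    have := not_lt.1 hi
    gcongr

/-- Minimax: a subspace on which `A` is bounded by `s` has codimension at least the number of
singular values that exceed `s`. -/
theorem finrank_add_traceLevel_le (A : Matrix (Fin m) (Fin m) ℂ) {s : ℝ} (hs : 0 ≤ s)
    (K : Submodule ℂ (Fin m → ℂ)) (hK : ∀ v ∈ K, vecNorm (A *ᵥ v) ≤ s * vecNorm v) :
    Module.finrank ℂ K + traceLevel A s ≤ m := by
  obtain ⟨U, σ, hU, hU', h0, hA, -, h⟩ := exists_svd A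
  obtain ⟨V, hV, hm⟩ := finrank_coords_ge U (fun i => ¬ s < σ i)
  have hdisj : Disjoint K V := by
    rw [Submodule.disjoint_def]
    intro v hvK hvV
    by_contra hv
    have h1 := hK v hvK
    have h2 : (s * vecNorm v) ^ 2 < vecNorm (A *ᵥ v) ^ 2 := by
      rw [mul_pow, vecNorm_sq_of_svd hA, vecNorm_sq_unitary hU', Finset.mul_sum]
      have hne : Uᴴ *ᵥ v ≠ 0 := by
        intro h3
        apply hv
        rw [← Matrix.one_mulVec v, ← hU', ← Matrix.mulVec_mulVec, h3, Matrix.mulVec_zero]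
      obtain ⟨i, hi⟩ := Function.ne_iff.1 hne
      refine Finset.sum_lt_sum (fun j _ => ?_) ⟨i, Finset.mem_univ i, ?_⟩
      · by_cases hj : s < σ j
        · gcongr
        · rw [(hV v).1 hvV j hj]; simp
      · have hi' : s < σ i := by
          by_contra hc; exact hi ((hV v).1 hvV i hc)
        have : 0 < ‖(Uᴴ *ᵥ v) i‖ := norm_pos_iff.2 hi
        gcongr
    have h3 : (0 : ℝ) ≤ vecNorm (A *ᵥ v) := norm_nonneg _
    exact absurd (pow_le_pow_left₀ h3 h1 2) (not_le.2 h2)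
  have h1 := Submodule.finrank_add_finrank_le_of_disjoint hdisj
  have h2 := Finset.card_filter_add_card_filter_not (s := (Finset.univ : Finset (Fin m)))
    (fun i => s < σ i)
  simp only [Module.finrank_fintype_fun_eq_card, Fintype.card_fin, Finset.card_univ] at h1 h2
  rw [h]
  have : Module.finrank ℂ K + (Finset.univ.filter fun i => s < σ i).card ≤ m := by omega
  exact_mod_cast this

/-- Subadditivity of the level function: on the intersection of a subspace where `A` is bounded by
`s` with one where `B` is bounded by `t`, the sum is bounded by `s + t`, and codimensions add up. -/
theorem traceLevel_add_le (A B : Matrix (Fin m) (Fin m) ℂ) {s t : ℝ} (hs : 0 ≤ s) (ht : 0 ≤ t) :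
    traceLevel (A + B) (s + t) ≤ traceLevel A s + traceLevel B t := by
  obtain ⟨K, hK, hKm⟩ := exists_small_subspace A hs
  obtain ⟨L, hL, hLm⟩ := exists_small_subspace B ht
  have h1 := finrank_add_traceLevel_le (A + B) (add_nonneg hs ht) (K ⊓ L) (by
    intro v hv
    rw [Matrix.add_mulVec, add_mul]
    refine le_trans ?_ (add_le_add (hK v hv.1) (hL v hv.2))
    rw [vecNorm, WithLp.toLp_add]
    exact norm_add_le _ _)
  have h2 := Submodule.finrank_sup_add_finrank_inf_eq K L
  have h3 := (K ⊔ L).finrank_le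
  simp only [Module.finrank_fintype_fun_eq_card, Fintype.card_fin] at h3
  have h4 : (Module.finrank ℂ K : ℝ) + Module.finrank ℂ L ≤ m + Module.finrank ℂ ↥(K ⊓ L) := by
    exact_mod_cast (by omega)
  linarith

theorem traceLevel_zero_le_rank (A : Matrix (Fin m) (Fin m) ℂ) : traceLevel A 0 ≤ A.rank := by
  have h := finrank_add_traceLevel_le A le_rfl (LinearMap.ker A.mulVecLin) (by
    intro v hv
    rw [LinearMap.mem_ker, Matrix.mulVecLin_apply] at hv
    simp [hv, vecNorm])
  have h1 := A.mulVecLin.finrank_range_add_finrank_ker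
  simp only [Module.finrank_fintype_fun_eq_card, Fintype.card_fin] at h1
  have h2 : (A.rank : ℝ) + Module.finrank ℂ (LinearMap.ker A.mulVecLin) = m := by
    exact_mod_cast h1
  linarith

/-- A perturbation of rank `r` changes the number of large singular values by at most `r`. -/
theorem traceLevel_add_le_rank (A B : Matrix (Fin m) (Fin m) ℂ) {s : ℝ} (hs : 0 ≤ s) :
    traceLevel (A + B) s ≤ A.rank + traceLevel B s := by
  have := traceLevel_add_le A B le_rfl hs
  rw [zero_add] at this
  linarith [traceLevel_zero_le_rank A]

theorem rank_add_le (A B : Matrix (Fin m) (Fin m) ℂ) : (A + B).rank ≤ A.rank + B.rank := by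
  unfold Matrix.rank
  rw [Matrix.mulVecLin_add]
  refine (Submodule.finrank_mono (LinearMap.range_add_le _ _)).trans ?_
  exact Submodule.finrank_add_le_finrank_add_finrank _ _

theorem rank_sum_le {ι : Type*} (S : Finset ι) (A : ι → Matrix (Fin m) (Fin m) ℂ) :
    (∑ i ∈ S, A i).rank ≤ ∑ i ∈ S, (A i).rank :=
  Finset.le_sum_of_subadditive _ (by simp) rank_add_le _ _

end level

/-- Polarization: a matrix is a combination, with coefficients `i ^ l`, of four positive matrices
whose traces do not exceed its trace norm. -/
theorem exists_polarization {m : ℕ} (A : Matrix (Fin m) (Fin m) ℂ) :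
    ∃ B : Fin 4 → Matrix (Fin m) (Fin m) ℂ,
      A = ∑ l : Fin 4, Complex.I ^ (l : ℕ) • ((B l)ᴴ * B l) ∧ ∀ l, frobSq (B l) ≤ traceAbs A := by
  obtain ⟨B, C, rfl, hB, hC⟩ := exists_factorization A
  refine ⟨fun l => ((1 / 2 : ℝ) : ℂ) • (B + Complex.I ^ (l : ℕ) • Cᴴ)ᴴ, ?_, fun l => ?_⟩
  · simp only [Fin.sum_univ_four, Matrix.conjTranspose_add, Matrix.conjTranspose_smul,
      Matrix.conjTranspose_conjTranspose, Matrix.mul_add, Matrix.add_mul, smul_add,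
      Matrix.smul_mul, Matrix.mul_smul, smul_smul]
    simp only [Fin.val_zero, Fin.val_one, Fin.val_two, pow_zero, pow_one, Complex.I_sq,
      star_one, star_neg, Complex.star_def, Complex.conj_I, Complex.conj_ofReal,
      show ((3 : Fin 4) : ℕ) = 3 from rfl, Complex.I_pow_three]
    match_scalars <;> apply Complex.ext <;> simp <;> norm_num
  · rw [frobSq_smul, frobSq_conjTranspose]
    have h := frobSq_add_le B (Complex.I ^ (l : ℕ) • Cᴴ)
    rw [frobSq_smul, frobSq_conjTranspose, hB, hC] at h
    simp only [norm_pow, Complex.norm_I, one_pow, one_mul] at h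
    norm_num
    linarith

section rowColumn
variable {m : ℕ} {ι : Type*}

/-- A weighted Cauchy-Schwarz inequality for families of matrices. -/
theorem norm_sum_trace_mul_le (S : Finset ι) (κ : ι → ℂ) (w : ι → ℝ) (hw : ∀ i ∈ S, 0 < w i)
    (C D : ι → Matrix (Fin m) (Fin m) ℂ) {Γ : ℝ} (hD : ∑ i ∈ S, w i * frobSq (D i) ≤ Γ) :
    ‖∑ i ∈ S, κ i * (C i * D i).trace‖ ≤
      Real.sqrt (Γ * ∑ i ∈ S, ‖κ i‖ ^ 2 / w i * frobSq (C i)) := by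
  have hS : 0 ≤ ∑ i ∈ S, ‖κ i‖ ^ 2 / w i * frobSq (C i) :=
    Finset.sum_nonneg fun i hi => mul_nonneg (div_nonneg (by positivity) (hw i hi).le)
      (frobSq_nonneg _)
  calc _ ≤ ∑ i ∈ S, (‖κ i‖ / Real.sqrt (w i) * Real.sqrt (frobSq (C i))) *
        (Real.sqrt (w i) * Real.sqrt (frobSq (D i))) := by
        refine (norm_sum_le _ _).trans (Finset.sum_le_sum fun i hi => ?_)
        rw [norm_mul]
        have h0 : Real.sqrt (w i) ≠ 0 := (Real.sqrt_pos.2 (hw i hi)).ne'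
        calc _ ≤ ‖κ i‖ * (Real.sqrt (frobSq (C i)) * Real.sqrt (frobSq (D i))) := by
              gcongr; exact norm_trace_mul_le _ _
          _ = _ := by field_simp
    _ ≤ Real.sqrt (∑ i ∈ S, (‖κ i‖ / Real.sqrt (w i) * Real.sqrt (frobSq (C i))) ^ 2) *
        Real.sqrt (∑ i ∈ S, (Real.sqrt (w i) * Real.sqrt (frobSq (D i))) ^ 2) :=
        Real.sum_mul_le_sqrt_mul_sqrt _ _ _
    _ = Real.sqrt (∑ i ∈ S, ‖κ i‖ ^ 2 / w i * frobSq (C i)) *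
        Real.sqrt (∑ i ∈ S, w i * frobSq (D i)) := by
        congr 2 <;> refine Finset.sum_congr rfl fun i hi => ?_
        · rw [mul_pow, div_pow, Real.sq_sqrt (hw i hi).le, Real.sq_sqrt (frobSq_nonneg _)]
        · rw [mul_pow, Real.sq_sqrt (hw i hi).le, Real.sq_sqrt (frobSq_nonneg _)]
    _ ≤ Real.sqrt (∑ i ∈ S, ‖κ i‖ ^ 2 / w i * frobSq (C i)) * Real.sqrt Γ := by gcongr
    _ = _ := by rw [mul_comm, Real.sqrt_mul' _ hS]

variable (S : Finset ι) (κ : ι → ℂ) (w : ι → ℝ) (B : ι → Matrix (Fin m) (Fin m) ℂ)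
  {p q : Matrix (Fin m) (Fin m) ℂ} {Λ : ℝ}

/-- The row-column estimate: in an off-diagonal term `p (∑ κ f) q`, the column `f ^ (1/2) q` is
bounded in operator norm and the row `p f ^ (1/2)` in the Hilbert-Schmidt norm. -/
theorem traceAbs_offDiag_le (hw : ∀ i ∈ S, 0 < w i) (hp : IsProj p) (hΛ : 0 ≤ Λ)
    (hq : ∀ Z, ∑ i ∈ S, w i * frobSq (B i * q * Z) ≤ Λ * frobSq Z) :
    traceAbs (∑ i ∈ S, κ i • (p * ((B i)ᴴ * B i) * q)) ≤
      Real.sqrt (Λ * frobSq p * ∑ i ∈ S, ‖κ i‖ ^ 2 / w i * frobSq (B i * p)) := by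
  refine traceAbs_le_of_forall fun X hX => ?_
  have e : (X * ∑ i ∈ S, κ i • (p * ((B i)ᴴ * B i) * q)).trace =
      ∑ i ∈ S, κ i * ((B i * p)ᴴ * (B i * q * (X * p))).trace := by
    rw [Matrix.mul_sum, Matrix.trace_sum]
    refine Finset.sum_congr rfl fun i _ => ?_
    rw [Matrix.mul_smul, Matrix.trace_smul, smul_eq_mul, Matrix.conjTranspose_mul, hp.1]
    congr 1
    calc _ = (X * (p * p) * ((B i)ᴴ * B i) * q).trace := by
          rw [hp.2]; simp only [Matrix.mul_assoc]
      _ = ((X * p) * (p * (B i)ᴴ * (B i * q))).trace := by simp only [Matrix.mul_assoc]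
      _ = _ := by rw [Matrix.trace_mul_comm]; simp only [Matrix.mul_assoc]
  rw [e]
  have h := norm_sum_trace_mul_le S κ w hw (fun i => (B i * p)ᴴ) (fun i => B i * q * (X * p))
    ((hq (X * p)).trans (mul_le_mul_of_nonneg_left (hX p).1 hΛ))
  simpa only [frobSq_conjTranspose] using h

/-- The mirror image of `traceAbs_offDiag_le`, with the two projections exchanged. -/
theorem traceAbs_offDiag_le' (hw : ∀ i ∈ S, 0 < w i) (hp : IsProj p)
    (hq' : IsProj q) (hΛ : 0 ≤ Λ)
    (hq : ∀ Z, ∑ i ∈ S, w i * frobSq (B i * q * Z) ≤ Λ * frobSq Z) :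
    traceAbs (∑ i ∈ S, κ i • (q * ((B i)ᴴ * B i) * p)) ≤
      Real.sqrt (Λ * frobSq p * ∑ i ∈ S, ‖κ i‖ ^ 2 / w i * frobSq (B i * p)) := by
  refine traceAbs_le_of_forall fun X hX => ?_
  have e : (X * ∑ i ∈ S, κ i • (q * ((B i)ᴴ * B i) * p)).trace =
      ∑ i ∈ S, κ i * ((B i * p) * (B i * q * (p * X)ᴴ)ᴴ).trace := by
    rw [Matrix.mul_sum, Matrix.trace_sum]
    refine Finset.sum_congr rfl fun i _ => ?_
    rw [Matrix.mul_smul, Matrix.trace_smul, smul_eq_mul, Matrix.conjTranspose_mul,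
      Matrix.conjTranspose_conjTranspose, Matrix.conjTranspose_mul, hq'.1]
    congr 1
    calc _ = ((X * q * (B i)ᴴ) * (B i * (p * p))).trace := by
          rw [hp.2]; simp only [Matrix.mul_assoc]
      _ = (B i * p * (p * (X * q * (B i)ᴴ))).trace := by
          rw [Matrix.trace_mul_comm]; simp only [Matrix.mul_assoc]
      _ = _ := by simp only [Matrix.mul_assoc]
  rw [e]
  refine norm_sum_trace_mul_le S κ w hw _ _ ((?_ : _ ≤ Λ * frobSq p)) |>.trans le_rfl
  simp only [frobSq_conjTranspose (B _ * q * (p * X)ᴴ)]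
  refine (hq _).trans ?_
  rw [frobSq_conjTranspose]
  gcongr; exact (hX p).2

end rowColumn

section cut
variable {m : ℕ}

/-- The properties of `p`, the spectral projection of `q f q` for the interval `(lam, ∞)`, that
the Cuculescu construction uses. -/
structure IsCut (lam : ℝ) (q f p : Matrix (Fin m) (Fin m) ℂ) : Prop where
  isProj : IsProj p
  mul_left : p * q = p
  mul_right : q * p = p
  offDiag : p * f * (q - p) = 0
  offDiag' : (q - p) * f * p = 0
  le : ∀ Z, (Zᴴ * ((q - p) * f * (q - p)) * Z).trace.re ≤ lam * frobSq Z
  rank_le : (p.rank : ℝ) ≤ frobSq p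
  mul_frobSq_le : lam * frobSq p ≤ (p * f * p).trace.re

/-- Spectral projections of `q * f * q` for `(lam, ∞)` exist: they are cut out of the eigenvectors.
-/
theorem exists_cut {lam : ℝ} (hl : 0 < lam) {q f : Matrix (Fin m) (Fin m) ℂ} (hq : IsProj q)
    (hf : fᴴ = f) : ∃ p, IsCut lam q f p := by
  set g := q * f * q with hg
  have hgH : g.IsHermitian := by
    change gᴴ = g
    rw [hg, Matrix.conjTranspose_mul, Matrix.conjTranspose_mul, hq.1, hf, Matrix.mul_assoc]
  set U : Matrix (Fin m) (Fin m) ℂ := (hgH.eigenvectorUnitary : Matrix (Fin m) (Fin m) ℂ)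
  set D := hgH.eigenvalues
  have hU : Uᴴ * U = 1 := Matrix.mem_unitaryGroup_iff'.1 hgH.eigenvectorUnitary.2
  have hU' : U * Uᴴ = 1 := Matrix.mem_unitaryGroup_iff.1 hgH.eigenvectorUnitary.2
  let dc : (Fin m → ℝ) → Matrix (Fin m) (Fin m) ℂ := fun d =>
    U * Matrix.diagonal (fun i => (d i : ℂ)) * Uᴴ
  have dc_mul : ∀ d e, dc d * dc e = dc (fun i => d i * e i) := by
    intro d e
    calc _ = U * (Matrix.diagonal (fun i => (d i : ℂ)) * (Uᴴ * U) *
          Matrix.diagonal (fun i => (e i : ℂ))) * Uᴴ := by simp only [dc, Matrix.mul_assoc]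
      _ = _ := by rw [hU, Matrix.mul_one, Matrix.diagonal_mul_diagonal]; simp [dc]
  have dc_H : ∀ d, (dc d)ᴴ = dc d := by
    intro d
    have : (Matrix.diagonal (fun i => (d i : ℂ)))ᴴ = Matrix.diagonal (fun i => (d i : ℂ)) := by
      rw [Matrix.diagonal_conjTranspose]; congr 1; ext i; simp
    simp only [dc, Matrix.conjTranspose_mul, Matrix.conjTranspose_conjTranspose, this,
      Matrix.mul_assoc]
  have dc_tr : ∀ d, (dc d).trace.re = ∑ i, d i := by
    intro d
    simp only [dc]
    rw [Matrix.trace_mul_cycle, hU, Matrix.one_mul, Matrix.trace_diagonal]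
    simp
  have hgD : g = dc D := by
    have := hgH.spectral_theorem
    rw [Unitary.conjStarAlgAut_apply] at this
    exact this
  have hqg : q * g = g := by
    rw [hg, ← Matrix.mul_assoc, ← Matrix.mul_assoc, hq.2]
  have hgq : g * q = g := by rw [hg, Matrix.mul_assoc, hq.2]
  set χ : Fin m → ℝ := fun i => if lam < D i then 1 else 0 with hχ
  have hχχ : ∀ i, χ i * χ i = χ i := fun i => by simp [hχ]
  set p := dc χ with hp
  have hpp : IsProj p := ⟨dc_H _, by rw [hp, dc_mul]; simp only [hχχ]⟩
  have hpg : p = dc (fun i => χ i * (D i)⁻¹) * g := by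
    rw [hgD, dc_mul, hp]
    congr 1; ext i
    by_cases hi : lam < D i
    · have : D i ≠ 0 := (hl.trans hi).ne'
      simp [hχ, hi, this]
    · simp [hχ, hi]
  have hpq : p * q = p := by rw [hpg, Matrix.mul_assoc, hgq]
  have hqp : q * p = p := by
    have := congrArg Matrix.conjTranspose hpq
    rwa [Matrix.conjTranspose_mul, hpp.1, hq.1] at this
  have hcomm : p * g = g * p := by
    rw [hgD, hp, dc_mul, dc_mul]; congr 1; ext i; ring
  have hq1 : q * (q - p) = q - p := by rw [Matrix.mul_sub, hq.2, hqp]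
  have hq2 : (q - p) * q = q - p := by rw [Matrix.sub_mul, hq.2, hpq]
  have hpq' : p * (q - p) = 0 := by rw [Matrix.mul_sub, hpq, hpp.2, sub_self]
  have hq'p : (q - p) * p = 0 := by rw [Matrix.sub_mul, hqp, hpp.2, sub_self]
  have hpfp : p * f * p = dc (fun i => χ i * D i) := by
    calc p * f * p = (p * q) * f * (q * p) := by rw [hpq, hqp]
      _ = p * g * p := by rw [hg]; simp only [Matrix.mul_assoc]
      _ = g * p := by rw [hcomm, Matrix.mul_assoc, hpp.2]
      _ = _ := by rw [hgD, hp, dc_mul]; congr 1; ext i; ring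
  refine ⟨p, hpp, hpq, hqp, ?_, ?_, fun Z => ?_, ?_, ?_⟩
  · calc p * f * (q - p) = (p * q) * f * (q * (q - p)) := by rw [hpq, hq1]
      _ = p * g * (q - p) := by rw [hg]; simp only [Matrix.mul_assoc]
      _ = 0 := by rw [hcomm, Matrix.mul_assoc, hpq', Matrix.mul_zero]
  · calc (q - p) * f * p = ((q - p) * q) * f * (q * p) := by rw [hqp, hq2]
      _ = (q - p) * (g * p) := by rw [hg]; simp only [Matrix.mul_assoc]
      _ = 0 := by rw [← hcomm, ← Matrix.mul_assoc, hq'p, Matrix.zero_mul]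
  · have e : (q - p) * f * (q - p) = dc (fun i => (1 - χ i) * D i) := by
      calc _ = ((q - p) * q) * f * (q * (q - p)) := by rw [hq1, hq2]
        _ = (q - p) * g * (q - p) := by rw [hg]; simp only [Matrix.mul_assoc]
        _ = g * (1 - p) * (q - p) := by
            rw [Matrix.sub_mul q p g, hqg, hcomm, Matrix.mul_sub g 1 p, Matrix.mul_one]
        _ = g - g * p := by
            rw [Matrix.mul_assoc, Matrix.sub_mul 1 p, hpq', Matrix.one_mul, sub_zero,
              Matrix.mul_sub, hgq]
        _ = _ := by
            rw [hgD, hp, dc_mul]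
            simp only [dc]
            rw [← Matrix.sub_mul, ← Matrix.mul_sub, Matrix.diagonal_sub]
            congr 3; ext i; push_cast; ring
    have e2 : Zᴴ * dc (fun i => (1 - χ i) * D i) * Z =
        (Uᴴ * Z)ᴴ * Matrix.diagonal (fun i => (((1 - χ i) * D i : ℝ) : ℂ)) * (Uᴴ * Z) := by
      simp only [dc, Matrix.conjTranspose_mul, Matrix.conjTranspose_conjTranspose,
        Matrix.mul_assoc]
    rw [e, e2, ← frobSq_unitary_conj hU' Z]
    set W := Uᴴ * Z
    have e3 : (Wᴴ * Matrix.diagonal (fun i => (((1 - χ i) * D i : ℝ) : ℂ)) * W).trace.re =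
        ∑ i, ∑ j, (1 - χ i) * D i * ‖W i j‖ ^ 2 := by
      rw [Matrix.trace_mul_cycle, Matrix.trace_mul_comm, Matrix.trace, Complex.re_sum]
      refine Finset.sum_congr rfl fun i _ => ?_
      rw [Matrix.diag_apply, Matrix.diagonal_mul, Matrix.mul_apply, Finset.mul_sum, Complex.re_sum]
      refine Finset.sum_congr rfl fun j _ => ?_
      rw [Matrix.conjTranspose_apply, Complex.star_def, Complex.mul_conj', ← Complex.ofReal_pow,
        ← Complex.ofReal_mul, Complex.ofReal_re]
    rw [e3, frobSq, Finset.mul_sum]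
    refine Finset.sum_le_sum fun i _ => ?_
    rw [Finset.mul_sum]
    refine Finset.sum_le_sum fun j _ => ?_
    gcongr
    by_cases hi : lam < D i
    · simp [hχ, hi, hl.le]
    · simpa [hχ, hi] using not_lt.1 hi
  · rw [hpp.frobSq_eq, hp, dc_tr]
    have h1 : (dc χ).rank ≤ (Matrix.diagonal (fun i => (χ i : ℂ))).rank :=
      (Matrix.rank_mul_le_left _ _).trans (Matrix.rank_mul_le_right _ _)
    rw [Matrix.rank_diagonal, Fintype.card_subtype] at h1
    have h2 : ∑ i, χ i = ((Finset.univ.filter fun i => (χ i : ℂ) ≠ 0).card : ℝ) := by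
      simp [hχ]
    rw [h2]; exact_mod_cast h1
  · rw [hpp.frobSq_eq, hpfp, hp, dc_tr, dc_tr, Finset.mul_sum]
    refine Finset.sum_le_sum fun i _ => ?_
    by_cases hi : lam < D i
    · simp [hχ, hi, hi.le]
    · simp [hχ, hi]

end cut

/-! ### Trees of averages and the Cuculescu projections -/

open scoped Classical in
/-- The projection of `exists_cut`. -/
def spectralCut {m : ℕ} (lam : ℝ) (q f : Matrix (Fin m) (Fin m) ℂ) : Matrix (Fin m) (Fin m) ℂ :=
  if h : 0 < lam ∧ IsProj q ∧ fᴴ = f then (exists_cut h.1 h.2.1 h.2.2).choose else 0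

/-- A positive matrix-valued function that takes finitely many values, together with its
averages over the ancestors of its level sets. The leaves are the level sets, `anc j i` is the
ancestor of the leaf `i` in generation `j`, and the leaves are the generation `depth`. Positivity
is recorded by a root: the value on the leaf `i` is `(root i)ᴴ * root i`. -/
structure MassTree (I : Type*) (m : ℕ) where
  /-- the leaves -/
  leaves : Finset I
  /-- the generation of the leaves -/
  depth : ℕ
  /-- the ancestor in a given generation -/
  anc : ℕ → I → I
  /-- the measure of a node -/
  weight : I → ℝ
  /-- a square root of the value on a leaf -/
  root : I → Matrix (Fin m) (Fin m) ℂ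
  anc_depth : ∀ i ∈ leaves, anc depth i = i
  anc_anc : ∀ i ∈ leaves, ∀ j j', j ≤ j' → j' ≤ depth → anc j (anc j' i) = anc j i
  weight_pos : ∀ i ∈ leaves, ∀ j ≤ depth, 0 < weight (anc j i)

namespace MassTree

open scoped Classical

variable {I : Type*} {m : ℕ} (t : MassTree I m) (lam : ℝ)

/-- The value of the function on a leaf. -/
def val (i : I) : Matrix (Fin m) (Fin m) ℂ := (t.root i)ᴴ * t.root i

/-- The nodes of generation `j`. -/
def nodes (j : ℕ) : Finset I := t.leaves.image (t.anc j)

/-- The leaves below a node of generation `j`. -/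
def below (j : ℕ) (Q : I) : Finset I := t.leaves.filter fun i => t.anc j i = Q

/-- The children of a node of generation `j`. -/
def children (j : ℕ) (R : I) : Finset I := (t.nodes (j + 1)).filter fun Q => t.anc j Q = R

/-- The average of the function over a node of generation `j`. -/
def density (j : ℕ) (Q : I) : Matrix (Fin m) (Fin m) ℂ :=
  (t.weight Q : ℂ)⁻¹ • ∑ i ∈ t.below j Q, (t.weight i : ℂ) • t.val i

/-- The Cuculescu projection that enters a node of generation `j`. -/
def incoming : ℕ → I → Matrix (Fin m) (Fin m) ℂ
  | 0, _ => 1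
  | j + 1, Q => incoming j (t.anc j Q) -
      spectralCut lam (incoming j (t.anc j Q)) (t.density j (t.anc j Q))

/-- The part of the incoming projection at which the average is large. -/
def bad (j : ℕ) (Q : I) : Matrix (Fin m) (Fin m) ℂ :=
  spectralCut lam (t.incoming lam j Q) (t.density j Q)

/-- The Cuculescu projection that leaves a node of generation `j`. -/
def good (j : ℕ) (Q : I) : Matrix (Fin m) (Fin m) ℂ := t.incoming lam j Q - t.bad lam j Q

/-- The average compressed to the outgoing projection. -/
def goodDensity (j : ℕ) (Q : I) : Matrix (Fin m) (Fin m) ℂ :=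
  t.good lam j Q * t.density j Q * t.good lam j Q

/-- The average compressed to the bad projection. -/
def badDensity (j : ℕ) (Q : I) : Matrix (Fin m) (Fin m) ℂ :=
  t.bad lam j Q * t.density j Q * t.bad lam j Q

/-- The average over a node of the bad parts of its children. -/
def correction (j : ℕ) (R : I) : Matrix (Fin m) (Fin m) ℂ :=
  ∑ Q ∈ t.children j R, ((t.weight Q / t.weight R : ℝ) : ℂ) • t.badDensity lam (j + 1) Q

/-- The integral of the trace of the function compressed to the bad projection. -/
def badMass (j : ℕ) (Q : I) : ℝ :=
  ∑ i ∈ t.below j Q, t.weight i * frobSq (t.root i * t.bad lam j Q)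

/-- The integral of the trace of the function compressed to the outgoing projection. -/
def goodMass (j : ℕ) (Q : I) : ℝ :=
  ∑ i ∈ t.below j Q, t.weight i * frobSq (t.root i * t.good lam j Q)

/-- The integral of the trace of the function. -/
def mass : ℝ := ∑ i ∈ t.leaves, t.weight i * frobSq (t.root i)

theorem val_conjTranspose (i : I) : (t.val i)ᴴ = t.val i := by simp [val]

theorem density_conjTranspose (j : ℕ) (Q : I) : (t.density j Q)ᴴ = t.density j Q := by
  unfold density
  rw [Matrix.conjTranspose_smul, Matrix.conjTranspose_sum]
  simp [val_conjTranspose]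

theorem incoming_succ (j : ℕ) (Q : I) :
    t.incoming lam (j + 1) Q = t.good lam j (t.anc j Q) := rfl

variable {lam}

theorem spectralCut_spec (hl : 0 < lam) {q f : Matrix (Fin m) (Fin m) ℂ} (hq : IsProj q)
    (hf : fᴴ = f) : IsCut lam q f (spectralCut lam q f) := by
  have h : 0 < lam ∧ IsProj q ∧ fᴴ = f := ⟨hl, hq, hf⟩
  rw [spectralCut, dif_pos h]
  exact (exists_cut h.1 h.2.1 h.2.2).choose_spec

theorem incoming_isProj (hl : 0 < lam) (j : ℕ) (Q : I) : IsProj (t.incoming lam j Q) := by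
  induction j generalizing Q with
  | zero => exact IsProj.one
  | succ j ih =>
    have h := spectralCut_spec hl (ih (t.anc j Q)) (t.density_conjTranspose j (t.anc j Q))
    exact (ih _).sub h.isProj h.mul_left h.mul_right

theorem isCut_bad (hl : 0 < lam) (j : ℕ) (Q : I) :
    IsCut lam (t.incoming lam j Q) (t.density j Q) (t.bad lam j Q) :=
  spectralCut_spec hl (t.incoming_isProj hl j Q) (t.density_conjTranspose j Q)

theorem bad_isProj (hl : 0 < lam) (j : ℕ) (Q : I) : IsProj (t.bad lam j Q) :=
  (t.isCut_bad hl j Q).isProj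

theorem good_isProj (hl : 0 < lam) (j : ℕ) (Q : I) : IsProj (t.good lam j Q) :=
  (t.incoming_isProj hl j Q).sub (t.isCut_bad hl j Q).isProj (t.isCut_bad hl j Q).mul_left
    (t.isCut_bad hl j Q).mul_right

theorem bad_mul_density_mul_good (hl : 0 < lam) (j : ℕ) (Q : I) :
    t.bad lam j Q * t.density j Q * t.good lam j Q = 0 := (t.isCut_bad hl j Q).offDiag

theorem good_mul_density_mul_bad (hl : 0 < lam) (j : ℕ) (Q : I) :
    t.good lam j Q * t.density j Q * t.bad lam j Q = 0 := (t.isCut_bad hl j Q).offDiag'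

theorem goodDensity_le (hl : 0 < lam) (j : ℕ) (Q : I) (Z : Matrix (Fin m) (Fin m) ℂ) :
    (Zᴴ * t.goodDensity lam j Q * Z).trace.re ≤ lam * frobSq Z := (t.isCut_bad hl j Q).le Z

theorem rank_bad_le (hl : 0 < lam) (j : ℕ) (Q : I) :
    ((t.bad lam j Q).rank : ℝ) ≤ frobSq (t.bad lam j Q) := (t.isCut_bad hl j Q).rank_le

theorem mul_frobSq_bad_le (hl : 0 < lam) (j : ℕ) (Q : I) :
    lam * frobSq (t.bad lam j Q) ≤ (t.badDensity lam j Q).trace.re :=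
  (t.isCut_bad hl j Q).mul_frobSq_le

theorem incoming_eq (j : ℕ) (Q : I) :
    t.incoming lam j Q = t.bad lam j Q + t.good lam j Q := by simp [good]

theorem trace_density (j : ℕ) (Q : I) (Z : Matrix (Fin m) (Fin m) ℂ) :
    (Zᴴ * t.density j Q * Z).trace.re =
      (t.weight Q)⁻¹ * ∑ i ∈ t.below j Q, t.weight i * frobSq (t.root i * Z) := by
  have : ∀ i, t.weight i * frobSq (t.root i * Z) =
      ((t.weight i : ℂ) * (Zᴴ * t.val i * Z).trace).re := by
    intro i
    rw [Complex.re_ofReal_mul, frobSq_eq_re_trace, Matrix.conjTranspose_mul]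
    simp only [val, Matrix.mul_assoc]
  simp only [this]
  rw [density, Matrix.mul_smul, Matrix.smul_mul, Matrix.trace_smul, Matrix.mul_sum, Matrix.sum_mul,
    Matrix.trace_sum, smul_eq_mul, ← Complex.ofReal_inv, Complex.re_ofReal_mul, Complex.re_sum]
  simp

variable {t}

theorem weight_pos_of_mem {j : ℕ} (hj : j ≤ t.depth) {Q : I} (hQ : Q ∈ t.nodes j) :
    0 < t.weight Q := by
  obtain ⟨i, hi, rfl⟩ := Finset.mem_image.1 hQ
  exact t.weight_pos i hi j hj

theorem weight_pos_leaf {i : I} (hi : i ∈ t.leaves) : 0 < t.weight i := by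
  have := t.weight_pos i hi t.depth le_rfl
  rwa [t.anc_depth i hi] at this

theorem weight_mul_trace_density {j : ℕ} (hj : j ≤ t.depth) {Q : I} (hQ : Q ∈ t.nodes j)
    (Z : Matrix (Fin m) (Fin m) ℂ) : t.weight Q * (Zᴴ * t.density j Q * Z).trace.re =
      ∑ i ∈ t.below j Q, t.weight i * frobSq (t.root i * Z) := by
  rw [trace_density, mul_inv_cancel_left₀ (weight_pos_of_mem hj hQ).ne']

theorem weight_smul_density {j : ℕ} (hj : j ≤ t.depth) {Q : I} (hQ : Q ∈ t.nodes j) :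
    (t.weight Q : ℂ) • t.density j Q = ∑ i ∈ t.below j Q, (t.weight i : ℂ) • t.val i := by
  rw [density, smul_inv_smul₀]
  exact_mod_cast (weight_pos_of_mem hj hQ).ne'

theorem weight_mul_trace_badDensity (hl : 0 < lam) {j : ℕ} (hj : j ≤ t.depth) {Q : I}
    (hQ : Q ∈ t.nodes j) : t.weight Q * (t.badDensity lam j Q).trace.re = t.badMass lam j Q := by
  rw [badMass, ← weight_mul_trace_density hj hQ, (t.bad_isProj hl j Q).1, badDensity]

/-- Chebyshev's inequality for the bad projections. -/
theorem mul_weight_mul_frobSq_bad_le (hl : 0 < lam) {j : ℕ} (hj : j ≤ t.depth) {Q : I}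
    (hQ : Q ∈ t.nodes j) : lam * t.weight Q * frobSq (t.bad lam j Q) ≤ t.badMass lam j Q := by
  rw [← weight_mul_trace_badDensity hl hj hQ]
  nlinarith [mul_le_mul_of_nonneg_left (t.mul_frobSq_bad_le hl j Q) (weight_pos_of_mem hj hQ).le]

/-- On the outgoing projection the average over a node is at most `lam`, as a bound of quadratic
forms. This is the hypothesis of `traceAbs_offDiag_le`. -/
theorem sum_below_good_le (hl : 0 < lam) {j : ℕ} (hj : j ≤ t.depth) {Q : I} (hQ : Q ∈ t.nodes j)
    (Z : Matrix (Fin m) (Fin m) ℂ) :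
    ∑ i ∈ t.below j Q, t.weight i * frobSq (t.root i * t.good lam j Q * Z) ≤
      (lam * t.weight Q) * frobSq Z := by
  simp only [Matrix.mul_assoc]
  rw [← weight_mul_trace_density hj hQ]
  have h := t.goodDensity_le hl j Q Z
  have e : (t.good lam j Q * Z)ᴴ * t.density j Q * (t.good lam j Q * Z) =
      Zᴴ * t.goodDensity lam j Q * Z := by
    rw [Matrix.conjTranspose_mul, (t.good_isProj hl j Q).1, goodDensity]
    simp only [Matrix.mul_assoc]
  rw [e]
  nlinarith [mul_le_mul_of_nonneg_left h (weight_pos_of_mem hj hQ).le]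

theorem sum_nodes_sum_below {M : Type*} [AddCommMonoid M] (j : ℕ) (φ : I → I → M) :
    ∑ Q ∈ t.nodes j, ∑ i ∈ t.below j Q, φ Q i = ∑ i ∈ t.leaves, φ (t.anc j i) i := by
  rw [← Finset.sum_fiberwise_of_maps_to (s := t.leaves) (t := t.nodes j) (g := t.anc j)
    (fun i hi => Finset.mem_image_of_mem _ hi)]
  refine Finset.sum_congr rfl fun Q _ => Finset.sum_congr rfl fun i hi => ?_
  rw [(Finset.mem_filter.1 hi).2]

theorem anc_mem_nodes {j j' : ℕ} (h : j ≤ j') (hj' : j' ≤ t.depth) {Q : I}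
    (hQ : Q ∈ t.nodes j') : t.anc j Q ∈ t.nodes j := by
  obtain ⟨i, hi, rfl⟩ := Finset.mem_image.1 hQ
  rw [t.anc_anc i hi j j' h hj']
  exact Finset.mem_image_of_mem _ hi

theorem sum_nodes_sum_children {M : Type*} [AddCommMonoid M] {j : ℕ} (hj : j < t.depth)
    (φ : I → I → M) :
    ∑ R ∈ t.nodes j, ∑ Q ∈ t.children j R, φ R Q = ∑ Q ∈ t.nodes (j + 1), φ (t.anc j Q) Q := by
  rw [← Finset.sum_fiberwise_of_maps_to (s := t.nodes (j + 1)) (t := t.nodes j) (g := t.anc j)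
    (fun Q hQ => anc_mem_nodes (Nat.le_succ j) hj hQ)]
  refine Finset.sum_congr rfl fun R _ => Finset.sum_congr rfl fun Q hQ => ?_
  rw [(Finset.mem_filter.1 hQ).2]

theorem sum_children_sum_below {M : Type*} [AddCommMonoid M] {j : ℕ} (hj : j < t.depth) (R : I)
    (φ : I → M) :
    ∑ Q ∈ t.children j R, ∑ i ∈ t.below (j + 1) Q, φ i = ∑ i ∈ t.below j R, φ i := by
  rw [← Finset.sum_fiberwise_of_maps_to (s := t.below j R) (t := t.children j R)
    (g := t.anc (j + 1))]
  · refine Finset.sum_congr rfl fun Q hQ => Finset.sum_congr ?_ fun i _ => rfl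
    ext i
    simp only [below, Finset.mem_filter]
    refine ⟨fun h => ⟨⟨h.1, ?_⟩, h.2⟩, fun h => ⟨h.1.1, h.2⟩⟩
    rw [← t.anc_anc i h.1 j (j + 1) (Nat.le_succ j) hj, h.2]
    exact (Finset.mem_filter.1 hQ).2
  · intro i hi
    obtain ⟨h1, h2⟩ := Finset.mem_filter.1 hi
    refine Finset.mem_filter.2 ⟨Finset.mem_image_of_mem _ h1, ?_⟩
    rw [t.anc_anc i h1 j (j + 1) (Nat.le_succ j) hj, h2]

theorem sum_children_density {j : ℕ} (hj : j < t.depth) {R : I} (hR : R ∈ t.nodes j) :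
    ∑ Q ∈ t.children j R, (t.weight Q : ℂ) • t.density (j + 1) Q =
      (t.weight R : ℂ) • t.density j R := by
  rw [weight_smul_density hj.le hR, ← sum_children_sum_below hj]
  exact Finset.sum_congr rfl fun Q hQ => weight_smul_density hj (Finset.mem_filter.1 hQ).1

theorem incoming_density_incoming (hl : 0 < lam) (j : ℕ) (Q : I) :
    t.incoming lam j Q * t.density j Q * t.incoming lam j Q =
      t.badDensity lam j Q + t.goodDensity lam j Q := by
  rw [t.incoming_eq, Matrix.add_mul, Matrix.add_mul, Matrix.mul_add, Matrix.mul_add,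
    t.bad_mul_density_mul_good hl, t.good_mul_density_mul_bad hl, add_zero, zero_add]
  rfl

/-- The compressed average over a node is the average of the compressed averages over its
children, up to the correction by the bad parts. -/
theorem goodDensity_eq (hl : 0 < lam) {j : ℕ} (hj : j < t.depth) {R : I} (hR : R ∈ t.nodes j) :
    t.goodDensity lam j R = ∑ Q ∈ t.children j R,
      ((t.weight Q / t.weight R : ℝ) : ℂ) • t.goodDensity lam (j + 1) Q +
      t.correction lam j R := by
  have hw : (t.weight R : ℂ) ≠ 0 := by exact_mod_cast (weight_pos_of_mem hj.le hR).ne'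
  have h1 : ∀ Q ∈ t.children j R, ((t.weight Q / t.weight R : ℝ) : ℂ) •
      t.goodDensity lam (j + 1) Q + ((t.weight Q / t.weight R : ℝ) : ℂ) •
      t.badDensity lam (j + 1) Q = (t.weight R : ℂ)⁻¹ •
        (t.good lam j R * ((t.weight Q : ℂ) • t.density (j + 1) Q) * t.good lam j R) := by
    intro Q hQ
    have := t.incoming_density_incoming hl (j + 1) Q
    rw [incoming_succ, (Finset.mem_filter.1 hQ).2] at this
    rw [← smul_add, add_comm, ← this, Matrix.mul_smul, Matrix.smul_mul, smul_smul]
    push_cast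
    rw [div_eq_inv_mul]
  rw [correction, ← Finset.sum_add_distrib, Finset.sum_congr rfl h1, ← Finset.smul_sum,
    ← Matrix.sum_mul, ← Matrix.mul_sum, sum_children_density hj hR, Matrix.mul_smul,
    Matrix.smul_mul, inv_smul_smul₀ hw]
  rfl

theorem badMass_nonneg {j : ℕ} {Q : I} : 0 ≤ t.badMass lam j Q :=
  Finset.sum_nonneg fun _ hi => mul_nonneg
    (weight_pos_leaf (Finset.mem_filter.1 hi).1).le (frobSq_nonneg _)

theorem goodMass_nonneg {j : ℕ} {Q : I} : 0 ≤ t.goodMass lam j Q :=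
  Finset.sum_nonneg fun _ hi => mul_nonneg
    (weight_pos_leaf (Finset.mem_filter.1 hi).1).le (frobSq_nonneg _)

/-- The bad masses of all generations and the remaining good mass add up to the total mass. -/
theorem sum_badMass_add (hl : 0 < lam) {l : ℕ} (h : l ≤ t.depth) :
    ∑ j ∈ Finset.range (l + 1), ∑ Q ∈ t.nodes j, t.badMass lam j Q +
      ∑ Q ∈ t.nodes l, t.goodMass lam l Q = t.mass := by
  have key : ∀ j ≤ t.depth, ∑ Q ∈ t.nodes j, t.badMass lam j Q +
      ∑ Q ∈ t.nodes j, t.goodMass lam j Q =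
      ∑ i ∈ t.leaves, t.weight i * frobSq (t.root i * t.incoming lam j (t.anc j i)) := by
    intro j hj
    rw [← sum_nodes_sum_below j fun Q i => t.weight i * frobSq (t.root i * t.incoming lam j Q),
      ← Finset.sum_add_distrib]
    refine Finset.sum_congr rfl fun Q hQ => ?_
    rw [badMass, goodMass, ← weight_mul_trace_density hj hQ, ← weight_mul_trace_density hj hQ,
      ← weight_mul_trace_density hj hQ, (t.bad_isProj hl j Q).1, (t.good_isProj hl j Q).1,
      (t.incoming_isProj hl j Q).1, incoming_density_incoming hl, Matrix.trace_add,
      Complex.add_re]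
    simp only [badDensity, goodDensity]
    ring
  induction l with
  | zero =>
    rw [Finset.sum_range_one, key 0 h]
    simp [incoming, mass]
  | succ l ih =>
    rw [Finset.sum_range_succ, add_assoc, key (l + 1) h, ← ih (by omega)]
    congr 1
    rw [goodMass_sum l]
    refine Finset.sum_congr rfl fun i hi => ?_
    rw [incoming_succ, t.anc_anc i hi l (l + 1) (Nat.le_succ l) h]
where
  goodMass_sum (l : ℕ) : ∑ Q ∈ t.nodes l, t.goodMass lam l Q =
      ∑ i ∈ t.leaves, t.weight i * frobSq (t.root i * t.good lam l (t.anc l i)) :=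
    sum_nodes_sum_below l fun Q i => t.weight i * frobSq (t.root i * t.good lam l Q)

/-- Different bad projections take disjoint parts of the mass. -/
theorem sum_badMass_le (hl : 0 < lam) :
    ∑ j ∈ Finset.range (t.depth + 1), ∑ Q ∈ t.nodes j, t.badMass lam j Q ≤ t.mass := by
  rw [← sum_badMass_add hl le_rfl, le_add_iff_nonneg_right]
  exact Finset.sum_nonneg fun _ _ => goodMass_nonneg

theorem goodDensity_conjTranspose (hl : 0 < lam) (j : ℕ) (Q : I) :
    (t.goodDensity lam j Q)ᴴ = t.goodDensity lam j Q := by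
  rw [goodDensity, Matrix.conjTranspose_mul, Matrix.conjTranspose_mul, t.density_conjTranspose,
    (t.good_isProj hl j Q).1, Matrix.mul_assoc]

/-- If `G ≤ lam` then `w * tr (G P) ≤ lam * w * tr P`, for a compressed average `P`. -/
theorem weight_mul_trace_mul_le {j : ℕ} (hj : j ≤ t.depth) {Q : I}
    (hQ : Q ∈ t.nodes j) {G p : Matrix (Fin m) (Fin m) ℂ} (hp : IsProj p)
    (hG : ∀ Z, (Zᴴ * G * Z).trace.re ≤ lam * frobSq Z) :
    t.weight Q * (G * (p * t.density j Q * p)).trace.re ≤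
      lam * ∑ i ∈ t.below j Q, t.weight i * frobSq (t.root i * p) := by
  have e : t.weight Q * (G * (p * t.density j Q * p)).trace.re =
      ((G * (p * ((t.weight Q : ℂ) • t.density j Q) * p)).trace).re := by
    rw [Matrix.mul_smul, Matrix.smul_mul, Matrix.mul_smul, Matrix.trace_smul, smul_eq_mul,
      Complex.re_ofReal_mul]
  rw [e, weight_smul_density hj hQ, Matrix.mul_sum, Matrix.sum_mul, Matrix.mul_sum,
    Matrix.trace_sum, Complex.re_sum, Finset.mul_sum]
  refine Finset.sum_le_sum fun i hi => ?_
  have h := hG (t.root i * p)ᴴ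
  rw [frobSq_conjTranspose, Matrix.conjTranspose_conjTranspose] at h
  have e2 : (G * (p * ((t.weight i : ℂ) • t.val i) * p)).trace.re =
      t.weight i * (t.root i * p * G * (t.root i * p)ᴴ).trace.re := by
    rw [Matrix.mul_smul, Matrix.smul_mul, Matrix.mul_smul, Matrix.trace_smul, smul_eq_mul,
      Complex.re_ofReal_mul, Matrix.trace_mul_cycle, Matrix.trace_mul_comm (_ * _) G,
      Matrix.conjTranspose_mul, hp.1, val]
    simp only [Matrix.mul_assoc]
  rw [e2]
  nlinarith [mul_le_mul_of_nonneg_left h (weight_pos_leaf (Finset.mem_filter.1 hi).1).le]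

theorem weight_mul_frobSq_goodDensity_le (hl : 0 < lam) {j : ℕ} (hj : j ≤ t.depth) {Q : I}
    (hQ : Q ∈ t.nodes j) :
    t.weight Q * frobSq (t.goodDensity lam j Q) ≤ lam * t.goodMass lam j Q := by
  rw [frobSq_eq_re_trace, goodDensity_conjTranspose hl]
  exact weight_mul_trace_mul_le hj hQ (t.good_isProj hl j Q) (t.goodDensity_le hl j Q)

/-- The average over a node of the compressed averages over its children. -/
def avgGood (t : MassTree I m) (lam : ℝ) (j : ℕ) (R : I) : Matrix (Fin m) (Fin m) ℂ :=
  ∑ Q ∈ t.children j R, ((t.weight Q / t.weight R : ℝ) : ℂ) • t.goodDensity lam (j + 1) Q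

theorem frobSq_le_frobSq_sub_add (A B : Matrix (Fin m) (Fin m) ℂ) :
    frobSq A ≤ frobSq (A - B) + 2 * (Aᴴ * B).trace.re := by
  have h : frobSq (A - B) = frobSq A + frobSq B - (Aᴴ * B).trace.re - (Bᴴ * A).trace.re := by
    simp only [frobSq_eq_re_trace, Matrix.conjTranspose_sub, Matrix.sub_mul, Matrix.mul_sub,
      Matrix.trace_sub, Complex.sub_re]
    ring
  have h2 : (Bᴴ * A).trace.re = (Aᴴ * B).trace.re := by
    have : (Bᴴ * A) = (Aᴴ * B)ᴴ := by simp
    rw [this, Matrix.trace_conjTranspose]; simp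
  linarith [frobSq_nonneg B]

/-- One step of the `L_2` estimate: passing from a node to its children, the loss is paid for by the
bad masses of the children. -/
theorem weight_mul_frobSq_goodDensity_le_avg (hl : 0 < lam) {j : ℕ} (hj : j < t.depth) {R : I}
    (hR : R ∈ t.nodes j) :
    t.weight R * frobSq (t.goodDensity lam j R) ≤ t.weight R * frobSq (t.avgGood lam j R) +
      2 * lam * ∑ Q ∈ t.children j R, t.badMass lam (j + 1) Q := by
  have hw := weight_pos_of_mem hj.le hR
  have h1 := frobSq_le_frobSq_sub_add (t.goodDensity lam j R) (t.correction lam j R)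
  have h2 : t.goodDensity lam j R - t.correction lam j R = t.avgGood lam j R := by
    rw [goodDensity_eq hl hj hR, avgGood, add_sub_cancel_right]
  have h3 : t.weight R * ((t.goodDensity lam j R)ᴴ * t.correction lam j R).trace.re ≤
      lam * ∑ Q ∈ t.children j R, t.badMass lam (j + 1) Q := by
    rw [goodDensity_conjTranspose hl, correction, Matrix.mul_sum, Matrix.trace_sum,
      Complex.re_sum, Finset.mul_sum, Finset.mul_sum]
    refine Finset.sum_le_sum fun Q hQ => ?_
    rw [Matrix.mul_smul, Matrix.trace_smul, smul_eq_mul, Complex.re_ofReal_mul, ← mul_assoc,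
      mul_div_cancel₀ _ hw.ne']
    exact weight_mul_trace_mul_le hj (Finset.mem_filter.1 hQ).1 (t.bad_isProj hl _ Q)
      (t.goodDensity_le hl j R)
  rw [h2] at h1
  nlinarith [mul_le_mul_of_nonneg_left h1 hw.le]

end MassTree

/-! ### The martingale part and the Calderón-Zygmund decomposition -/

namespace MassTree

open scoped Classical

variable {I : Type*} {m : ℕ} {t : MassTree I m} {lam : ℝ}

section martingale

variable {H : Type*} [NormedAddCommGroup H] [InnerProductSpace ℂ H]

/-- The entries of the martingale part of the function, where `e Q` stands for the indicator
function of the node `Q`. -/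
def martingalePart (t : MassTree I m) (lam : ℝ) {V : Type*} [AddCommGroup V] [Module ℂ V]
    (e : I → V) (l : ℕ) (a b : Fin m) : V :=
  ∑ Q ∈ t.nodes l, t.goodDensity lam l Q a b • e Q +
    ∑ j ∈ Finset.range l, ∑ R ∈ t.nodes j, t.correction lam j R a b • e R

theorem anc_self_of_mem {j : ℕ} (hj : j ≤ t.depth) {Q : I} (hQ : Q ∈ t.nodes j) :
    t.anc j Q = Q := by
  obtain ⟨i, hi, rfl⟩ := Finset.mem_image.1 hQ
  exact t.anc_anc i hi j j le_rfl hj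

theorem anc_anc_of_mem {j j' l : ℕ} (h : j ≤ j') (h' : j' ≤ l) (hl : l ≤ t.depth) {Q : I}
    (hQ : Q ∈ t.nodes l) : t.anc j (t.anc j' Q) = t.anc j Q := by
  obtain ⟨i, hi, rfl⟩ := Finset.mem_image.1 hQ
  rw [t.anc_anc i hi j' l h' hl, t.anc_anc i hi j l (h.trans h') hl,
    t.anc_anc i hi j j' h (h'.trans hl)]

variable {e : I → H}

/-- Indicator functions of distinct nodes of one generation are orthogonal. -/
theorem norm_sq_sum_nodes
    (he : ∀ j j', j ≤ j' → j' ≤ t.depth → ∀ R ∈ t.nodes j, ∀ Q ∈ t.nodes j',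
      inner ℂ (e R) (e Q) = if t.anc j Q = R then (t.weight Q : ℂ) else 0)
    {l : ℕ} (hl : l ≤ t.depth) (φ : I → ℂ) :
    ‖∑ Q ∈ t.nodes l, φ Q • e Q‖ ^ 2 = ∑ Q ∈ t.nodes l, t.weight Q * ‖φ Q‖ ^ 2 := by
  have h : inner ℂ (∑ Q ∈ t.nodes l, φ Q • e Q) (∑ Q ∈ t.nodes l, φ Q • e Q) =
      ∑ Q ∈ t.nodes l, ((t.weight Q * ‖φ Q‖ ^ 2 : ℝ) : ℂ) := by
    rw [sum_inner]
    refine Finset.sum_congr rfl fun R hR => ?_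
    rw [inner_sum, Finset.sum_eq_single R]
    · rw [inner_smul_left, inner_smul_right, he l l le_rfl hl R hR R hR,
        if_pos (anc_self_of_mem hl hR), ← mul_assoc, Complex.conj_mul']
      push_cast; ring
    · intro Q hQ hne
      rw [inner_smul_left, inner_smul_right, he l l le_rfl hl R hR Q hQ,
        if_neg (by rwa [anc_self_of_mem hl hQ]), mul_zero, mul_zero]
    · exact fun h => absurd hR h
  rw [← @inner_self_eq_norm_sq ℂ, h, ← Complex.ofReal_sum]
  exact Complex.ofReal_re _

/-- Against a node of an earlier generation, a function on generation `l + 1` may be replaced by its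
averages over generation `l`. Hence martingale differences are orthogonal. -/
theorem inner_sum_nodes_succ
    (he : ∀ j j', j ≤ j' → j' ≤ t.depth → ∀ R ∈ t.nodes j, ∀ Q ∈ t.nodes j',
      inner ℂ (e R) (e Q) = if t.anc j Q = R then (t.weight Q : ℂ) else 0)
    {j l : ℕ} (hjl : j ≤ l) (hl : l < t.depth) {R' : I}
    (hR' : R' ∈ t.nodes j) (a b : Fin m) :
    inner ℂ (e R') (∑ Q ∈ t.nodes (l + 1), t.goodDensity lam (l + 1) Q a b • e Q) =
      inner ℂ (e R') (∑ R ∈ t.nodes l, t.avgGood lam l R a b • e R) := by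
  rw [inner_sum, inner_sum]
  have h2 : ∀ R ∈ t.nodes l, inner ℂ (e R') (t.avgGood lam l R a b • e R) =
      ∑ Q ∈ t.children l R, if t.anc j R = R' then
        t.goodDensity lam (l + 1) Q a b * t.weight Q else 0 := by
    intro R hR
    have hw : (t.weight R : ℂ) ≠ 0 := by exact_mod_cast (weight_pos_of_mem hl.le hR).ne'
    rw [inner_smul_right, he j l hjl hl.le R' hR' R hR]
    split_ifs
    · rw [avgGood, Matrix.sum_apply, Finset.sum_mul]
      refine Finset.sum_congr rfl fun Q _ => ?_
      rw [Matrix.smul_apply, smul_eq_mul]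
      push_cast
      field_simp
    · simp
  rw [Finset.sum_congr rfl h2, sum_nodes_sum_children hl]
  refine Finset.sum_congr rfl fun Q hQ => ?_
  rw [inner_smul_right, he j (l + 1) (by omega) hl R' hR' Q hQ,
    anc_anc_of_mem hjl (Nat.le_succ l) hl hQ]
  split_ifs <;> simp

/-- The martingale part is controlled in `L_2` by the total mass: its differences are orthogonal,
and their norms telescope, up to the bad masses. -/
theorem sum_norm_sq_martingalePart_le
    (he : ∀ j j', j ≤ j' → j' ≤ t.depth → ∀ R ∈ t.nodes j, ∀ Q ∈ t.nodes j',
      inner ℂ (e R) (e Q) = if t.anc j Q = R then (t.weight Q : ℂ) else 0)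
    (hlam : 0 < lam) :
    ∑ a, ∑ b, ‖t.martingalePart lam e t.depth a b‖ ^ 2 ≤ 3 * lam * t.mass := by
  have hsucc : ∀ l < t.depth, ∀ a b, t.martingalePart lam e (l + 1) a b =
      t.martingalePart lam e l a b +
        (∑ Q ∈ t.nodes (l + 1), t.goodDensity lam (l + 1) Q a b • e Q -
          ∑ R ∈ t.nodes l, t.avgGood lam l R a b • e R) := by
    intro l hl a b
    have h : ∑ R ∈ t.nodes l, t.correction lam l R a b • e R =
        ∑ R ∈ t.nodes l, t.goodDensity lam l R a b • e R -
          ∑ R ∈ t.nodes l, t.avgGood lam l R a b • e R := by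
      rw [← Finset.sum_sub_distrib]
      refine Finset.sum_congr rfl fun R hR => ?_
      rw [goodDensity_eq hlam hl hR, ← sub_smul, avgGood, Matrix.add_apply, add_sub_cancel_left]
    rw [martingalePart, martingalePart, Finset.sum_range_succ, h]
    abel
  have hnorm : ∀ l < t.depth, ∀ a b, ‖t.martingalePart lam e (l + 1) a b‖ ^ 2 =
      ‖t.martingalePart lam e l a b‖ ^ 2 +
        ∑ Q ∈ t.nodes (l + 1), t.weight Q * ‖t.goodDensity lam (l + 1) Q a b‖ ^ 2 -
        ∑ R ∈ t.nodes l, t.weight R * ‖t.avgGood lam l R a b‖ ^ 2 := by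
    intro l hl a b
    set X := ∑ Q ∈ t.nodes (l + 1), t.goodDensity lam (l + 1) Q a b • e Q with hX
    set Y := ∑ R ∈ t.nodes l, t.avgGood lam l R a b • e R with hY
    have hort : ∀ j ≤ l, ∀ R ∈ t.nodes j, inner ℂ (e R) (X - Y) = 0 := by
      intro j hj R hR
      rw [inner_sub_right, hX, hY, inner_sum_nodes_succ he hj hl hR, sub_self]
    have h1 : inner ℂ (t.martingalePart lam e l a b) (X - Y) = 0 := by
      rw [martingalePart, inner_add_left, sum_inner, sum_inner,
        Finset.sum_eq_zero fun R hR => ?_, Finset.sum_eq_zero fun j hj => ?_, add_zero]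
      · rw [sum_inner]
        refine Finset.sum_eq_zero fun R hR => ?_
        rw [inner_smul_left, hort j (Finset.mem_range.1 hj).le R hR, mul_zero]
      · rw [inner_smul_left, hort l le_rfl R hR, mul_zero]
    have h2 : inner ℂ Y (X - Y) = 0 := by
      conv_lhs => rw [hY, sum_inner]
      refine Finset.sum_eq_zero fun R hR => ?_
      rw [inner_smul_left, ← hY, hort l le_rfl R hR, mul_zero]
    have h3 := norm_add_sq_eq_norm_sq_add_norm_sq_of_inner_eq_zero _ _ h1
    have h4 := norm_add_sq_eq_norm_sq_add_norm_sq_of_inner_eq_zero _ _ h2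
    rw [add_sub_cancel, ← sq, ← sq, ← sq] at h4
    rw [hX, norm_sq_sum_nodes he hl, hY, norm_sq_sum_nodes he hl.le, ← hX, ← hY] at h4
    rw [hsucc l hl, sq, h3, ← sq, ← sq]
    linarith
  have hfrob : ∀ (j : ℕ) (φ : I → Matrix (Fin m) (Fin m) ℂ),
      ∑ a, ∑ b, ∑ Q ∈ t.nodes j, t.weight Q * ‖φ Q a b‖ ^ 2 =
        ∑ Q ∈ t.nodes j, t.weight Q * frobSq (φ Q) := by
    intro j φ
    simp only [frobSq, Finset.mul_sum]
    exact (Finset.sum_congr rfl fun a _ => Finset.sum_comm).trans Finset.sum_comm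
  have main : ∀ l ≤ t.depth, ∑ a, ∑ b, ‖t.martingalePart lam e l a b‖ ^ 2 ≤
      ∑ Q ∈ t.nodes l, t.weight Q * frobSq (t.goodDensity lam l Q) +
        2 * lam * ∑ j ∈ Finset.range (l + 1), ∑ Q ∈ t.nodes j, t.badMass lam j Q := by
    intro l
    induction l with
    | zero =>
      intro hl
      have h0 : ∀ a b, ‖t.martingalePart lam e 0 a b‖ ^ 2 =
          ∑ Q ∈ t.nodes 0, t.weight Q * ‖t.goodDensity lam 0 Q a b‖ ^ 2 := by
        intro a b
        rw [← norm_sq_sum_nodes he hl]; simp [martingalePart]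
      simp only [h0, hfrob]
      have : 0 ≤ ∑ j ∈ Finset.range (0 + 1), ∑ Q ∈ t.nodes j, t.badMass lam j Q :=
        Finset.sum_nonneg fun _ _ => Finset.sum_nonneg fun _ _ => badMass_nonneg
      nlinarith
    | succ l ih =>
      intro hl
      have hl' : l < t.depth := hl
      simp only [hnorm l hl', Finset.sum_add_distrib, Finset.sum_sub_distrib, hfrob]
      have h1 := ih hl'.le
      have h2 : ∑ R ∈ t.nodes l, t.weight R * frobSq (t.goodDensity lam l R) ≤
          ∑ R ∈ t.nodes l, t.weight R * frobSq (t.avgGood lam l R) +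
            2 * lam * ∑ Q ∈ t.nodes (l + 1), t.badMass lam (l + 1) Q := by
        rw [← sum_nodes_sum_children hl' fun _ Q => t.badMass lam (l + 1) Q, Finset.mul_sum,
          ← Finset.sum_add_distrib]
        exact Finset.sum_le_sum fun R hR => weight_mul_frobSq_goodDensity_le_avg hlam hl' hR
      rw [Finset.sum_range_succ _ (l + 1), mul_add]
      linarith
  refine (main t.depth le_rfl).trans ?_
  have h1 : ∑ Q ∈ t.nodes t.depth, t.weight Q * frobSq (t.goodDensity lam t.depth Q) ≤
      lam * ∑ Q ∈ t.nodes t.depth, t.goodMass lam t.depth Q := by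
    rw [Finset.mul_sum]
    exact Finset.sum_le_sum fun Q hQ => weight_mul_frobSq_goodDensity_le hlam le_rfl hQ
  have h2 := sum_badMass_add (t := t) hlam (le_refl t.depth)
  have h3 : 0 ≤ ∑ Q ∈ t.nodes t.depth, t.goodMass lam t.depth Q :=
    Finset.sum_nonneg fun _ _ => goodMass_nonneg
  have h4 : 0 ≤ ∑ j ∈ Finset.range (t.depth + 1), ∑ Q ∈ t.nodes j, t.badMass lam j Q :=
    Finset.sum_nonneg fun _ _ => Finset.sum_nonneg fun _ _ => badMass_nonneg
  rw [← h2]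
  nlinarith

end martingale

section decomposition

variable (t lam)

/-- The off-diagonal term of a node with the bad projection on the left. Here `u i` stands for the
value at a point of the image of the indicator function of `i`. -/
def rowTerm (j : ℕ) (Q : I) (u : I → ℂ) : Matrix (Fin m) (Fin m) ℂ :=
  ∑ i ∈ t.below j Q, u i • (t.bad lam j Q * t.val i * t.good lam j Q)

/-- The off-diagonal term of a node with the bad projection on the right. -/
def colTerm (j : ℕ) (Q : I) (u : I → ℂ) : Matrix (Fin m) (Fin m) ℂ :=
  ∑ i ∈ t.below j Q, u i • (t.good lam j Q * t.val i * t.bad lam j Q)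

/-- The diagonal term of a node, with mean zero. -/
def diagTerm (j : ℕ) (Q : I) (u : I → ℂ) : Matrix (Fin m) (Fin m) ℂ :=
  ∑ i ∈ t.below j Q, u i • (t.bad lam j Q * t.val i * t.bad lam j Q) - u Q • t.badDensity lam j Q

variable {t lam}

theorem sum_below_compress {j : ℕ} (hj : j ≤ t.depth) {Q : I} (hQ : Q ∈ t.nodes j) (c : ℂ)
    (p q : Matrix (Fin m) (Fin m) ℂ) :
    ∑ i ∈ t.below j Q, (c * t.weight i) • (p * t.val i * q) =
      (c * t.weight Q) • (p * t.density j Q * q) := by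
  have : (c * t.weight Q) • (p * t.density j Q * q) =
      c • (p * ((t.weight Q : ℂ) • t.density j Q) * q) := by
    rw [Matrix.mul_smul, Matrix.smul_mul, smul_smul]
  rw [this, weight_smul_density hj hQ, Matrix.mul_sum, Matrix.sum_mul, Finset.smul_sum]
  refine Finset.sum_congr rfl fun i _ => ?_
  rw [Matrix.mul_smul, Matrix.smul_mul, mul_smul]

/-- The row term has mean zero: a constant value `c` of the kernel may be subtracted, since the cut
has no off-diagonal part. -/
theorem rowTerm_sub (hl : 0 < lam) {j : ℕ} (hj : j ≤ t.depth) {Q : I} (hQ : Q ∈ t.nodes j)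
    (u : I → ℂ) (c : ℂ) :
    t.rowTerm lam j Q u = t.rowTerm lam j Q fun i => u i - c * t.weight i := by
  have := sum_below_compress hj hQ c (t.bad lam j Q) (t.good lam j Q)
  simp only [rowTerm, sub_smul, Finset.sum_sub_distrib]
  rw [this, t.bad_mul_density_mul_good hl, smul_zero, sub_zero]

theorem colTerm_sub (hl : 0 < lam) {j : ℕ} (hj : j ≤ t.depth) {Q : I} (hQ : Q ∈ t.nodes j)
    (u : I → ℂ) (c : ℂ) :
    t.colTerm lam j Q u = t.colTerm lam j Q fun i => u i - c * t.weight i := by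
  have := sum_below_compress hj hQ c (t.good lam j Q) (t.bad lam j Q)
  simp only [colTerm, sub_smul, Finset.sum_sub_distrib]
  rw [this, t.good_mul_density_mul_bad hl, smul_zero, sub_zero]

theorem diagTerm_sub {j : ℕ} (hj : j ≤ t.depth) {Q : I} (hQ : Q ∈ t.nodes j)
    (u : I → ℂ) (c : ℂ) :
    t.diagTerm lam j Q u = t.diagTerm lam j Q fun i => u i - c * t.weight i := by
  have := sum_below_compress hj hQ c (t.bad lam j Q) (t.bad lam j Q)
  simp only [diagTerm, sub_smul, Finset.sum_sub_distrib]
  rw [this, badDensity]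
  abel

/-- The telescoping sum over the generations: at each node, the incoming compression of a value
splits into the outgoing one and the three terms that involve the bad projection. -/
theorem val_eq (i : I) (hi : i ∈ t.leaves) {l : ℕ} (hl : l ≤ t.depth) : t.val i =
    t.good lam l (t.anc l i) * t.val i * t.good lam l (t.anc l i) +
    ∑ j ∈ Finset.range (l + 1),
      (t.bad lam j (t.anc j i) * t.val i * t.good lam j (t.anc j i) +
        t.good lam j (t.anc j i) * t.val i * t.bad lam j (t.anc j i) +
        t.bad lam j (t.anc j i) * t.val i * t.bad lam j (t.anc j i)) := by
  have step : ∀ j, t.incoming lam j (t.anc j i) * t.val i * t.incoming lam j (t.anc j i) =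
      t.good lam j (t.anc j i) * t.val i * t.good lam j (t.anc j i) +
      (t.bad lam j (t.anc j i) * t.val i * t.good lam j (t.anc j i) +
        t.good lam j (t.anc j i) * t.val i * t.bad lam j (t.anc j i) +
        t.bad lam j (t.anc j i) * t.val i * t.bad lam j (t.anc j i)) := by
    intro j
    rw [t.incoming_eq, Matrix.add_mul, Matrix.add_mul, Matrix.mul_add, Matrix.mul_add]
    abel
  induction l with
  | zero =>
    rw [Finset.sum_range_one, ← step 0]
    simp [incoming]
  | succ l ih =>
    have := step (l + 1)
    rw [incoming_succ, t.anc_anc i hi l (l + 1) (Nat.le_succ l) hl] at this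
    conv_lhs => rw [ih (by omega), this]
    rw [Finset.sum_range_succ _ (l + 1)]
    abel

/-- The Calderón-Zygmund decomposition. -/
theorem sum_leaves_eq (u : I → ℂ) : ∑ i ∈ t.leaves, u i • t.val i =
    (Matrix.of fun a b => t.martingalePart lam u t.depth a b) +
    ∑ Q ∈ t.nodes 0, u Q • t.badDensity lam 0 Q +
    ∑ j ∈ Finset.range t.depth, ∑ Q ∈ t.nodes (j + 1),
      (u Q - ((t.weight Q / t.weight (t.anc j Q) : ℝ) : ℂ) * u (t.anc j Q)) •
        t.badDensity lam (j + 1) Q +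
    ∑ j ∈ Finset.range (t.depth + 1), ∑ Q ∈ t.nodes j,
      (t.rowTerm lam j Q u + t.colTerm lam j Q u + t.diagTerm lam j Q u) := by
  have hM : (Matrix.of fun a b => t.martingalePart lam u t.depth a b) =
      ∑ Q ∈ t.nodes t.depth, u Q • t.goodDensity lam t.depth Q +
      ∑ j ∈ Finset.range t.depth, ∑ Q ∈ t.nodes (j + 1),
        (((t.weight Q / t.weight (t.anc j Q) : ℝ) : ℂ) * u (t.anc j Q)) •
          t.badDensity lam (j + 1) Q := by
    have h : ∀ j ∈ Finset.range t.depth, ∑ Q ∈ t.nodes (j + 1),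
        (((t.weight Q / t.weight (t.anc j Q) : ℝ) : ℂ) * u (t.anc j Q)) •
          t.badDensity lam (j + 1) Q = ∑ R ∈ t.nodes j, u R • t.correction lam j R := by
      intro j hj
      rw [← sum_nodes_sum_children (Finset.mem_range.1 hj) fun R Q =>
        (((t.weight Q / t.weight R : ℝ) : ℂ) * u R) • t.badDensity lam (j + 1) Q]
      refine Finset.sum_congr rfl fun R _ => ?_
      rw [correction, Finset.smul_sum]
      refine Finset.sum_congr rfl fun Q _ => ?_
      rw [mul_comm, mul_smul]
    rw [Finset.sum_congr rfl h]
    ext a b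
    simp [martingalePart, Matrix.sum_apply, mul_comm]
  have hG : ∑ i ∈ t.leaves, u i • (t.good lam t.depth (t.anc t.depth i) * t.val i *
      t.good lam t.depth (t.anc t.depth i)) =
      ∑ Q ∈ t.nodes t.depth, u Q • t.goodDensity lam t.depth Q := by
    rw [← sum_nodes_sum_below t.depth fun Q i => u i • (t.good lam t.depth Q * t.val i *
      t.good lam t.depth Q)]
    refine Finset.sum_congr rfl fun Q hQ => ?_
    have hb : t.below t.depth Q = {Q} := by
      obtain ⟨i, hi, rfl⟩ := Finset.mem_image.1 hQ
      ext i'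
      simp only [below, Finset.mem_filter, Finset.mem_singleton]
      rw [t.anc_depth i hi]
      refine ⟨fun h => ?_, fun h => ?_⟩
      · rw [← h.2, t.anc_depth i' h.1]
      · subst h; exact ⟨hi, t.anc_depth i' hi⟩
    have hw : (t.weight Q : ℂ) ≠ 0 := by exact_mod_cast (weight_pos_of_mem le_rfl hQ).ne'
    rw [hb, Finset.sum_singleton, goodDensity, density, hb, Finset.sum_singleton,
      inv_smul_smul₀ hw]
  have hB : ∑ i ∈ t.leaves, u i • ∑ j ∈ Finset.range (t.depth + 1),
      (t.bad lam j (t.anc j i) * t.val i * t.good lam j (t.anc j i) +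
        t.good lam j (t.anc j i) * t.val i * t.bad lam j (t.anc j i) +
        t.bad lam j (t.anc j i) * t.val i * t.bad lam j (t.anc j i)) =
      ∑ j ∈ Finset.range (t.depth + 1), ∑ Q ∈ t.nodes j,
      (t.rowTerm lam j Q u + t.colTerm lam j Q u + t.diagTerm lam j Q u +
        u Q • t.badDensity lam j Q) := by
    simp only [Finset.smul_sum]
    rw [Finset.sum_comm]
    refine Finset.sum_congr rfl fun j _ => ?_
    rw [← sum_nodes_sum_below j fun Q i => u i • (t.bad lam j Q * t.val i * t.good lam j Q +
      t.good lam j Q * t.val i * t.bad lam j Q + t.bad lam j Q * t.val i * t.bad lam j Q)]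
    refine Finset.sum_congr rfl fun Q _ => ?_
    simp only [rowTerm, colTerm, diagTerm, smul_add, Finset.sum_add_distrib]
    abel
  have hS : ∑ j ∈ Finset.range (t.depth + 1), ∑ Q ∈ t.nodes j, u Q • t.badDensity lam j Q =
      ∑ j ∈ Finset.range t.depth, ∑ Q ∈ t.nodes (j + 1), u Q • t.badDensity lam (j + 1) Q +
      ∑ Q ∈ t.nodes 0, u Q • t.badDensity lam 0 Q := by
    rw [Finset.sum_range_succ']
  calc ∑ i ∈ t.leaves, u i • t.val i = ∑ i ∈ t.leaves, (u i •
        (t.good lam t.depth (t.anc t.depth i) * t.val i *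
        t.good lam t.depth (t.anc t.depth i)) + u i • ∑ j ∈ Finset.range (t.depth + 1),
      (t.bad lam j (t.anc j i) * t.val i * t.good lam j (t.anc j i) +
        t.good lam j (t.anc j i) * t.val i * t.bad lam j (t.anc j i) +
        t.bad lam j (t.anc j i) * t.val i * t.bad lam j (t.anc j i))) := by
        refine Finset.sum_congr rfl fun i hi => ?_
        rw [← smul_add, ← val_eq i hi le_rfl]
    _ = _ := by
        rw [Finset.sum_add_distrib, hG, hB, hM]
        simp only [Finset.sum_add_distrib, hS, sub_smul, Finset.sum_sub_distrib]
        abel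

end decomposition

end MassTree

/-! ### Atoms and their indicator functions -/

namespace NonregularFiltration

variable {d n : ℕ} {μ : Measure (EuclideanSpace ℝ (Fin d))} (F : NonregularFiltration n μ)

/-- A set is an atom if it is an atom of some generation. -/
def IsAtom (Q : Set (EuclideanSpace ℝ (Fin d))) : Prop := ∃ k, Q ∈ F.atoms k

variable {F} {Q R : Set (EuclideanSpace ℝ (Fin d))} {j k : ℤ}

theorem nonempty_of_mem_atoms (hQ : Q ∈ F.atoms k) : Q.Nonempty :=
  nonempty_of_measure_ne_zero (F.measure_atom_pos k Q hQ).ne'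

theorem IsAtom.measurableSet (h : F.IsAtom Q) : MeasurableSet Q :=
  F.measurableSet_atom _ _ h.choose_spec

theorem IsAtom.pos (h : F.IsAtom Q) : 0 < μ Q := F.measure_atom_pos _ _ h.choose_spec

theorem IsAtom.radius_pos (h : F.IsAtom Q) : 0 < F.radius Q :=
  F.radius_pos _ _ h.choose_spec

theorem IsAtom.subset_ball (h : F.IsAtom Q) :
    Q ⊆ Metric.ball (F.center Q) (28 * F.radius Q) := F.atom_subset_ball _ _ h.choose_spec

theorem IsAtom.lt_top [IsLocallyFiniteMeasure μ] (h : F.IsAtom Q) : μ Q < ∞ :=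
  (measure_mono h.subset_ball).trans_lt measure_ball_lt_top

theorem measurableSet_dilatedBall (Q : Set (EuclideanSpace ℝ (Fin d))) :
    MeasurableSet (F.dilatedBall Q) := Metric.isOpen_ball.measurableSet

/-- The dilated ball of an atom is not much larger, in measure, than the atom. -/
theorem IsAtom.measure_dilatedBall_le (h : F.IsAtom Q) :
    μ (F.dilatedBall Q) ≤ ENNReal.ofReal F.β * μ Q := by
  obtain ⟨k, hk⟩ := h
  refine (F.doubling k Q hk).trans ?_
  refine mul_le_mul' le_rfl ?_
  calc μ (Metric.ball (F.center Q) (F.radius Q))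
      = μ (Metric.ball (F.center Q) (F.radius Q) ∩ μ.support) :=
        (measure_inter_conull Measure.measure_compl_support).symm
    _ ≤ μ Q := measure_mono (F.ball_subset_atom k Q hk)

theorem exists_ancestor (hjk : j ≤ k) (hQ : Q ∈ F.atoms k) : ∃ R ∈ F.atoms j, Q ⊆ R := by
  obtain ⟨l, rfl⟩ : ∃ l : ℕ, k = j + l := ⟨(k - j).toNat, by omega⟩
  clear hjk
  induction l generalizing Q with
  | zero => exact ⟨Q, by simpa using hQ, subset_rfl⟩
  | succ l ih =>
    obtain ⟨R, hR, hQR⟩ := F.nested (j + l) Q (by convert hQ using 2; push_cast; ring)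
    obtain ⟨R', hR', h⟩ := ih hR
    exact ⟨R', hR', hQR.trans h⟩

theorem eq_of_inter_nonempty (hQ : Q ∈ F.atoms k) (hR : R ∈ F.atoms k)
    (h : (Q ∩ R).Nonempty) : Q = R := by
  by_contra hne
  exact h.ne_empty (disjoint_iff_inter_eq_empty.1 (F.disjoint_atoms k hQ hR hne))

theorem subset_or_disjoint (hjk : j ≤ k) (hQ : Q ∈ F.atoms k) (hR : R ∈ F.atoms j) :
    Q ⊆ R ∨ Disjoint Q R := by
  obtain ⟨R', hR', h⟩ := exists_ancestor hjk hQ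
  by_cases hd : Disjoint Q R
  · exact Or.inr hd
  · left
    obtain ⟨x, hx⟩ := not_disjoint_iff_nonempty_inter.1 hd
    rwa [← eq_of_inter_nonempty hR' hR ⟨x, h hx.1, hx.2⟩]

open scoped Classical in
/-- The atom of generation `k` that contains `Q`; empty if there is none. -/
def ancestor (F : NonregularFiltration n μ) (k : ℤ) (Q : Set (EuclideanSpace ℝ (Fin d))) :
    Set (EuclideanSpace ℝ (Fin d)) :=
  if h : ∃ R ∈ F.atoms k, Q ⊆ R then h.choose else ∅

theorem ancestor_mem (hjk : j ≤ k) (hQ : Q ∈ F.atoms k) : F.ancestor j Q ∈ F.atoms j := by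
  have h := exists_ancestor hjk hQ
  rw [ancestor, dif_pos h]
  exact h.choose_spec.1

theorem subset_ancestor (hjk : j ≤ k) (hQ : Q ∈ F.atoms k) : Q ⊆ F.ancestor j Q := by
  have h := exists_ancestor hjk hQ
  rw [ancestor, dif_pos h]
  exact h.choose_spec.2

theorem ancestor_eq (hjk : j ≤ k) (hQ : Q ∈ F.atoms k) (hR : R ∈ F.atoms j) (h : Q ⊆ R) :
    F.ancestor j Q = R := by
  obtain ⟨x, hx⟩ := nonempty_of_mem_atoms hQ
  exact eq_of_inter_nonempty (ancestor_mem hjk hQ) hR ⟨x, subset_ancestor hjk hQ hx, h hx⟩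

theorem ancestor_ancestor {i : ℤ} (hij : i ≤ j) (hjk : j ≤ k) (hQ : Q ∈ F.atoms k) :
    F.ancestor i (F.ancestor j Q) = F.ancestor i Q :=
  (ancestor_eq (hij.trans hjk) hQ (ancestor_mem hij (ancestor_mem hjk hQ))
    ((subset_ancestor hjk hQ).trans (subset_ancestor hij (ancestor_mem hjk hQ)))).symm

/-- If an atom of generation `k` strictly contains an atom of generation `k + 1`, then it is the
smallest atom that does so. -/
theorem eq_sInter_of_ssubset (hQ : Q ∈ F.atoms (k + 1)) (hR : R ∈ F.atoms k) (h : Q ⊂ R) :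
    R = ⋂₀ {S | (∃ k, S ∈ F.atoms k) ∧ Q ⊂ S} := by
  refine subset_antisymm (subset_sInter ?_) (sInter_subset_of_mem ⟨⟨k, hR⟩, h⟩)
  rintro S ⟨⟨j, hS⟩, hQS⟩
  obtain ⟨x, hx⟩ := nonempty_of_mem_atoms hQ
  rcases le_or_gt j k with hjk | hjk
  · rcases subset_or_disjoint hjk hR hS with h1 | h1
    · exact h1
    · exact absurd (hQS.1 hx) (h1.notMem_of_mem_left (h.1 hx))
  · rcases subset_or_disjoint (Int.add_one_le_iff.2 hjk) hS hQ with h1 | h1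
    · exact absurd h1 hQS.2
    · exact absurd hx (h1.notMem_of_mem_left (hQS.1 hx))

theorem countable_atoms [SigmaFinite μ] (k : ℤ) : (F.atoms k).Countable := by
  have h := Measure.countable_meas_pos_of_disjoint_iUnion (μ := μ)
    (As := fun Q : F.atoms k => (Q : Set (EuclideanSpace ℝ (Fin d))))
    (fun Q => F.measurableSet_atom k Q Q.2)
    (fun Q R hne => F.disjoint_atoms k Q.2 R.2 (fun h => hne (Subtype.ext h)))
  have : {Q : F.atoms k | 0 < μ Q.1} = univ := eq_univ_of_forall fun Q =>
    F.measure_atom_pos k Q Q.2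
  rw [this] at h
  exact countable_coe_iff.1 (countable_univ_iff.1 h)

end NonregularFiltration

section kernel

variable {d n : ℕ} {μ : Measure (EuclideanSpace ℝ (Fin d))}

open scoped Classical in
/-- The indicator function of a measurable set of finite measure, as an element of `L_2`. -/
def indL2 (μ : Measure (EuclideanSpace ℝ (Fin d))) (Q : Set (EuclideanSpace ℝ (Fin d))) :
    Lp ℂ 2 μ :=
  if h : MeasurableSet Q ∧ μ Q ≠ ∞ then indicatorConstLp 2 h.1 h.2 1 else 0

theorem indL2_of {Q : Set (EuclideanSpace ℝ (Fin d))} (h1 : MeasurableSet Q) (h2 : μ Q ≠ ∞) :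
    indL2 μ Q = indicatorConstLp 2 h1 h2 1 := dif_pos ⟨h1, h2⟩

theorem norm_indL2_sq {Q : Set (EuclideanSpace ℝ (Fin d))} (h1 : MeasurableSet Q)
    (h2 : μ Q ≠ ∞) : ‖indL2 μ Q‖ₑ ^ 2 = μ Q := by
  rw [indL2_of h1 h2, indicatorConstLp, Lp.enorm_toLp,
    eLpNorm_indicator_const h1 two_ne_zero ENNReal.ofNat_ne_top]
  rw [enorm_one, one_mul, ← ENNReal.rpow_natCast, ← ENNReal.rpow_mul]
  simp

theorem enorm_sq_Lp (f : Lp ℂ 2 μ) : ∫⁻ x, ‖f x‖ₑ ^ 2 ∂μ = ‖f‖ₑ ^ 2 := by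
  rw [Lp.enorm_def, eLpNorm_eq_lintegral_rpow_enorm_toReal (by simp) (by simp)]
  simp only [ENNReal.toReal_ofNat, ENNReal.rpow_ofNat, one_div]
  rw [← ENNReal.rpow_natCast, ← ENNReal.rpow_mul]; simp

/-- Cauchy-Schwarz against the indicator function of a set. -/
theorem setLIntegral_sq_le {α : Type*} [MeasurableSpace α] {ν : Measure α} {f : α → ℝ≥0∞}
    (hf : AEMeasurable f ν) (V : Set α) :
    (∫⁻ x in V, f x ∂ν) ^ 2 ≤ ν V * ∫⁻ x in V, f x ^ 2 ∂ν := by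
  have h := ENNReal.lintegral_mul_le_Lp_mul_Lq (ν.restrict V) Real.HolderConjugate.two_two
    (aemeasurable_const (b := (1 : ℝ≥0∞))) hf.restrict
  simp only [Pi.mul_apply, one_mul, one_pow, lintegral_const, Measure.restrict_apply,
    MeasurableSet.univ, univ_inter, one_div, ENNReal.rpow_ofNat] at h
  calc _ ≤ (ν V ^ (2⁻¹ : ℝ) * (∫⁻ x in V, f x ^ 2 ∂ν) ^ (2⁻¹ : ℝ)) ^ 2 := by gcongr
    _ = _ := by
      rw [mul_pow, ← ENNReal.rpow_natCast, ← ENNReal.rpow_natCast, ← ENNReal.rpow_mul,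
        ← ENNReal.rpow_mul]
      simp

theorem setLIntegral_enorm_image_sq_le (T : Lp ℂ 2 μ →L[ℂ] Lp ℂ 2 μ)
    {Q : Set (EuclideanSpace ℝ (Fin d))} (h1 : MeasurableSet Q) (h2 : μ Q ≠ ∞)
    (V : Set (EuclideanSpace ℝ (Fin d))) :
    (∫⁻ x in V, ‖T (indL2 μ Q) x‖ₑ ∂μ) ^ 2 ≤ ‖T‖ₑ ^ 2 * (μ V * μ Q) := by
  refine (setLIntegral_sq_le (Lp.aestronglyMeasurable _).enorm V).trans ?_
  calc _ ≤ μ V * ∫⁻ x, ‖T (indL2 μ Q) x‖ₑ ^ 2 ∂μ := by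
        exact mul_le_mul_right (setLIntegral_le_lintegral _ _) _
    _ ≤ μ V * (‖T‖ₑ * ‖indL2 μ Q‖ₑ) ^ 2 := by
        rw [enorm_sq_Lp]; gcongr; exact T.le_opENorm _
    _ = _ := by rw [mul_pow, norm_indL2_sq h1 h2]; ring

/-- If `μ V ≤ D μ Q`, then `∫_V |T 1_Q| ≤ ‖T‖ D ^ (1/2) μ Q`, and `D ^ (1/2) ≤ 1 + D`. -/
theorem setLIntegral_enorm_image_le (T : Lp ℂ 2 μ →L[ℂ] Lp ℂ 2 μ)
    {Q : Set (EuclideanSpace ℝ (Fin d))} (h1 : MeasurableSet Q) (h2 : μ Q ≠ ∞)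
    {V : Set (EuclideanSpace ℝ (Fin d))} {D : ℝ≥0∞} (hV : μ V ≤ D * μ Q) :
    ∫⁻ x in V, ‖T (indL2 μ Q) x‖ₑ ∂μ ≤ ‖T‖ₑ * (1 + D) * μ Q := by
  refine (ENNReal.pow_le_pow_left_iff two_ne_zero).1 ?_
  refine (setLIntegral_enorm_image_sq_le T h1 h2 V).trans ?_
  calc _ ≤ ‖T‖ₑ ^ 2 * ((D * μ Q) * μ Q) := by gcongr
    _ ≤ ‖T‖ₑ ^ 2 * (((1 + D) ^ 2 * μ Q) * μ Q) := by
      gcongr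
      calc D ≤ 1 * (1 + D) := by rw [one_mul]; exact le_add_self
        _ ≤ (1 + D) * (1 + D) := by gcongr; exact le_self_add
        _ = _ := (sq _).symm
    _ = _ := by ring

end kernel

/-! ### Kernel estimates -/

section kernelEstimates

variable {d n : ℕ} {μ : Measure (EuclideanSpace ℝ (Fin d))}
  {F : NonregularFiltration n μ}
  {k : EuclideanSpace ℝ (Fin d) → EuclideanSpace ℝ (Fin d) → ℂ}
  {T : Lp ℂ 2 μ →L[ℂ] Lp ℂ 2 μ} {Q R : Set (EuclideanSpace ℝ (Fin d))}

/-- The image of the indicator function of `Q` under the kernel `k(x, y) - k(x, c)`. -/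
def kernelDiff (μ : Measure (EuclideanSpace ℝ (Fin d)))
    (k : EuclideanSpace ℝ (Fin d) → EuclideanSpace ℝ (Fin d) → ℂ) (c : EuclideanSpace ℝ (Fin d))
    (Q : Set (EuclideanSpace ℝ (Fin d))) (x : EuclideanSpace ℝ (Fin d)) : ℂ :=
  ∫ y in Q, (k x y - k x c) ∂μ

theorem measurable_kernelDiff [IsLocallyFiniteMeasure μ] (hk : Measurable (Function.uncurry k))
    (c : EuclideanSpace ℝ (Fin d)) (Q : Set (EuclideanSpace ℝ (Fin d))) :
    Measurable (kernelDiff μ k c Q) := by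
  have : StronglyMeasurable (Function.uncurry fun x y => k x y - k x c) := by
    refine Measurable.stronglyMeasurable ?_
    exact hk.sub (hk.comp (measurable_fst.prodMk measurable_const))
  exact this.integral_prod_right.measurable

theorem ae_image_eq_integral (hT : HasKernel T k) {c : EuclideanSpace ℝ (Fin d)} {r : ℝ}
    (hQ : MeasurableSet Q) (hQ' : μ Q ≠ ∞) (hQr : Q ⊆ Metric.ball c r) :
    ∀ᵐ x ∂μ, x ∉ Metric.closedBall c r → T (indL2 μ Q) x = ∫ y in Q, k x y ∂μ := by
  have h1 : indL2 μ Q =ᵐ[μ] Q.indicator fun _ => (1 : ℂ) := by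
    rw [indL2_of hQ hQ']; exact indicatorConstLp_coeFn
  have h2 := hT (indL2 μ Q) (Metric.closedBall c r) (isCompact_closedBall c r) (by
    filter_upwards [h1] with y hy hyK
    rw [hy, indicator_of_notMem fun h => hyK (Metric.ball_subset_closedBall (hQr h))])
  filter_upwards [h2] with x hx hxK
  rw [hx hxK, ← integral_indicator hQ]
  refine integral_congr_ae ?_
  filter_upwards [h1] with y hy
  rw [hy]
  by_cases hyQ : y ∈ Q <;> simp [hyQ]

theorem integrableOn_kernel (hk : Measurable (Function.uncurry k)) (hsize : KernelSize n k)
    {c x : EuclideanSpace ℝ (Fin d)} {r : ℝ} (hr : 0 < r)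
    (hQ : MeasurableSet Q) (hQ' : μ Q ≠ ∞) (hQr : Q ⊆ Metric.ball c r)
    (hx : x ∉ Metric.ball c (2 * r)) : IntegrableOn (k x) Q μ := by
  obtain ⟨A, hA⟩ := hsize
  refine Measure.integrableOn_of_bounded (M := |A| / r ^ n) hQ'
    (hk.of_uncurry_left).aestronglyMeasurable ?_
  filter_upwards [ae_restrict_mem hQ] with y hy
  have h1 : dist y c < r := hQr hy
  have h2 : 2 * r ≤ dist x c := not_lt.1 hx
  have h3 : r ≤ ‖x - y‖ := by
    rw [← dist_eq_norm]; linarith [dist_triangle x y c]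
  have hne : x ≠ y := by
    rintro rfl; simp at h3; linarith
  refine (hA x y hne).trans ?_
  have : A ≤ |A| := le_abs_self A
  gcongr

/-- Far from an atom, `T 1_Q` is `μ(Q) k(x, c)` up to the oscillation of the kernel. -/
theorem ae_image_sub_eq [IsLocallyFiniteMeasure μ] (hk : Measurable (Function.uncurry k))
    (hT : HasKernel T k)
    (hsize : KernelSize n k) (hR : F.IsAtom R) (hQ : MeasurableSet Q) (hQR : Q ⊆ R) :
    ∀ᵐ x ∂μ, x ∉ F.dilatedBall R →
      T (indL2 μ Q) x - k x (F.center R) * (μ.real Q : ℂ) = kernelDiff μ k (F.center R) Q x := by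
  have hr := hR.radius_pos
  have hQ' : μ Q ≠ ∞ := ((measure_mono hQR).trans_lt hR.lt_top).ne
  have hball := hQR.trans hR.subset_ball
  have hα := F.α_gt
  filter_upwards [ae_image_eq_integral hT hQ hQ' hball] with x hx hxR
  have hdist : F.α * F.radius R ≤ dist x (F.center R) := not_lt.1 hxR
  have hx1 : x ∉ Metric.closedBall (F.center R) (28 * F.radius R) := by
    rw [Metric.mem_closedBall, not_le]
    exact lt_of_lt_of_le (by gcongr; linarith) hdist
  have hx2 : x ∉ Metric.ball (F.center R) (2 * (28 * F.radius R)) := by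
    rw [Metric.mem_ball, not_lt]
    refine le_trans ?_ hdist
    rw [← mul_assoc]; gcongr; linarith
  have hint := integrableOn_kernel hk hsize (by positivity) hQ hQ' hball hx2
  rw [hx hx1, kernelDiff, integral_sub hint (integrableOn_const hQ')]
  simp [mul_comm]

/-- The `j`-th term of the Hörmander sum of an atom. -/
def hormanderTerm (F : NonregularFiltration n μ)
    (k : EuclideanSpace ℝ (Fin d) → EuclideanSpace ℝ (Fin d) → ℂ)
    (R : Set (EuclideanSpace ℝ (Fin d))) (j : ℕ) : ℝ≥0∞ :=
  ⨆ y ∈ R, (μ (F.annulus R (j + 1)) *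
      ∫⁻ x in F.annulus R (j + 1) \ F.dilatedBall R,
        ‖k x y - k x (F.center R)‖ₑ ^ 2 ∂μ) ^ (1 / 2 : ℝ)

theorem compl_dilatedBall_subset (hR : F.IsAtom R) :
    (F.dilatedBall R)ᶜ ⊆ ⋃ j : ℕ, F.annulus R (j + 1) \ F.dilatedBall R := by
  intro x hx
  have hr := hR.radius_pos
  have hα := F.α_gt
  have hdist : F.α * F.radius R ≤ ‖x - F.center R‖ := by
    rw [← dist_eq_norm]; exact not_lt.1 hx
  have h2 : 2 * F.radius R ≤ ‖x - F.center R‖ := by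
    refine le_trans ?_ hdist; gcongr; linarith
  obtain ⟨j, hj1, hj2⟩ := exists_nat_pow_near (x := ‖x - F.center R‖ / (2 * F.radius R))
    (y := (2 : ℝ)) (by rw [one_le_div (by positivity)]; exact h2) one_lt_two
  rw [le_div_iff₀ (by positivity)] at hj1
  rw [div_lt_iff₀ (by positivity)] at hj2
  refine mem_iUnion.2 ⟨j, ⟨?_, ?_⟩, hx⟩
  · rw [pow_succ]; linarith
  · rw [pow_succ 2 (j + 1)]; linarith

theorem measure_mul_lintegral_sq_le {y : EuclideanSpace ℝ (Fin d)} (hy : y ∈ R) (j : ℕ) :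
    μ (F.annulus R (j + 1) \ F.dilatedBall R) *
      ∫⁻ x in F.annulus R (j + 1) \ F.dilatedBall R, ‖k x y - k x (F.center R)‖ₑ ^ 2 ∂μ ≤
      hormanderTerm F k R j ^ 2 := by
  have h : (μ (F.annulus R (j + 1)) * ∫⁻ x in F.annulus R (j + 1) \ F.dilatedBall R,
      ‖k x y - k x (F.center R)‖ₑ ^ 2 ∂μ) ^ (1 / 2 : ℝ) ≤ hormanderTerm F k R j :=
    le_iSup₂_of_le y hy le_rfl
  calc _ ≤ μ (F.annulus R (j + 1)) * ∫⁻ x in F.annulus R (j + 1) \ F.dilatedBall R,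
      ‖k x y - k x (F.center R)‖ₑ ^ 2 ∂μ := by
        gcongr; exact sdiff_subset
    _ = ((μ (F.annulus R (j + 1)) * ∫⁻ x in F.annulus R (j + 1) \ F.dilatedBall R,
      ‖k x y - k x (F.center R)‖ₑ ^ 2 ∂μ) ^ (1 / 2 : ℝ)) ^ 2 := by
        rw [← ENNReal.rpow_natCast, ← ENNReal.rpow_mul]; simp
    _ ≤ _ := by gcongr

/-- The square function estimate that absorbs the off-diagonal terms: the `L_2` Hörmander
condition controls, outside of the dilated ball, the square function of the kernel oscillations. -/
theorem lintegral_far_sqrt_le [IsLocallyFiniteMeasure μ]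
    (hk : Measurable (Function.uncurry k)) {H : ℝ≥0}
    (hR : F.IsAtom R) (hH : ∑' j, hormanderTerm F k R j ≤ H)
    (S : Finset (Set (EuclideanSpace ℝ (Fin d))))
    (hSR : ∀ i ∈ S, i ⊆ R) (hS0 : ∀ i ∈ S, μ i ≠ 0)
    (c : Set (EuclideanSpace ℝ (Fin d)) → ℝ≥0∞) :
    ∫⁻ x in (F.dilatedBall R)ᶜ,
      (∑ i ∈ S, c i * (μ i)⁻¹ * ‖kernelDiff μ k (F.center R) i x‖ₑ ^ 2) ^ (1 / 2 : ℝ) ∂μ ≤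
      H * (∑ i ∈ S, c i * μ i) ^ (1 / 2 : ℝ) := by
  set f : EuclideanSpace ℝ (Fin d) → ℝ≥0∞ := fun x =>
    (∑ i ∈ S, c i * (μ i)⁻¹ * ‖kernelDiff μ k (F.center R) i x‖ₑ ^ 2) ^ (1 / 2 : ℝ) with hf
  have hm : ∀ i, Measurable fun x => ‖kernelDiff μ k (F.center R) i x‖ₑ ^ 2 := fun i =>
    (measurable_kernelDiff hk _ i).enorm.pow_const 2
  have hfm : Measurable f :=
    (Finset.measurable_sum S fun i _ => (hm i).const_mul _).pow_const _
  have hf2 : ∀ x, f x ^ 2 = ∑ i ∈ S, c i * (μ i)⁻¹ * ‖kernelDiff μ k (F.center R) i x‖ₑ ^ 2 := by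
    intro x
    rw [hf, ← ENNReal.rpow_natCast, ← ENNReal.rpow_mul]; simp
  have hpiece : ∀ j : ℕ, ∫⁻ x in F.annulus R (j + 1) \ F.dilatedBall R, f x ∂μ ≤
      hormanderTerm F k R j * (∑ i ∈ S, c i * μ i) ^ (1 / 2 : ℝ) := by
    intro j
    set D := F.annulus R (j + 1) \ F.dilatedBall R with hD
    refine (ENNReal.pow_le_pow_left_iff two_ne_zero).1 ?_
    refine (setLIntegral_sq_le hfm.aemeasurable D).trans ?_
    have hrhs : (hormanderTerm F k R j * (∑ i ∈ S, c i * μ i) ^ (1 / 2 : ℝ)) ^ 2 =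
        ∑ i ∈ S, c i * μ i * hormanderTerm F k R j ^ 2 := by
      rw [mul_pow, ← ENNReal.rpow_natCast (_ ^ (1 / 2 : ℝ)), ← ENNReal.rpow_mul, ← Finset.sum_mul]
      simp [mul_comm]
    simp only [hf2]
    rw [hrhs, lintegral_finsetSum S fun i _ => (hm i).const_mul _, Finset.mul_sum]
    refine Finset.sum_le_sum fun i hi => ?_
    have hfin : μ i ≠ ∞ := ((measure_mono (hSR i hi)).trans_lt hR.lt_top).ne
    have hK : Measurable (Function.uncurry fun x y => ‖k x y - k x (F.center R)‖ₑ ^ 2) :=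
      ((hk.sub (hk.comp (measurable_fst.prodMk measurable_const))).enorm).pow_const 2
    have h1 : ∀ x, ‖kernelDiff μ k (F.center R) i x‖ₑ ^ 2 ≤
        μ i * ∫⁻ y in i, ‖k x y - k x (F.center R)‖ₑ ^ 2 ∂μ := by
      intro x
      refine le_trans ?_ (setLIntegral_sq_le (f := fun y => ‖k x y - k x (F.center R)‖ₑ) ?_ i)
      · gcongr; exact enorm_integral_le_lintegral_enorm _
      · exact ((hk.of_uncurry_left).sub measurable_const).enorm.aemeasurable
    calc μ D * ∫⁻ x in D, c i * (μ i)⁻¹ * ‖kernelDiff μ k (F.center R) i x‖ₑ ^ 2 ∂μ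
        ≤ μ D * ∫⁻ x in D, c i * ∫⁻ y in i, ‖k x y - k x (F.center R)‖ₑ ^ 2 ∂μ ∂μ := by
          refine mul_le_mul' le_rfl (lintegral_mono fun x => ?_)
          calc _ ≤ c i * (μ i)⁻¹ * (μ i * ∫⁻ y in i, ‖k x y - k x (F.center R)‖ₑ ^ 2 ∂μ) := by
                gcongr; exact h1 x
            _ = c i * ((μ i)⁻¹ * μ i) * ∫⁻ y in i, ‖k x y - k x (F.center R)‖ₑ ^ 2 ∂μ := by ring
            _ = _ := by rw [ENNReal.inv_mul_cancel (hS0 i hi) hfin, mul_one]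
      _ = c i * (μ D * ∫⁻ x in D, ∫⁻ y in i, ‖k x y - k x (F.center R)‖ₑ ^ 2 ∂μ ∂μ) := by
          rw [lintegral_const_mul _ hK.lintegral_prod_right]; ring
      _ = c i * ∫⁻ y in i, μ D * ∫⁻ x in D, ‖k x y - k x (F.center R)‖ₑ ^ 2 ∂μ ∂μ := by
          rw [lintegral_lintegral_swap hK.aemeasurable,
            lintegral_const_mul _ (Measurable.lintegral_prod_left hK)]
      _ ≤ c i * ∫⁻ y in i, hormanderTerm F k R j ^ 2 ∂μ := by
          refine mul_le_mul' le_rfl (setLIntegral_mono measurable_const fun y hy => ?_)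
          exact measure_mul_lintegral_sq_le (hSR i hi hy) j
      _ = _ := by rw [setLIntegral_const]; ring
  calc ∫⁻ x in (F.dilatedBall R)ᶜ, f x ∂μ
      ≤ ∫⁻ x in ⋃ j : ℕ, F.annulus R (j + 1) \ F.dilatedBall R, f x ∂μ :=
        lintegral_mono_set (compl_dilatedBall_subset hR)
    _ ≤ ∑' j : ℕ, ∫⁻ x in F.annulus R (j + 1) \ F.dilatedBall R, f x ∂μ :=
        lintegral_iUnion_le _ _
    _ ≤ ∑' j : ℕ, hormanderTerm F k R j * (∑ i ∈ S, c i * μ i) ^ (1 / 2 : ℝ) :=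
        ENNReal.tsum_le_tsum hpiece
    _ ≤ _ := by rw [ENNReal.tsum_mul_right]; gcongr

/-- Far from an atom, the Hörmander condition bounds the oscillation of the kernel in `L_1`. -/
theorem lintegral_far_le [IsLocallyFiniteMeasure μ]
    (hk : Measurable (Function.uncurry k)) {H : ℝ≥0}
    (hR : F.IsAtom R) (hH : ∑' j, hormanderTerm F k R j ≤ H)
    (hQR : Q ⊆ R) (hQ0 : μ Q ≠ 0) :
    ∫⁻ x in (F.dilatedBall R)ᶜ, ‖kernelDiff μ k (F.center R) Q x‖ₑ ∂μ ≤ H * μ Q := by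
  have h := lintegral_far_sqrt_le hk hR hH {Q} (by simpa using hQR)
    (by simpa using hQ0) (fun _ => μ Q)
  have hfin : μ Q ≠ ∞ := ((measure_mono hQR).trans_lt hR.lt_top).ne
  have e : ∀ a : ℝ≥0∞, (a ^ 2) ^ (1 / 2 : ℝ) = a := fun a => by
    rw [← ENNReal.rpow_natCast, ← ENNReal.rpow_mul]; simp
  simp only [Finset.sum_singleton, ENNReal.mul_inv_cancel hQ0 hfin, one_mul, e] at h
  rwa [← sq, e] at h

/-- The gap between an atom and its parent: there `T 1_Q` is controlled by the size of the kernel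
and the integral condition of the filtration. -/
theorem lintegral_gap_le [IsLocallyFiniteMeasure μ] (hT : HasKernel T k) {A C : ℝ≥0}
    (hA : ∀ x y, x ≠ y → ‖k x y‖ ≤ A / ‖x - y‖ ^ n) (hQ : F.IsAtom Q)
    (hC : ∀ x ∈ Q, ∫⁻ y in Metric.ball (F.center R) (F.α * F.radius R) \
      Metric.ball (F.center Q) (56 * F.radius Q), ENNReal.ofReal (1 / ‖x - y‖ ^ n) ∂μ ≤ C) :
    ∫⁻ x in F.dilatedBall R \ F.dilatedBall Q, ‖T (indL2 μ Q) x‖ₑ ∂μ ≤ A * C * μ Q := by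
  have hr := hQ.radius_pos
  have hα := F.α_gt
  set V := F.dilatedBall R \ Metric.ball (F.center Q) (56 * F.radius Q) with hV
  have hsub : F.dilatedBall R \ F.dilatedBall Q ⊆ V := by
    refine sdiff_subset_sdiff_right (Metric.ball_subset_ball ?_)
    gcongr; linarith
  have hVm : MeasurableSet V :=
    (NonregularFiltration.measurableSet_dilatedBall R).diff Metric.isOpen_ball.measurableSet
  have hG : Measurable (Function.uncurry fun x y : EuclideanSpace ℝ (Fin d) =>
      ENNReal.ofReal (1 / ‖y - x‖ ^ n)) := by
    refine Measurable.ennreal_ofReal ?_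
    have : Measurable fun p : EuclideanSpace ℝ (Fin d) × EuclideanSpace ℝ (Fin d) =>
      ‖p.2 - p.1‖ := by fun_prop
    exact (this.pow_const n).const_div 1
  calc ∫⁻ x in F.dilatedBall R \ F.dilatedBall Q, ‖T (indL2 μ Q) x‖ₑ ∂μ
      ≤ ∫⁻ x in V, ‖T (indL2 μ Q) x‖ₑ ∂μ := lintegral_mono_set hsub
    _ ≤ ∫⁻ x in V, ∫⁻ y in Q, A * ENNReal.ofReal (1 / ‖y - x‖ ^ n) ∂μ ∂μ := by
        refine lintegral_mono_ae ?_
        filter_upwards [ae_restrict_mem hVm, ae_restrict_of_ae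
          (ae_image_eq_integral hT hQ.measurableSet hQ.lt_top.ne hQ.subset_ball)] with x hxV hx
        have hd : 56 * F.radius Q ≤ dist x (F.center Q) := not_lt.1 hxV.2
        rw [hx (by rw [Metric.mem_closedBall, not_le]; linarith)]
        refine (enorm_integral_le_lintegral_enorm _).trans
          (setLIntegral_mono' hQ.measurableSet fun y hy => ?_)
        have hy' : dist y (F.center Q) < 28 * F.radius Q := hQ.subset_ball hy
        have hne : x ≠ y := by rintro rfl; linarith
        rw [← ofReal_norm, ← ENNReal.ofReal_coe_nnreal, ← ENNReal.ofReal_mul (NNReal.coe_nonneg A)]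
        refine ENNReal.ofReal_le_ofReal ((hA x y hne).trans_eq ?_)
        rw [norm_sub_rev, mul_one_div]
    _ = ∫⁻ y in Q, ∫⁻ x in V, A * ENNReal.ofReal (1 / ‖y - x‖ ^ n) ∂μ ∂μ :=
        lintegral_lintegral_swap (hG.const_mul _).aemeasurable
    _ ≤ ∫⁻ y in Q, A * C ∂μ := by
        refine setLIntegral_mono' hQ.measurableSet fun y hy => ?_
        rw [lintegral_const_mul]
        · exact mul_le_mul' le_rfl (hC y hy)
        · exact hG.of_uncurry_right
    _ = _ := by rw [setLIntegral_const]

/-- The mean-zero combination of an atom and its parent has image in `L_1`. -/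
theorem lintegral_parent_sub_le [IsLocallyFiniteMeasure μ] (hk : Measurable (Function.uncurry k))
    (hT : HasKernel T k)
    (hsize : KernelSize n k) (hreg : L2Hormander F k) :
    ∃ C : ℝ≥0, ∀ (i : ℤ) (Q R : Set (EuclideanSpace ℝ (Fin d))), Q ∈ F.atoms (i + 1) →
      R ∈ F.atoms i → Q ⊆ R → ∫⁻ x, ‖T (indL2 μ Q) x -
        ((μ.real Q / μ.real R : ℝ) : ℂ) * T (indL2 μ R) x‖ₑ ∂μ ≤ C * μ Q := by
  obtain ⟨H, hH⟩ := hreg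
  obtain ⟨C, hC⟩ := F.parent_integral
  obtain ⟨A, hA⟩ := hsize
  set A' : ℝ≥0 := ⟨|A|, abs_nonneg A⟩ with hA'
  have hA2 : ∀ x y, x ≠ y → ‖k x y‖ ≤ A' / ‖x - y‖ ^ n := fun x y hxy =>
    (hA x y hxy).trans (div_le_div_of_nonneg_right (le_abs_self A) (by positivity))
  refine ⟨2 * (‖T‖₊ * (1 + Real.toNNReal F.β)) + A' * C + 2 * H, fun i Q R hQ hR hQR => ?_⟩
  have hQa : F.IsAtom Q := ⟨_, hQ⟩
  have hRa : F.IsAtom R := ⟨_, hR⟩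
  rcases eq_or_ne Q R with rfl | hne
  · have : ((μ.real Q / μ.real Q : ℝ) : ℂ) = 1 := by
      have : μ.real Q ≠ 0 := (ENNReal.toReal_pos hQa.pos.ne' hQa.lt_top.ne).ne'
      rw [div_self this]; simp
    simp [this]
  have hss : Q ⊂ R := hQR.ssubset_of_ne hne
  set ρ : ℝ := μ.real Q / μ.real R with hρ
  have hρ0 : 0 ≤ ρ := by positivity
  have hRpos : 0 < μ.real R := ENNReal.toReal_pos hRa.pos.ne' hRa.lt_top.ne
  have hρR : ENNReal.ofReal ρ * μ R = μ Q := by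
    rw [← ofReal_measureReal hRa.lt_top.ne, ← ENNReal.ofReal_mul hρ0, hρ,
      div_mul_cancel₀ _ hRpos.ne', ofReal_measureReal hQa.lt_top.ne]
  have hρe : ‖(ρ : ℂ)‖ₑ = ENNReal.ofReal ρ := by
    rw [← ofReal_norm, Complex.norm_real, Real.norm_of_nonneg hρ0]
  set u := T (indL2 μ Q)
  set v := T (indL2 μ R)
  have hu : Measurable fun x => ‖u x‖ₑ := (Lp.stronglyMeasurable u).measurable.enorm
  have hv : Measurable fun x => ‖v x‖ₑ := (Lp.stronglyMeasurable v).measurable.enorm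
  have hball := NonregularFiltration.measurableSet_dilatedBall (F := F) R
  rw [← lintegral_add_compl _ hball]
  have hnear : ∫⁻ x in F.dilatedBall R, ‖u x - ρ * v x‖ₑ ∂μ ≤
      (2 * (‖T‖ₑ * (1 + ENNReal.ofReal F.β)) + A' * C) * μ Q := by
    calc ∫⁻ x in F.dilatedBall R, ‖u x - ρ * v x‖ₑ ∂μ
        ≤ ∫⁻ x in F.dilatedBall R, (‖u x‖ₑ + ENNReal.ofReal ρ * ‖v x‖ₑ) ∂μ := by
          refine lintegral_mono fun x => ?_
          refine enorm_sub_le.trans_eq ?_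
          rw [enorm_mul, hρe]
      _ = ∫⁻ x in F.dilatedBall R, ‖u x‖ₑ ∂μ +
          ENNReal.ofReal ρ * ∫⁻ x in F.dilatedBall R, ‖v x‖ₑ ∂μ := by
          rw [lintegral_add_left hu, lintegral_const_mul _ hv]
      _ ≤ (∫⁻ x in F.dilatedBall Q, ‖u x‖ₑ ∂μ +
            ∫⁻ x in F.dilatedBall R \ F.dilatedBall Q, ‖u x‖ₑ ∂μ) +
          ENNReal.ofReal ρ * (‖T‖ₑ * (1 + ENNReal.ofReal F.β) * μ R) := by
          refine add_le_add ?_ (mul_le_mul' le_rfl ?_)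
          · refine (lintegral_mono_set ?_).trans (lintegral_union_le _ _ _)
            rw [union_sdiff_self]; exact subset_union_right
          · exact setLIntegral_enorm_image_le T hRa.measurableSet hRa.lt_top.ne
              hRa.measure_dilatedBall_le
      _ ≤ (‖T‖ₑ * (1 + ENNReal.ofReal F.β) * μ Q + A' * C * μ Q) +
          ENNReal.ofReal ρ * (‖T‖ₑ * (1 + ENNReal.ofReal F.β) * μ R) := by
          gcongr
          · exact setLIntegral_enorm_image_le T hQa.measurableSet hQa.lt_top.ne
              hQa.measure_dilatedBall_le
          · exact lintegral_gap_le hT hA2 hQa (hC Q R hQa hRa hss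
              (NonregularFiltration.eq_sInter_of_ssubset hQ hR hss))
      _ = _ := by
          have : ENNReal.ofReal ρ * (‖T‖ₑ * (1 + ENNReal.ofReal F.β) * μ R) =
              ‖T‖ₑ * (1 + ENNReal.ofReal F.β) * (ENNReal.ofReal ρ * μ R) := by ring
          rw [this, hρR]; ring
  have hfar : ∫⁻ x in (F.dilatedBall R)ᶜ, ‖u x - ρ * v x‖ₑ ∂μ ≤ 2 * H * μ Q := by
    have hsum : ∑' j, hormanderTerm F k R j ≤ H := hH i R hR
    have m1 := (measurable_kernelDiff (μ := μ) hk (F.center R) Q).enorm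
    have m2 := (measurable_kernelDiff (μ := μ) hk (F.center R) R).enorm
    calc ∫⁻ x in (F.dilatedBall R)ᶜ, ‖u x - ρ * v x‖ₑ ∂μ
        ≤ ∫⁻ x in (F.dilatedBall R)ᶜ, (‖kernelDiff μ k (F.center R) Q x‖ₑ +
            ENNReal.ofReal ρ * ‖kernelDiff μ k (F.center R) R x‖ₑ) ∂μ := by
          refine lintegral_mono_ae ?_
          filter_upwards [ae_restrict_mem hball.compl, ae_restrict_of_ae
            (ae_image_sub_eq hk hT ⟨A, hA⟩ hRa hQa.measurableSet hQR), ae_restrict_of_ae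
            (ae_image_sub_eq hk hT ⟨A, hA⟩ hRa hRa.measurableSet subset_rfl)] with x hx h1 h2
          have e : u x - ρ * v x = kernelDiff μ k (F.center R) Q x -
              ρ * kernelDiff μ k (F.center R) R x := by
            rw [← h1 hx, ← h2 hx]
            have : (ρ : ℂ) * (μ.real R : ℂ) = (μ.real Q : ℂ) := by
              rw [← Complex.ofReal_mul, hρ, div_mul_cancel₀ _ hRpos.ne']
            linear_combination -(k x (F.center R)) * this
          rw [e]
          refine enorm_sub_le.trans_eq ?_
          rw [enorm_mul, hρe]
      _ = ∫⁻ x in (F.dilatedBall R)ᶜ, ‖kernelDiff μ k (F.center R) Q x‖ₑ ∂μ +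
          ENNReal.ofReal ρ *
            ∫⁻ x in (F.dilatedBall R)ᶜ, ‖kernelDiff μ k (F.center R) R x‖ₑ ∂μ := by
          rw [lintegral_add_left m1, lintegral_const_mul _ m2]
      _ ≤ H * μ Q + ENNReal.ofReal ρ * (H * μ R) := by
          gcongr
          · exact lintegral_far_le hk hRa hsum hQR hQa.pos.ne'
          · exact lintegral_far_le hk hRa hsum subset_rfl hRa.pos.ne'
      _ = _ := by
          have : ENNReal.ofReal ρ * (H * μ R) = H * (ENNReal.ofReal ρ * μ R) := by ring
          rw [this, hρR]; ring
  refine (add_le_add hnear hfar).trans_eq ?_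
  rw [← add_mul]
  push_cast
  rfl

end kernelEstimates

/-! ### Trace norm and rank of the terms of the decomposition -/

section levelSum
variable {m : ℕ}

open scoped Classical in
/-- In a finite sum, some terms may be counted by their rank, the others by their trace norm. -/
theorem mul_traceLevel_sum_le {ι : Type*} (S : Finset ι) (Z : ι → Matrix (Fin m) (Fin m) ℂ)
    (near : ι → Prop) {s : ℝ} (hs : 0 < s) :
    s * traceLevel (∑ i ∈ S, Z i) s ≤
      ∑ i ∈ S, if near i then s * ((Z i).rank : ℝ) else traceAbs (Z i) := by
  rw [← Finset.sum_filter_add_sum_filter_not S near Z]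
  have h1 := traceLevel_add_le_rank (∑ i ∈ S.filter near, Z i)
    (∑ i ∈ S.filter fun i => ¬ near i, Z i) hs.le
  have h2 : ((∑ i ∈ S.filter near, Z i).rank : ℝ) ≤ ∑ i ∈ S.filter near, ((Z i).rank : ℝ) := by
    exact_mod_cast rank_sum_le _ _
  have h3 := mul_traceLevel_le_traceAbs (∑ i ∈ S.filter fun i => ¬ near i, Z i) s
  have h4 := traceAbs_sum_le (S.filter fun i => ¬ near i) Z
  rw [Finset.sum_ite, ← Finset.mul_sum]
  nlinarith [mul_le_mul_of_nonneg_left h1 hs.le, mul_le_mul_of_nonneg_left h2 hs.le]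

end levelSum

namespace MassTree

open scoped Classical

variable {I : Type*} {m : ℕ} {t : MassTree I m} {lam : ℝ}

/-- Chebyshev's inequality, in the form in which it enters the bounds of the off-diagonal terms. -/
theorem lam_mul_frobSq_bad_le (hl : 0 < lam) {j : ℕ} (hj : j ≤ t.depth) {Q : I}
    (hQ : Q ∈ t.nodes j) (κ : I → ℂ) :
    Real.sqrt (lam * t.weight Q * frobSq (t.bad lam j Q) *
      ∑ i ∈ t.below j Q, ‖κ i‖ ^ 2 / t.weight i * frobSq (t.root i * t.bad lam j Q)) ≤
    Real.sqrt (t.badMass lam j Q *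
      ∑ i ∈ t.below j Q, ‖κ i‖ ^ 2 / t.weight i * frobSq (t.root i * t.bad lam j Q)) := by
  refine Real.sqrt_le_sqrt (mul_le_mul_of_nonneg_right
    (mul_weight_mul_frobSq_bad_le hl hj hQ) (Finset.sum_nonneg fun i hi => ?_))
  have := (weight_pos_leaf (Finset.mem_filter.1 hi).1).le
  have := frobSq_nonneg (t.root i * t.bad lam j Q)
  positivity

theorem traceAbs_rowTerm_le (hl : 0 < lam) {j : ℕ} (hj : j ≤ t.depth) {Q : I}
    (hQ : Q ∈ t.nodes j) (κ : I → ℂ) :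
    traceAbs (t.rowTerm lam j Q κ) ≤ Real.sqrt (t.badMass lam j Q *
      ∑ i ∈ t.below j Q, ‖κ i‖ ^ 2 / t.weight i * frobSq (t.root i * t.bad lam j Q)) :=
  (traceAbs_offDiag_le (t.below j Q) κ t.weight t.root
    (fun _ hi => weight_pos_leaf (Finset.mem_filter.1 hi).1) (t.bad_isProj hl j Q)
    (mul_nonneg hl.le (weight_pos_of_mem hj hQ).le) (sum_below_good_le hl hj hQ)).trans
    (lam_mul_frobSq_bad_le hl hj hQ κ)

theorem traceAbs_colTerm_le (hl : 0 < lam) {j : ℕ} (hj : j ≤ t.depth) {Q : I}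
    (hQ : Q ∈ t.nodes j) (κ : I → ℂ) :
    traceAbs (t.colTerm lam j Q κ) ≤ Real.sqrt (t.badMass lam j Q *
      ∑ i ∈ t.below j Q, ‖κ i‖ ^ 2 / t.weight i * frobSq (t.root i * t.bad lam j Q)) :=
  (traceAbs_offDiag_le' (t.below j Q) κ t.weight t.root
    (fun _ hi => weight_pos_leaf (Finset.mem_filter.1 hi).1) (t.bad_isProj hl j Q)
    (t.good_isProj hl j Q)
    (mul_nonneg hl.le (weight_pos_of_mem hj hQ).le) (sum_below_good_le hl hj hQ)).trans
    (lam_mul_frobSq_bad_le hl hj hQ κ)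

theorem traceAbs_compress_le (hl : 0 < lam) (j : ℕ) (Q i : I) :
    traceAbs (t.bad lam j Q * t.val i * t.bad lam j Q) ≤
      frobSq (t.root i * t.bad lam j Q) := by
  have : t.bad lam j Q * t.val i * t.bad lam j Q =
      (t.root i * t.bad lam j Q)ᴴ * (t.root i * t.bad lam j Q) := by
    rw [Matrix.conjTranspose_mul, (t.bad_isProj hl j Q).1, val]
    simp only [Matrix.mul_assoc]
  rw [this]
  exact traceAbs_conjTranspose_mul_self_le _

theorem traceAbs_diagTerm_le (hl : 0 < lam) (j : ℕ) (Q : I) (κ : I → ℂ) :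
    traceAbs (t.diagTerm lam j Q κ) ≤
      ∑ i ∈ t.below j Q, frobSq (t.root i * t.bad lam j Q) * ‖κ i‖ +
        traceAbs (t.badDensity lam j Q) * ‖κ Q‖ := by
  rw [diagTerm, sub_eq_add_neg, ← neg_smul]
  refine (traceAbs_add_le _ _).trans (add_le_add ((traceAbs_sum_le _ _).trans ?_) ?_)
  · refine Finset.sum_le_sum fun i _ => (traceAbs_smul_le _ _).trans ?_
    rw [mul_comm]
    gcongr; exact traceAbs_compress_le hl j Q i
  · refine (traceAbs_smul_le _ _).trans_eq ?_
    rw [norm_neg, mul_comm]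

theorem weight_mul_traceAbs_badDensity_le (hl : 0 < lam) {j : ℕ} (hj : j ≤ t.depth) {Q : I}
    (hQ : Q ∈ t.nodes j) : t.weight Q * traceAbs (t.badDensity lam j Q) ≤ t.badMass lam j Q := by
  have hw := weight_pos_of_mem hj hQ
  have h := sum_below_compress hj hQ (t.weight Q : ℂ)⁻¹ (t.bad lam j Q) (t.bad lam j Q)
  rw [inv_mul_cancel₀ (by exact_mod_cast hw.ne'), one_smul] at h
  rw [badDensity, ← h, badMass]
  calc _ ≤ t.weight Q * ∑ i ∈ t.below j Q,
        (t.weight Q)⁻¹ * (t.weight i * frobSq (t.root i * t.bad lam j Q)) := by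
        refine mul_le_mul_of_nonneg_left ((traceAbs_sum_le _ _).trans
          (Finset.sum_le_sum fun i hi => (traceAbs_smul_le _ _).trans ?_)) hw.le
        have hwi := weight_pos_leaf (Finset.mem_filter.1 hi).1
        rw [norm_mul, norm_inv, Complex.norm_real, Complex.norm_real, Real.norm_of_nonneg hw.le,
          Real.norm_of_nonneg hwi.le, mul_assoc]
        gcongr; exact traceAbs_compress_le hl j Q i
    _ = _ := by rw [← Finset.mul_sum, mul_inv_cancel_left₀ hw.ne']

/-- Near a node, the terms attached to it are counted by rank, whatever the size of the kernel. -/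
theorem rank_terms_le (j : ℕ) (Q : I) (u : I → ℂ) :
    (t.rowTerm lam j Q u + t.colTerm lam j Q u + t.diagTerm lam j Q u).rank ≤
      3 * (t.bad lam j Q).rank := by
  have h1 : (t.rowTerm lam j Q u).rank ≤ (t.bad lam j Q).rank := by
    have : t.rowTerm lam j Q u = t.bad lam j Q *
        ∑ i ∈ t.below j Q, u i • (t.val i * t.good lam j Q) := by
      rw [rowTerm, Matrix.mul_sum]
      simp only [Matrix.mul_smul, Matrix.mul_assoc]
    rw [this]; exact Matrix.rank_mul_le_left _ _
  have h2 : (t.colTerm lam j Q u).rank ≤ (t.bad lam j Q).rank := by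
    have : t.colTerm lam j Q u =
        (∑ i ∈ t.below j Q, u i • (t.good lam j Q * t.val i)) * t.bad lam j Q := by
      rw [colTerm, Matrix.sum_mul]
      simp only [Matrix.smul_mul]
    rw [this]; exact Matrix.rank_mul_le_right _ _
  have h3 : (t.diagTerm lam j Q u).rank ≤ (t.bad lam j Q).rank := by
    have : t.diagTerm lam j Q u = (∑ i ∈ t.below j Q, u i • (t.bad lam j Q * t.val i) -
        u Q • (t.bad lam j Q * t.density j Q)) * t.bad lam j Q := by
      rw [diagTerm, Matrix.sub_mul, Matrix.sum_mul, badDensity]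
      simp only [Matrix.smul_mul]
    rw [this]; exact Matrix.rank_mul_le_right _ _
  have h4 := rank_add_le (t.rowTerm lam j Q u + t.colTerm lam j Q u) (t.diagTerm lam j Q u)
  have h5 := rank_add_le (t.rowTerm lam j Q u) (t.colTerm lam j Q u)
  omega

theorem mul_rank_bad_le (hl : 0 < lam) {j : ℕ} (hj : j ≤ t.depth) {Q : I}
    (hQ : Q ∈ t.nodes j) : lam * t.weight Q * ((t.bad lam j Q).rank : ℝ) ≤ t.badMass lam j Q :=
  (mul_le_mul_of_nonneg_left (t.rank_bad_le hl j Q)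
    (mul_nonneg hl.le (weight_pos_of_mem hj hQ).le)).trans (mul_weight_mul_frobSq_bad_le hl hj hQ)

/-- There is no bad part at a node whose weight is large compared to the total mass. -/
theorem badDensity_eq_zero (hl : 0 < lam) {j : ℕ} (hj : j ≤ t.depth) {Q : I}
    (hQ : Q ∈ t.nodes j) (h : t.mass < lam * t.weight Q) : t.badDensity lam j Q = 0 := by
  have h1 : t.badMass lam j Q ≤ t.mass := by
    refine le_trans ?_ (sum_badMass_le hl)
    refine le_trans ?_ (Finset.single_le_sum (f := fun j => ∑ Q ∈ t.nodes j, t.badMass lam j Q)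
      (fun _ _ => Finset.sum_nonneg fun _ _ => badMass_nonneg)
      (Finset.mem_range.2 (Nat.lt_succ_of_le hj)))
    exact Finset.single_le_sum (f := fun Q => t.badMass lam j Q) (fun _ _ => badMass_nonneg) hQ
  have h2 := mul_rank_bad_le hl hj hQ
  have h3 : (t.bad lam j Q).rank = 0 := by
    by_contra hne
    have : (1 : ℝ) ≤ (t.bad lam j Q).rank := by exact_mod_cast Nat.one_le_iff_ne_zero.2 hne
    have hw : 0 < lam * t.weight Q := mul_pos hl (weight_pos_of_mem hj hQ)
    nlinarith
  have h4 : t.bad lam j Q = 0 := by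
    refine Matrix.toLin'.injective ?_
    rw [Matrix.toLin'_apply', map_zero, ← LinearMap.range_eq_bot]
    exact Submodule.finrank_eq_zero.1 h3
  rw [badDensity, h4, Matrix.mul_zero]

end MassTree

/-! ### Majorants for the level function of the image -/

section trees

open scoped Classical

variable {d n : ℕ} {μ : Measure (EuclideanSpace ℝ (Fin d))} {m : ℕ}

variable {s : ℝ}

theorem ae_sum_smul_apply {ι : Type*} (P : Finset ι) (c : ι → ℂ) (g : ι → Lp ℂ 2 μ) :
    ∀ᵐ x ∂μ, (∑ i ∈ P, c i • g i : Lp ℂ 2 μ) x = ∑ i ∈ P, c i • g i x := by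
  induction P using Finset.induction_on with
  | empty =>
    filter_upwards [Lp.coeFn_zero ℂ 2 μ] with x hx
    simpa using hx
  | insert a P ha ih =>
    rw [Finset.sum_insert ha]
    filter_upwards [Lp.coeFn_add (c a • g a) (∑ i ∈ P, c i • g i), Lp.coeFn_smul (c a) (g a), ih]
      with x h1 h2 h3
    rw [h1, Pi.add_apply, h2, h3, Finset.sum_insert ha, Pi.smul_apply]

/-- The image of the martingale part has the same form, with `T 1_Q` in place of `1_Q`. -/
theorem ae_martingalePart_eq (T : Lp ℂ 2 μ →L[ℂ] Lp ℂ 2 μ)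
    (t : MassTree (Set (EuclideanSpace ℝ (Fin d))) m) (a b : Fin m) :
    ∀ᵐ x ∂μ, T (t.martingalePart s (indL2 μ) t.depth a b) x =
      t.martingalePart s (fun Q => T (indL2 μ Q) x) t.depth a b := by
  simp only [MassTree.martingalePart, map_add, map_sum, map_smul]
  rw [Finset.sum_sigma' (Finset.range t.depth) fun j => t.nodes j]
  filter_upwards [Lp.coeFn_add (∑ Q ∈ t.nodes t.depth,
      t.goodDensity s t.depth Q a b • T (indL2 μ Q)) _,
    ae_sum_smul_apply (t.nodes t.depth) (fun Q => t.goodDensity s t.depth Q a b)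
      (fun Q => T (indL2 μ Q)),
    ae_sum_smul_apply ((Finset.range t.depth).sigma fun j => t.nodes j)
      (fun p => t.correction s p.1 p.2 a b) (fun p => T (indL2 μ p.2))] with x h1 h2 h3
  rw [h1, Pi.add_apply, h2, h3, Finset.sum_sigma]

/-- Terms with image in `L_1`, through the triangle inequality. -/
theorem exists_majorant_sum {ι : Type*} (P : Finset ι) (hs : 0 < s)
    (g : ι → EuclideanSpace ℝ (Fin d) → ℂ) (hg : ∀ i, Measurable (g i))
    (D : ι → Matrix (Fin m) (Fin m) ℂ) (c : ι → ℝ≥0∞)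
    (hc : ∀ i ∈ P, ENNReal.ofReal (traceAbs (D i)) * ∫⁻ x, ‖g i x‖ₑ ∂μ ≤ c i) :
    ∃ Ψ : EuclideanSpace ℝ (Fin d) → ℝ≥0∞, Measurable Ψ ∧
      (∀ x, ENNReal.ofReal s * ENNReal.ofReal (traceLevel (∑ i ∈ P, g i x • D i) s) ≤ Ψ x) ∧
      ∫⁻ x, Ψ x ∂μ ≤ ∑ i ∈ P, c i := by
  have hm : ∀ i, Measurable fun x => ENNReal.ofReal (traceAbs (D i)) * ‖g i x‖ₑ := fun i =>
    (hg i).enorm.const_mul _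
  refine ⟨fun x => ∑ i ∈ P, ENNReal.ofReal (traceAbs (D i)) * ‖g i x‖ₑ,
    Finset.measurable_sum _ fun i _ => hm i, fun x => ?_, ?_⟩
  · rw [← ENNReal.ofReal_mul hs.le]
    have e : ∑ i ∈ P, ENNReal.ofReal (traceAbs (D i)) * ‖g i x‖ₑ =
        ENNReal.ofReal (∑ i ∈ P, ‖g i x‖ * traceAbs (D i)) := by
      rw [ENNReal.ofReal_sum_of_nonneg fun i _ => mul_nonneg (norm_nonneg _) (traceAbs_nonneg _)]
      refine Finset.sum_congr rfl fun i _ => ?_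
      rw [ENNReal.ofReal_mul (norm_nonneg _), ofReal_norm, mul_comm]
    refine (ENNReal.ofReal_le_ofReal ?_).trans_eq e.symm
    exact ((mul_traceLevel_le_traceAbs _ s).trans
      ((traceAbs_sum_le _ _).trans (Finset.sum_le_sum fun i _ => traceAbs_smul_le _ _)))
  · rw [lintegral_finsetSum _ fun i _ => hm i]
    refine Finset.sum_le_sum fun i hi => ?_
    rw [lintegral_const_mul _ (hg i).enorm]
    exact hc i hi

/-- The majorant, away from the dilated ball of a node, of the trace norm of the terms of the
node. -/
def farMajorant (μ : Measure (EuclideanSpace ℝ (Fin d)))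
    (t : MassTree (Set (EuclideanSpace ℝ (Fin d))) m) (s : ℝ) (j : ℕ)
    (Q : Set (EuclideanSpace ℝ (Fin d))) (κ : Set (EuclideanSpace ℝ (Fin d)) → ℂ) : ℝ≥0∞ :=
  2 * (ENNReal.ofReal (t.badMass s j Q) ^ (1 / 2 : ℝ) * (∑ i ∈ t.below j Q,
    ENNReal.ofReal (frobSq (t.root i * t.bad s j Q)) * (μ i)⁻¹ * ‖κ i‖ₑ ^ 2) ^ (1 / 2 : ℝ)) +
  (∑ i ∈ t.below j Q, ENNReal.ofReal (frobSq (t.root i * t.bad s j Q)) * ‖κ i‖ₑ +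
    ENNReal.ofReal (traceAbs (t.badDensity s j Q)) * ‖κ Q‖ₑ)

theorem measurable_farMajorant (t : MassTree (Set (EuclideanSpace ℝ (Fin d))) m) (j : ℕ)
    (Q : Set (EuclideanSpace ℝ (Fin d)))
    {κ : EuclideanSpace ℝ (Fin d) → Set (EuclideanSpace ℝ (Fin d)) → ℂ}
    (hκ : ∀ i, Measurable fun x => κ x i) : Measurable fun x => farMajorant μ t s j Q (κ x) := by
  have h1 : ∀ i, Measurable fun x => ‖κ x i‖ₑ := fun i => (hκ i).enorm
  unfold farMajorant
  refine Measurable.add (((Measurable.pow_const (Finset.measurable_sum _ fun i _ =>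
    ((h1 i).pow_const 2).const_mul _) _).const_mul _).const_mul _)
    ((Finset.measurable_sum _ fun i _ => (h1 i).const_mul _).add ((h1 Q).const_mul _))

variable [IsLocallyFiniteMeasure μ] {F : NonregularFiltration n μ}

/-- The tree of the ancestors, `L` generations back, of finitely many atoms of generation `N`. -/
def NonregularFiltration.massTree (F : NonregularFiltration n μ) {N : ℤ} (L : ℕ)
    {S : Finset (Set (EuclideanSpace ℝ (Fin d)))} (hS : ∀ i ∈ S, i ∈ F.atoms N)
    (B : Set (EuclideanSpace ℝ (Fin d)) → Matrix (Fin m) (Fin m) ℂ) :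
    MassTree (Set (EuclideanSpace ℝ (Fin d))) m where
  leaves := S
  depth := L
  anc j Q := F.ancestor (N - L + j) Q
  weight Q := μ.real Q
  root := B
  anc_depth i hi := by
    rw [sub_add_cancel]
    exact NonregularFiltration.ancestor_eq le_rfl (hS i hi) (hS i hi) subset_rfl
  anc_anc i hi j j' h h' :=
    NonregularFiltration.ancestor_ancestor (by omega) (by omega) (hS i hi)
  weight_pos i hi j hj := by
    have h : F.IsAtom (F.ancestor (N - L + j) i) :=
      ⟨_, NonregularFiltration.ancestor_mem (by omega) (hS i hi)⟩
    exact ENNReal.toReal_pos h.pos.ne' h.lt_top.ne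

variable {N : ℤ} {L : ℕ} {S : Finset (Set (EuclideanSpace ℝ (Fin d)))}
  {hS : ∀ i ∈ S, i ∈ F.atoms N}
  {B : Set (EuclideanSpace ℝ (Fin d)) → Matrix (Fin m) (Fin m) ℂ}
  {k : EuclideanSpace ℝ (Fin d) → EuclideanSpace ℝ (Fin d) → ℂ}
  {T : Lp ℂ 2 μ →L[ℂ] Lp ℂ 2 μ}

theorem mem_atoms_of_mem_nodes {j : ℕ} (hj : j ≤ L) {Q : Set (EuclideanSpace ℝ (Fin d))}
    (hQ : Q ∈ (F.massTree L hS B).nodes j) : Q ∈ F.atoms (N - L + j) := by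
  obtain ⟨i, hi, rfl⟩ := Finset.mem_image.1 hQ
  exact NonregularFiltration.ancestor_mem (by omega) (hS i hi)

theorem subset_of_mem_below {j : ℕ} (hj : j ≤ L) {Q i : Set (EuclideanSpace ℝ (Fin d))}
    (hi : i ∈ (F.massTree L hS B).below j Q) : i ∈ S ∧ i ⊆ Q := by
  obtain ⟨h1, h2⟩ := Finset.mem_filter.1 hi
  refine ⟨h1, ?_⟩
  rw [← h2]
  exact NonregularFiltration.subset_ancestor (by omega) (hS i h1)

theorem ofReal_weight {j : ℕ} (hj : j ≤ L) {Q : Set (EuclideanSpace ℝ (Fin d))}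
    (hQ : Q ∈ (F.massTree L hS B).nodes j) :
    ENNReal.ofReal ((F.massTree L hS B).weight Q) = μ Q :=
  ofReal_measureReal (NonregularFiltration.IsAtom.lt_top ⟨_, mem_atoms_of_mem_nodes hj hQ⟩).ne

theorem inner_indL2 {j j' : ℕ} (hjj' : j ≤ j') (hj' : j' ≤ L)
    {R Q : Set (EuclideanSpace ℝ (Fin d))} (hR : R ∈ (F.massTree L hS B).nodes j)
    (hQ : Q ∈ (F.massTree L hS B).nodes j') :
    inner ℂ (indL2 μ R) (indL2 μ Q) =
      if (F.massTree L hS B).anc j Q = R then ((F.massTree L hS B).weight Q : ℂ) else 0 := by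
  have hRm := mem_atoms_of_mem_nodes (hjj'.trans hj') hR
  have hQm := mem_atoms_of_mem_nodes hj' hQ
  have hRa : F.IsAtom R := ⟨_, hRm⟩
  have hQa : F.IsAtom Q := ⟨_, hQm⟩
  have hle : N - L + (j : ℤ) ≤ N - L + j' := by omega
  rw [indL2_of hRa.measurableSet hRa.lt_top.ne, indL2_of hQa.measurableSet hQa.lt_top.ne,
    L2.inner_indicatorConstLp_one_indicatorConstLp_one hRa.measurableSet hQa.measurableSet
      hRa.lt_top.ne hQa.lt_top.ne]
  change _ = if F.ancestor (N - L + j) Q = R then (μ.real Q : ℂ) else 0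
  split_ifs with h
  · have : Q ⊆ R := h ▸ NonregularFiltration.subset_ancestor hle hQm
    rw [inter_eq_right.2 this]; rfl
  · have : Disjoint Q R := by
      refine (NonregularFiltration.subset_or_disjoint hle hQm hRm).resolve_left fun h' => h ?_
      exact NonregularFiltration.ancestor_eq hle hQm hRm h'
    rw [this.symm.inter_eq]; simp

/-- The martingale part, through the boundedness of `T` on `L_2`. -/
theorem exists_majorant_martingalePart (T : Lp ℂ 2 μ →L[ℂ] Lp ℂ 2 μ) (hs : 0 < s)
    {t : MassTree (Set (EuclideanSpace ℝ (Fin d))) m} (ht : t = F.massTree L hS B) :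
    ∃ Ψ : EuclideanSpace ℝ (Fin d) → ℝ≥0∞, Measurable Ψ ∧
      (∀ᵐ x ∂μ, ENNReal.ofReal s * ENNReal.ofReal (traceLevel (Matrix.of fun a b =>
        t.martingalePart s (fun Q => T (indL2 μ Q) x) t.depth a b) s) ≤ Ψ x) ∧
      ∫⁻ x, Ψ x ∂μ ≤ 3 * ‖T‖ₑ ^ 2 * ENNReal.ofReal t.mass := by
  set V : Fin m → Fin m → Lp ℂ 2 μ := fun a b => t.martingalePart s (indL2 μ) t.depth a b with hV
  have hs0 : ENNReal.ofReal s ≠ 0 := (ENNReal.ofReal_pos.2 hs).ne'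
  have hm : ∀ a b, Measurable fun x => ‖T (V a b) x‖ₑ ^ 2 := fun a b =>
    (Lp.stronglyMeasurable (T (V a b))).measurable.enorm.pow_const 2
  refine ⟨fun x => (ENNReal.ofReal s)⁻¹ * ∑ a, ∑ b, ‖T (V a b) x‖ₑ ^ 2, ?_, ?_, ?_⟩
  · exact (Finset.measurable_sum _ fun a _ => Finset.measurable_sum _ fun b _ => hm a b).const_mul _
  · have h : ∀ᵐ x ∂μ, ∀ a b, T (V a b) x =
        t.martingalePart s (fun Q => T (indL2 μ Q) x) t.depth a b :=
      ae_all_iff.2 fun a => ae_all_iff.2 fun b => ae_martingalePart_eq T t a b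
    filter_upwards [h] with x hx
    set M : Matrix (Fin m) (Fin m) ℂ := Matrix.of fun a b =>
      t.martingalePart s (fun Q => T (indL2 μ Q) x) t.depth a b with hM
    have e : ∑ a, ∑ b, ‖T (V a b) x‖ₑ ^ 2 = ENNReal.ofReal (frobSq M) := by
      rw [frobSq, ENNReal.ofReal_sum_of_nonneg fun _ _ => by positivity]
      refine Finset.sum_congr rfl fun a _ => ?_
      rw [ENNReal.ofReal_sum_of_nonneg fun _ _ => by positivity]
      refine Finset.sum_congr rfl fun b _ => ?_
      rw [hx a b, ENNReal.ofReal_pow (norm_nonneg _), ofReal_norm]; rfl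
    rw [e, ← ENNReal.ofReal_inv_of_pos hs, ← ENNReal.ofReal_mul hs.le,
      ← ENNReal.ofReal_mul (inv_nonneg.2 hs.le)]
    refine ENNReal.ofReal_le_ofReal ?_
    rw [inv_mul_eq_div, le_div_iff₀ hs]
    linarith [sq_mul_traceLevel_le_frobSq M hs.le]
  · rw [lintegral_const_mul _ (Finset.measurable_sum _ fun a _ =>
      Finset.measurable_sum _ fun b _ => hm a b),
      lintegral_finsetSum _ fun a _ => Finset.measurable_sum _ fun b _ => hm a b]
    simp only [lintegral_finsetSum _ fun b _ => hm _ b, enorm_sq_Lp]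
    have h1 : ∑ a, ∑ b, ‖T (V a b)‖ₑ ^ 2 ≤ ‖T‖ₑ ^ 2 * ENNReal.ofReal (3 * s * t.mass) := by
      calc _ ≤ ∑ a, ∑ b, ‖T‖ₑ ^ 2 * ENNReal.ofReal (‖V a b‖ ^ 2) := by
            refine Finset.sum_le_sum fun a _ => Finset.sum_le_sum fun b _ => ?_
            rw [ENNReal.ofReal_pow (norm_nonneg _), ofReal_norm, ← mul_pow]
            gcongr; exact T.le_opENorm _
        _ = ‖T‖ₑ ^ 2 * ENNReal.ofReal (∑ a, ∑ b, ‖V a b‖ ^ 2) := by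
            rw [ENNReal.ofReal_sum_of_nonneg fun _ _ => by positivity, Finset.mul_sum]
            refine Finset.sum_congr rfl fun a _ => ?_
            rw [ENNReal.ofReal_sum_of_nonneg fun _ _ => by positivity, Finset.mul_sum]
        _ ≤ _ := by
            refine mul_le_mul' le_rfl (ENNReal.ofReal_le_ofReal ?_)
            refine MassTree.sum_norm_sq_martingalePart_le ?_ hs
            subst ht
            exact fun j j' h h' R hR Q hQ => inner_indL2 h h' hR hQ
    calc _ ≤ (ENNReal.ofReal s)⁻¹ * (‖T‖ₑ ^ 2 * ENNReal.ofReal (3 * s * t.mass)) := by gcongr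
      _ = (ENNReal.ofReal s)⁻¹ * (‖T‖ₑ ^ 2 * (3 * (ENNReal.ofReal s * ENNReal.ofReal t.mass))) := by
          rw [mul_assoc 3, ENNReal.ofReal_mul (by norm_num), ENNReal.ofReal_mul hs.le]; norm_num
      _ = ((ENNReal.ofReal s)⁻¹ * ENNReal.ofReal s) * (3 * ‖T‖ₑ ^ 2 * ENNReal.ofReal t.mass) := by
          ring
      _ = _ := by rw [ENNReal.inv_mul_cancel hs0 ENNReal.ofReal_ne_top, one_mul]

theorem ofReal_traceAbs_badDensity_mul_le (hs : 0 < s) {j : ℕ} (hj : j ≤ L)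
    {Q : Set (EuclideanSpace ℝ (Fin d))} (hQ : Q ∈ (F.massTree L hS B).nodes j) :
    ENNReal.ofReal (traceAbs ((F.massTree L hS B).badDensity s j Q)) * μ Q ≤
      ENNReal.ofReal ((F.massTree L hS B).badMass s j Q) := by
  rw [← ofReal_weight hj hQ, ← ENNReal.ofReal_mul (traceAbs_nonneg _), mul_comm]
  exact ENNReal.ofReal_le_ofReal (MassTree.weight_mul_traceAbs_badDensity_le hs hj hQ)

theorem ofReal_traceAbs_terms_le (hs : 0 < s) {t : MassTree (Set (EuclideanSpace ℝ (Fin d))) m}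
    (ht : t = F.massTree L hS B) {j : ℕ} (hj : j ≤ L) {Q : Set (EuclideanSpace ℝ (Fin d))}
    (hQ : Q ∈ t.nodes j) (κ : Set (EuclideanSpace ℝ (Fin d)) → ℂ) :
    ENNReal.ofReal (traceAbs (t.rowTerm s j Q κ + t.colTerm s j Q κ + t.diagTerm s j Q κ)) ≤
      farMajorant μ t s j Q κ := by
  subst ht
  set t := F.massTree L hS B with ht
  have hw : ∀ i ∈ t.below j Q, 0 < t.weight i ∧ ENNReal.ofReal (t.weight i) = μ i := by
    intro i hi
    have hiS : F.IsAtom i := ⟨_, hS i (subset_of_mem_below hj hi).1⟩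
    exact ⟨ENNReal.toReal_pos hiS.pos.ne' hiS.lt_top.ne, ofReal_measureReal hiS.lt_top.ne⟩
  set X := ∑ i ∈ t.below j Q, ‖κ i‖ ^ 2 / t.weight i * frobSq (t.root i * t.bad s j Q) with hX
  have hX0 : ∀ i ∈ t.below j Q,
      0 ≤ ‖κ i‖ ^ 2 / t.weight i * frobSq (t.root i * t.bad s j Q) := fun i hi =>
    mul_nonneg (div_nonneg (by positivity) (hw i hi).1.le) (frobSq_nonneg _)
  have eX : ENNReal.ofReal X = ∑ i ∈ t.below j Q,
      ENNReal.ofReal (frobSq (t.root i * t.bad s j Q)) * (μ i)⁻¹ * ‖κ i‖ₑ ^ 2 := by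
    rw [hX, ENNReal.ofReal_sum_of_nonneg hX0]
    refine Finset.sum_congr rfl fun i hi => ?_
    rw [ENNReal.ofReal_mul (div_nonneg (by positivity) (hw i hi).1.le),
      ENNReal.ofReal_div_of_pos (hw i hi).1, (hw i hi).2, ENNReal.ofReal_pow (norm_nonneg _),
      ofReal_norm, div_eq_mul_inv]
    ring
  have h1 := MassTree.traceAbs_rowTerm_le hs hj hQ κ
  have h2 := MassTree.traceAbs_colTerm_le hs hj hQ κ
  have h3 := t.traceAbs_diagTerm_le hs j Q κ
  have h4 := traceAbs_add_le (t.rowTerm s j Q κ + t.colTerm s j Q κ) (t.diagTerm s j Q κ)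
  have h5 := traceAbs_add_le (t.rowTerm s j Q κ) (t.colTerm s j Q κ)
  have hb : 0 ≤ t.badMass s j Q := MassTree.badMass_nonneg
  have hsq : ENNReal.ofReal (Real.sqrt (t.badMass s j Q * X)) =
      ENNReal.ofReal (t.badMass s j Q) ^ (1 / 2 : ℝ) * ENNReal.ofReal X ^ (1 / 2 : ℝ) := by
    rw [Real.sqrt_eq_rpow, ← ENNReal.ofReal_rpow_of_nonneg
      (mul_nonneg hb (Finset.sum_nonneg hX0)) (by norm_num), ENNReal.ofReal_mul hb,
      ENNReal.mul_rpow_of_nonneg _ _ (by norm_num)]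
  have hd : ENNReal.ofReal (∑ i ∈ t.below j Q, frobSq (t.root i * t.bad s j Q) * ‖κ i‖ +
      traceAbs (t.badDensity s j Q) * ‖κ Q‖) =
      ∑ i ∈ t.below j Q, ENNReal.ofReal (frobSq (t.root i * t.bad s j Q)) * ‖κ i‖ₑ +
        ENNReal.ofReal (traceAbs (t.badDensity s j Q)) * ‖κ Q‖ₑ := by
    rw [ENNReal.ofReal_add (Finset.sum_nonneg fun i _ => mul_nonneg (frobSq_nonneg _)
      (norm_nonneg _)) (mul_nonneg (traceAbs_nonneg _) (norm_nonneg _)),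
      ENNReal.ofReal_sum_of_nonneg fun i _ => mul_nonneg (frobSq_nonneg _) (norm_nonneg _),
      ENNReal.ofReal_mul (traceAbs_nonneg _), ofReal_norm]
    congr 1
    refine Finset.sum_congr rfl fun i _ => ?_
    rw [ENNReal.ofReal_mul (frobSq_nonneg _), ofReal_norm]
  rw [farMajorant, ← eX, ← hsq, ← hd, two_mul, ← ENNReal.ofReal_add (Real.sqrt_nonneg _)
    (Real.sqrt_nonneg _), ← ENNReal.ofReal_add (by positivity)]
  · exact ENNReal.ofReal_le_ofReal (by linarith)
  · exact (traceAbs_nonneg _).trans h3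

theorem lintegral_farMajorant_le (hk : Measurable (Function.uncurry k)) (hs : 0 < s)
    {t : MassTree (Set (EuclideanSpace ℝ (Fin d))) m} (ht : t = F.massTree L hS B)
    {j : ℕ} (hj : j ≤ L) {Q : Set (EuclideanSpace ℝ (Fin d))} (hQ : Q ∈ t.nodes j)
    {H : ℝ≥0} (hH : ∑' j, hormanderTerm F k Q j ≤ H) :
    ∫⁻ x in (F.dilatedBall Q)ᶜ, farMajorant μ t s j Q
      (fun i => kernelDiff μ k (F.center Q) i x) ∂μ ≤
      4 * H * ENNReal.ofReal (t.badMass s j Q) := by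
  subst ht
  set t := F.massTree L hS B with ht
  have hQa : F.IsAtom Q := ⟨_, mem_atoms_of_mem_nodes hj hQ⟩
  have hm : ∀ i, Measurable fun x => ‖kernelDiff μ k (F.center Q) i x‖ₑ := fun i =>
    (measurable_kernelDiff hk _ i).enorm
  have hi0 : ∀ i ∈ t.below j Q, F.IsAtom i ∧ i ⊆ Q := fun i hi =>
    ⟨⟨_, hS i (subset_of_mem_below hj hi).1⟩, (subset_of_mem_below hj hi).2⟩
  have hbm : ∑ i ∈ t.below j Q, ENNReal.ofReal (frobSq (t.root i * t.bad s j Q)) * μ i =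
      ENNReal.ofReal (t.badMass s j Q) := by
    have hw : ∀ i ∈ t.below j Q, 0 < t.weight i ∧ ENNReal.ofReal (t.weight i) = μ i := fun i hi =>
      ⟨MassTree.weight_pos_leaf (Finset.mem_filter.1 hi).1,
        ofReal_measureReal (hi0 i hi).1.lt_top.ne⟩
    rw [MassTree.badMass, ENNReal.ofReal_sum_of_nonneg fun i hi =>
      mul_nonneg (hw i hi).1.le (frobSq_nonneg _)]
    refine Finset.sum_congr rfl fun i hi => ?_
    rw [ENNReal.ofReal_mul (hw i hi).1.le, (hw i hi).2, mul_comm]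
  have hm1 : Measurable fun x => (∑ i ∈ t.below j Q,
      ENNReal.ofReal (frobSq (t.root i * t.bad s j Q)) * (μ i)⁻¹ *
        ‖kernelDiff μ k (F.center Q) i x‖ₑ ^ 2) ^ (1 / 2 : ℝ) :=
    (Finset.measurable_sum _ fun i _ => ((hm i).pow_const 2).const_mul _).pow_const _
  unfold farMajorant
  rw [lintegral_add_left ((hm1.const_mul _).const_mul _), lintegral_const_mul _ (hm1.const_mul _),
    lintegral_const_mul _ hm1, lintegral_add_left
      (Finset.measurable_sum _ fun i _ => (hm i).const_mul _),
    lintegral_finsetSum _ fun i _ => (hm i).const_mul _, lintegral_const_mul _ (hm Q)]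
  have h1 := lintegral_far_sqrt_le hk hQa hH (t.below j Q) (fun i hi => (hi0 i hi).2)
    (fun i hi => (hi0 i hi).1.pos.ne')
    (fun i => ENNReal.ofReal (frobSq (t.root i * t.bad s j Q)))
  rw [hbm] at h1
  have h2 : ∑ i ∈ t.below j Q, ∫⁻ x in (F.dilatedBall Q)ᶜ,
      ENNReal.ofReal (frobSq (t.root i * t.bad s j Q)) * ‖kernelDiff μ k (F.center Q) i x‖ₑ ∂μ ≤
      H * ENNReal.ofReal (t.badMass s j Q) := by
    rw [← hbm, Finset.mul_sum]
    refine Finset.sum_le_sum fun i hi => ?_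
    rw [lintegral_const_mul _ (hm i), mul_left_comm]
    gcongr
    exact lintegral_far_le hk hQa hH (hi0 i hi).2 (hi0 i hi).1.pos.ne'
  have h3 : ENNReal.ofReal (traceAbs (t.badDensity s j Q)) *
      ∫⁻ x in (F.dilatedBall Q)ᶜ, ‖kernelDiff μ k (F.center Q) Q x‖ₑ ∂μ ≤
      H * ENNReal.ofReal (t.badMass s j Q) := by
    calc _ ≤ ENNReal.ofReal (traceAbs (t.badDensity s j Q)) * (H * μ Q) := by
          gcongr; exact lintegral_far_le hk hQa hH subset_rfl hQa.pos.ne'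
      _ = H * (ENNReal.ofReal (traceAbs (t.badDensity s j Q)) * μ Q) := by ring
      _ ≤ _ := by gcongr; exact ofReal_traceAbs_badDensity_mul_le hs hj hQ
  set b := ENNReal.ofReal (t.badMass s j Q)
  have hb : b ^ (1 / 2 : ℝ) * b ^ (1 / 2 : ℝ) = b := by
    rw [← ENNReal.rpow_add_of_nonneg _ _ (by norm_num) (by norm_num)]; norm_num
  calc _ ≤ 2 * (b ^ (1 / 2 : ℝ) * (H * b ^ (1 / 2 : ℝ))) + (H * b + H * b) := by gcongr
    _ = 2 * (H * (b ^ (1 / 2 : ℝ) * b ^ (1 / 2 : ℝ))) + (H * b + H * b) := by ring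
    _ = _ := by rw [hb]; ring

end trees

/-! ### The weak type inequality for positive finite sums -/

section positive

open scoped Classical

variable {d n : ℕ} {μ : Measure (EuclideanSpace ℝ (Fin d))} {m : ℕ}
variable {s : ℝ} {F : NonregularFiltration n μ}

variable {N : ℤ} {L : ℕ} {S : Finset (Set (EuclideanSpace ℝ (Fin d)))}
  {B : Set (EuclideanSpace ℝ (Fin d)) → Matrix (Fin m) (Fin m) ℂ}
  {k : EuclideanSpace ℝ (Fin d) → EuclideanSpace ℝ (Fin d) → ℂ}
  {T : Lp ℂ 2 μ →L[ℂ] Lp ℂ 2 μ}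

/-- Finitely many atoms have large ancestors in a common generation. -/
theorem exists_generation_lt {τ c : ℝ≥0∞} (hτ : τ < c * μ univ)
    (hF : ∀ k, ∀ Q ∈ F.atoms k,
      c * μ univ ≤ ⨆ R ∈ {R | (∃ j, R ∈ F.atoms j) ∧ Q ⊆ R}, μ R)
    (hS : ∀ i ∈ S, i ∈ F.atoms N) :
    ∃ L : ℕ, ∀ i ∈ S, τ < μ (F.ancestor (N - L) i) := by
  have hmono : ∀ i ∈ S, ∀ L L' : ℕ, L ≤ L' → τ < μ (F.ancestor (N - L) i) →
      τ < μ (F.ancestor (N - L') i) := by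
    intro i hi L L' hL h
    refine h.trans_le (measure_mono ?_)
    rw [← NonregularFiltration.ancestor_ancestor (i := N - L') (j := N - L) (by omega)
      (by omega) (hS i hi)]
    exact NonregularFiltration.subset_ancestor (j := N - L') (k := N - L) (by omega)
      (NonregularFiltration.ancestor_mem (by omega) (hS i hi))
  have hex : ∀ i ∈ S, ∃ L : ℕ, τ < μ (F.ancestor (N - L) i) := by
    intro i hi
    have h := hτ.trans_le (hF N i (hS i hi))
    simp only [lt_iSup_iff] at h
    obtain ⟨R, ⟨⟨j, hR⟩, hiR⟩, hτR⟩ := h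
    rcases le_or_gt j N with hj | hj
    · refine ⟨(N - j).toNat, ?_⟩
      have e : N - ((N - j).toNat : ℤ) = j := by omega
      rw [e, NonregularFiltration.ancestor_eq hj (hS i hi) hR hiR]
      exact hτR
    · refine ⟨0, hτR.trans_le (measure_mono ?_)⟩
      have e : N - ((0 : ℕ) : ℤ) = N := by simp
      rw [e]
      obtain ⟨x, hx⟩ := NonregularFiltration.nonempty_of_mem_atoms (hS i hi)
      have h1 := NonregularFiltration.subset_ancestor (j := N) (k := N) le_rfl (hS i hi)
      refine (NonregularFiltration.subset_or_disjoint hj.le hR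
        (NonregularFiltration.ancestor_mem (k := N) le_rfl (hS i hi))).resolve_right fun hd => ?_
      exact disjoint_left.1 hd (hiR hx) (h1 hx)
  choose! l hl using hex
  exact ⟨S.sup l, fun i hi => hmono i hi _ _ (Finset.le_sup hi) (hl i hi)⟩

theorem sum_ofReal_badMass_le (hs : 0 < s) (t : MassTree (Set (EuclideanSpace ℝ (Fin d))) m) :
    ∑ p ∈ (Finset.range (t.depth + 1)).sigma fun j => t.nodes j,
      ENNReal.ofReal (t.badMass s p.1 p.2) ≤ ENNReal.ofReal t.mass := by
  rw [← ENNReal.ofReal_sum_of_nonneg fun _ _ => MassTree.badMass_nonneg]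
  refine ENNReal.ofReal_le_ofReal ?_
  rw [Finset.sum_sigma]
  exact MassTree.sum_badMass_le hs

variable [IsLocallyFiniteMeasure μ] {hS : ∀ i ∈ S, i ∈ F.atoms N}

/-- The off-diagonal and mean-zero terms: in the dilated ball of a node they are counted by the
rank of its bad projection, outside by their trace norm. -/
theorem exists_majorant_terms (hk : Measurable (Function.uncurry k)) (hT : HasKernel T k)
    (hsize : KernelSize n k) {H : ℝ≥0} (hH : ∀ i, ∀ Q ∈ F.atoms i, ∑' j, hormanderTerm F k Q j ≤ H)
    (hs : 0 < s) {t : MassTree (Set (EuclideanSpace ℝ (Fin d))) m} (ht : t = F.massTree L hS B) :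
    ∃ Ψ : EuclideanSpace ℝ (Fin d) → ℝ≥0∞, Measurable Ψ ∧
      (∀ᵐ x ∂μ, ENNReal.ofReal s * ENNReal.ofReal (traceLevel
        (∑ j ∈ Finset.range (t.depth + 1), ∑ Q ∈ t.nodes j,
          (t.rowTerm s j Q (fun i => T (indL2 μ i) x) + t.colTerm s j Q (fun i => T (indL2 μ i) x) +
            t.diagTerm s j Q (fun i => T (indL2 μ i) x))) s) ≤ Ψ x) ∧
      ∫⁻ x, Ψ x ∂μ ≤ (3 * ENNReal.ofReal F.β + 4 * H) * ENNReal.ofReal t.mass := by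
  set P := (Finset.range (t.depth + 1)).sigma fun j => t.nodes j with hP
  have hPm : ∀ p ∈ P, p.1 ≤ L ∧ p.2 ∈ t.nodes p.1 ∧ F.IsAtom p.2 := by
    intro p hp
    obtain ⟨h1, h2⟩ := Finset.mem_sigma.1 hp
    subst ht
    have h3 : p.1 ≤ L := Nat.lt_succ_iff.1 (Finset.mem_range.1 h1)
    exact ⟨h3, h2, ⟨_, mem_atoms_of_mem_nodes h3 h2⟩⟩
  have hL : t.depth = L := by subst ht; rfl
  have hbelow : ∀ p ∈ P, ∀ i ∈ t.below p.1 p.2, F.IsAtom i ∧ i ⊆ p.2 := by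
    intro p hp i hi
    subst ht
    have := subset_of_mem_below (hPm p hp).1 hi
    exact ⟨⟨_, hS i this.1⟩, this.2⟩
  set κ : EuclideanSpace ℝ (Fin d) → Set (EuclideanSpace ℝ (Fin d)) →
    Set (EuclideanSpace ℝ (Fin d)) → ℂ := fun x Q i => kernelDiff μ k (F.center Q) i x with hκ
  set φ : (Σ _ : ℕ, Set (EuclideanSpace ℝ (Fin d))) → EuclideanSpace ℝ (Fin d) → ℝ≥0∞ :=
    fun p x => (F.dilatedBall p.2).indicator
      (fun _ => ENNReal.ofReal (3 * (s * ((t.bad s p.1 p.2).rank : ℝ)))) x +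
      (F.dilatedBall p.2)ᶜ.indicator (fun x => farMajorant μ t s p.1 p.2 (κ x p.2)) x with hφ
  have hball : ∀ Q, MeasurableSet (F.dilatedBall Q) :=
    NonregularFiltration.measurableSet_dilatedBall
  have hfm : ∀ p : (Σ _ : ℕ, Set (EuclideanSpace ℝ (Fin d))),
      Measurable fun x => farMajorant μ t s p.1 p.2 (κ x p.2) := fun p =>
    measurable_farMajorant t p.1 p.2 fun i => measurable_kernelDiff hk _ i
  have hφ1 : ∀ p : (Σ _ : ℕ, Set (EuclideanSpace ℝ (Fin d))), Measurable
      ((F.dilatedBall p.2).indicator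
        fun _ => ENNReal.ofReal (3 * (s * ((t.bad s p.1 p.2).rank : ℝ)))) := fun p =>
    measurable_const.indicator (hball _)
  have hφm : ∀ p, Measurable (φ p) := fun p =>
    (hφ1 p).add ((hfm p).indicator (hball _).compl)
  refine ⟨fun x => ∑ p ∈ P, φ p x, Finset.measurable_sum _ fun p _ => hφm p, ?_, ?_⟩
  · have hae : ∀ᵐ x ∂μ, ∀ p ∈ P, x ∉ F.dilatedBall p.2 → ∀ i, i ∈ t.below p.1 p.2 ∨ i = p.2 →
        T (indL2 μ i) x - k x (F.center p.2) * (μ.real i : ℂ) = κ x p.2 i := by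
      refine (ae_ball_iff P.countable_toSet).2 fun p hp => ?_
      have h1 : ∀ᵐ x ∂μ, ∀ i ∈ insert p.2 (t.below p.1 p.2), x ∉ F.dilatedBall p.2 →
          T (indL2 μ i) x - k x (F.center p.2) * (μ.real i : ℂ) = κ x p.2 i := by
        refine (ae_ball_iff (Finset.countable_toSet _)).2 fun i hi => ?_
        rcases Finset.mem_insert.1 hi with rfl | hi
        · exact ae_image_sub_eq hk hT hsize (hPm p hp).2.2 (hPm p hp).2.2.measurableSet subset_rfl
        · exact ae_image_sub_eq hk hT hsize (hPm p hp).2.2 (hbelow p hp i hi).1.measurableSet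
            (hbelow p hp i hi).2
      filter_upwards [h1] with x hx hxp i hi
      refine hx i (Finset.mem_insert.2 hi.symm) hxp
    filter_upwards [hae] with x hx
    rw [← Finset.sum_sigma (Finset.range (t.depth + 1)) (fun j => t.nodes j)
      (fun p => t.rowTerm s p.1 p.2 (fun i => T (indL2 μ i) x) +
        t.colTerm s p.1 p.2 (fun i => T (indL2 μ i) x) +
        t.diagTerm s p.1 p.2 (fun i => T (indL2 μ i) x)), ← ENNReal.ofReal_mul hs.le]
    refine (ENNReal.ofReal_le_ofReal (mul_traceLevel_sum_le P _
      (fun p => x ∈ F.dilatedBall p.2) hs)).trans ?_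
    refine (ENNReal.ofReal_sum_of_nonneg fun p _ => ?_).trans_le
      (Finset.sum_le_sum fun p hp => ?_)
    · split_ifs
      · positivity
      · exact traceAbs_nonneg _
    by_cases hxp : x ∈ F.dilatedBall p.2
    · rw [if_pos hxp, hφ]
      simp only [indicator_of_mem hxp, indicator_of_notMem (notMem_compl_iff.2 hxp), add_zero]
      refine ENNReal.ofReal_le_ofReal ?_
      have : (((t.rowTerm s p.1 p.2 (fun i => T (indL2 μ i) x) +
        t.colTerm s p.1 p.2 (fun i => T (indL2 μ i) x) +
        t.diagTerm s p.1 p.2 (fun i => T (indL2 μ i) x)).rank : ℕ) : ℝ) ≤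
          ((3 * (t.bad s p.1 p.2).rank : ℕ) : ℝ) := by
        exact_mod_cast MassTree.rank_terms_le p.1 p.2 _
      push_cast at this
      nlinarith
    · rw [if_neg hxp, hφ]
      simp only [indicator_of_notMem hxp, indicator_of_mem (mem_compl hxp), zero_add]
      have hj : p.1 ≤ t.depth := hL ▸ (hPm p hp).1
      have hQ := (hPm p hp).2.1
      set c := k x (F.center p.2) with hc
      have hw : ∀ i, t.weight i = μ.real i := by subst ht; exact fun _ => rfl
      have e1 : ∀ i ∈ t.below p.1 p.2, T (indL2 μ i) x - c * t.weight i = κ x p.2 i := by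
        intro i hi; rw [hw]; exact hx p hp hxp i (Or.inl hi)
      have e2 : T (indL2 μ p.2) x - c * t.weight p.2 = κ x p.2 p.2 := by
        rw [hw]; exact hx p hp hxp _ (Or.inr rfl)
      have er : t.rowTerm s p.1 p.2 (fun i => T (indL2 μ i) x) =
          t.rowTerm s p.1 p.2 (κ x p.2) := by
        rw [MassTree.rowTerm_sub hs hj hQ _ c]
        exact Finset.sum_congr rfl fun i hi => by simp only [e1 i hi]
      have ec : t.colTerm s p.1 p.2 (fun i => T (indL2 μ i) x) =
          t.colTerm s p.1 p.2 (κ x p.2) := by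
        rw [MassTree.colTerm_sub hs hj hQ _ c]
        exact Finset.sum_congr rfl fun i hi => by simp only [e1 i hi]
      have ed : t.diagTerm s p.1 p.2 (fun i => T (indL2 μ i) x) =
          t.diagTerm s p.1 p.2 (κ x p.2) := by
        rw [MassTree.diagTerm_sub hj hQ _ c, MassTree.diagTerm, MassTree.diagTerm, e2]
        congr 1
        exact Finset.sum_congr rfl fun i hi => by rw [e1 i hi]
      rw [er, ec, ed]
      exact ofReal_traceAbs_terms_le hs ht (hPm p hp).1 hQ _
  · rw [lintegral_finsetSum _ fun p _ => hφm p]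
    refine le_trans ?_ (mul_le_mul' le_rfl (sum_ofReal_badMass_le hs t))
    rw [Finset.mul_sum]
    refine Finset.sum_le_sum fun p hp => ?_
    rw [hφ]
    simp only
    rw [lintegral_add_left (hφ1 p), lintegral_indicator (hball _).compl,
      lintegral_indicator_const (hball _), add_mul]
    obtain ⟨hj, hQ, hQa⟩ := hPm p hp
    refine add_le_add ?_ ?_
    · have hμw : ENNReal.ofReal (t.weight p.2) = μ p.2 := by
        subst ht; exact ofReal_weight hj hQ
      have hw0 : 0 ≤ t.weight p.2 := (MassTree.weight_pos_of_mem (hL ▸ hj) hQ).le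
      calc _ ≤ ENNReal.ofReal (3 * (s * ((t.bad s p.1 p.2).rank : ℝ))) *
            (ENNReal.ofReal F.β * μ p.2) := by gcongr; exact hQa.measure_dilatedBall_le
        _ = 3 * ENNReal.ofReal F.β *
            ENNReal.ofReal (s * t.weight p.2 * ((t.bad s p.1 p.2).rank : ℝ)) := by
          rw [ENNReal.ofReal_mul (by norm_num), ENNReal.ofReal_mul hs.le,
            ENNReal.ofReal_mul (mul_nonneg hs.le hw0), ENNReal.ofReal_mul hs.le, hμw]
          norm_num; ring
        _ ≤ _ := by
          gcongr
          exact MassTree.mul_rank_bad_le hs (hL ▸ hj) hQ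
    · refine lintegral_farMajorant_le hk hs ht hj hQ (hH (N - L + p.1) p.2 ?_)
      subst ht; exact mem_atoms_of_mem_nodes hj hQ

/-- The mean-zero combinations of the nodes and their parents. -/
theorem exists_majorant_parents {C : ℝ≥0} (hC : ∀ (i : ℤ) (Q R : Set (EuclideanSpace ℝ (Fin d))),
      Q ∈ F.atoms (i + 1) → R ∈ F.atoms i → Q ⊆ R → ∫⁻ x, ‖T (indL2 μ Q) x -
        ((μ.real Q / μ.real R : ℝ) : ℂ) * T (indL2 μ R) x‖ₑ ∂μ ≤ C * μ Q)
    (hs : 0 < s) {t : MassTree (Set (EuclideanSpace ℝ (Fin d))) m} (ht : t = F.massTree L hS B) :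
    ∃ Ψ : EuclideanSpace ℝ (Fin d) → ℝ≥0∞, Measurable Ψ ∧
      (∀ x, ENNReal.ofReal s * ENNReal.ofReal (traceLevel
        (∑ j ∈ Finset.range t.depth, ∑ Q ∈ t.nodes (j + 1),
          (T (indL2 μ Q) x - ((t.weight Q / t.weight (t.anc j Q) : ℝ) : ℂ) *
            T (indL2 μ (t.anc j Q)) x) • t.badDensity s (j + 1) Q) s) ≤ Ψ x) ∧
      ∫⁻ x, Ψ x ∂μ ≤ C * ENNReal.ofReal t.mass := by
  set P := (Finset.range t.depth).sigma fun j => t.nodes (j + 1) with hP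
  have hTm : ∀ Q, Measurable fun x => T (indL2 μ Q) x := fun Q =>
    (Lp.stronglyMeasurable _).measurable
  obtain ⟨Ψ, h1, h2, h3⟩ := exists_majorant_sum (μ := μ) P hs
    (fun p x => T (indL2 μ p.2) x - ((t.weight p.2 / t.weight (t.anc p.1 p.2) : ℝ) : ℂ) *
      T (indL2 μ (t.anc p.1 p.2)) x) (fun p => (hTm _).sub ((hTm _).const_mul _))
    (fun p => t.badDensity s (p.1 + 1) p.2)
    (fun p => C * ENNReal.ofReal (t.badMass s (p.1 + 1) p.2)) (by
      intro p hp
      obtain ⟨hp1, hp2⟩ := Finset.mem_sigma.1 hp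
      subst ht
      have hj : p.1 + 1 ≤ L := Finset.mem_range.1 hp1
      have hQ := mem_atoms_of_mem_nodes hj hp2
      have hle : N - L + (p.1 : ℤ) ≤ N - L + ((p.1 + 1 : ℕ) : ℤ) := by omega
      have e : N - L + ((p.1 + 1 : ℕ) : ℤ) = N - L + (p.1 : ℤ) + 1 := by push_cast; ring
      have h := hC _ p.2 _ (e ▸ hQ) (NonregularFiltration.ancestor_mem hle hQ)
        (NonregularFiltration.subset_ancestor hle hQ)
      refine (mul_le_mul' le_rfl h).trans ?_
      rw [mul_left_comm]
      exact mul_le_mul' le_rfl (ofReal_traceAbs_badDensity_mul_le hs hj hp2))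
  refine ⟨Ψ, h1, fun x => ?_, h3.trans ?_⟩
  · have := h2 x
    rwa [Finset.sum_sigma] at this
  · rw [← Finset.mul_sum]
    refine mul_le_mul' le_rfl ?_
    rw [← ENNReal.ofReal_sum_of_nonneg fun _ _ => MassTree.badMass_nonneg]
    refine ENNReal.ofReal_le_ofReal (le_trans ?_ (MassTree.sum_badMass_le hs))
    rw [Finset.sum_sigma, Finset.sum_range_succ', le_add_iff_nonneg_right]
    exact Finset.sum_nonneg fun _ _ => MassTree.badMass_nonneg

/-- The nodes of the first generation, where there is no parent to subtract: either the image of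
the indicator function is in `L_1`, or there is no bad part. -/
theorem exists_majorant_start {C : ℝ≥0} (hs : 0 < s)
    {t : MassTree (Set (EuclideanSpace ℝ (Fin d))) m} (ht : t = F.massTree L hS B)
    (hC : ∀ Q ∈ t.nodes 0, t.badDensity s 0 Q = 0 ∨ ∫⁻ x, ‖T (indL2 μ Q) x‖ₑ ∂μ ≤ C * μ Q) :
    ∃ Ψ : EuclideanSpace ℝ (Fin d) → ℝ≥0∞, Measurable Ψ ∧
      (∀ x, ENNReal.ofReal s * ENNReal.ofReal (traceLevel
        (∑ Q ∈ t.nodes 0, T (indL2 μ Q) x • t.badDensity s 0 Q) s) ≤ Ψ x) ∧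
      ∫⁻ x, Ψ x ∂μ ≤ C * ENNReal.ofReal t.mass := by
  obtain ⟨Ψ, h1, h2, h3⟩ := exists_majorant_sum (μ := μ) (t.nodes 0) hs
    (fun Q x => T (indL2 μ Q) x) (fun Q => (Lp.stronglyMeasurable _).measurable)
    (fun Q => t.badDensity s 0 Q) (fun Q => C * ENNReal.ofReal (t.badMass s 0 Q)) (by
      intro Q hQ
      rcases hC Q hQ with h | h
      · rw [h, traceAbs_zero]; simp
      · subst ht
        refine (mul_le_mul' le_rfl h).trans ?_
        rw [mul_left_comm]
        exact mul_le_mul' le_rfl (ofReal_traceAbs_badDensity_mul_le hs (Nat.zero_le _) hQ))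
  refine ⟨Ψ, h1, h2, h3.trans ?_⟩
  rw [← Finset.mul_sum]
  refine mul_le_mul' le_rfl ?_
  rw [← ENNReal.ofReal_sum_of_nonneg fun _ _ => MassTree.badMass_nonneg]
  refine ENNReal.ofReal_le_ofReal (le_trans ?_ (MassTree.sum_badMass_le hs))
  rw [Finset.sum_range_succ', le_add_iff_nonneg_left]
  exact Finset.sum_nonneg fun _ _ => Finset.sum_nonneg fun _ _ => MassTree.badMass_nonneg

/-- The weak type inequality for positive functions with finitely many values, on atoms. The level
function is not known to be measurable at this point, so the bound is stated by a majorant. -/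
theorem exists_majorant_psd (F : NonregularFiltration n μ)
    (hk : Measurable (Function.uncurry k)) (hT : HasKernel T k)
    (hsize : KernelSize n k) (hreg : L2Hormander F k) :
    ∃ C : ℝ≥0, ∀ (N : ℤ) (S : Finset (Set (EuclideanSpace ℝ (Fin d))))
      (_ : ∀ i ∈ S, i ∈ F.atoms N) (m : ℕ)
      (B : Set (EuclideanSpace ℝ (Fin d)) → Matrix (Fin m) (Fin m) ℂ) (s : ℝ), 0 < s →
    ∃ Ψ : EuclideanSpace ℝ (Fin d) → ℝ≥0∞, Measurable Ψ ∧
      (∀ᵐ x ∂μ, ENNReal.ofReal s * ENNReal.ofReal (traceLevel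
        (∑ i ∈ S, T (indL2 μ i) x • ((B i)ᴴ * B i)) (4 * s)) ≤ Ψ x) ∧
      ∫⁻ x, Ψ x ∂μ ≤ C * ∑ i ∈ S, μ i * ENNReal.ofReal (frobSq (B i)) := by
  obtain ⟨C₁, hC₁⟩ := lintegral_parent_sub_le (F := F) hk hT hsize hreg
  obtain ⟨H, hH⟩ := hreg
  obtain ⟨c, hc, hF⟩ := F.exhaust
  set C₀ : ℝ≥0 := ‖T‖₊ * (1 + 2 / c) with hC₀
  refine ⟨3 * ‖T‖₊ ^ 2 + C₀ + C₁ + (3 * Real.toNNReal F.β + 4 * H), fun N S hS m B s hs => ?_⟩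
  have hmass : ∀ L, ENNReal.ofReal (F.massTree L hS B).mass =
      ∑ i ∈ S, μ i * ENNReal.ofReal (frobSq (B i)) := by
    intro L
    rw [MassTree.mass, ENNReal.ofReal_sum_of_nonneg fun i hi =>
      mul_nonneg (MassTree.weight_pos_leaf hi).le (frobSq_nonneg _)]
    refine Finset.sum_congr rfl fun i hi => ?_
    rw [ENNReal.ofReal_mul (MassTree.weight_pos_leaf hi).le]
    congr 1
    exact ofReal_measureReal (NonregularFiltration.IsAtom.lt_top ⟨_, hS i hi⟩).ne
  -- The start generation, in which all nodes are so large that their bad part is harmless.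
  obtain ⟨L, hL⟩ : ∃ L : ℕ, ∀ Q ∈ (F.massTree L hS B).nodes 0,
      (F.massTree L hS B).badDensity s 0 Q = 0 ∨
        ∫⁻ x, ‖T (indL2 μ Q) x‖ₑ ∂μ ≤ C₀ * μ Q := by
    rcases S.eq_empty_or_nonempty with rfl | ⟨i₀, hi₀⟩
    · exact ⟨0, fun Q hQ => by simp [MassTree.nodes, NonregularFiltration.massTree] at hQ⟩
    have hpos : 0 < μ univ :=
      (F.measure_atom_pos N i₀ (hS i₀ hi₀)).trans_le (measure_mono (subset_univ _))
    rcases eq_or_ne (μ univ) ∞ with hinf | hfin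
    · set M := (F.massTree 0 hS B).mass with hM
      obtain ⟨L, hL⟩ := exists_generation_lt (τ := ENNReal.ofReal (M / s)) (c := c)
        (by rw [hinf, ENNReal.mul_top (by exact_mod_cast hc.ne')]; exact ENNReal.ofReal_lt_top)
        hF hS
      refine ⟨L, fun Q hQ => Or.inl (MassTree.badDensity_eq_zero hs (Nat.zero_le _) hQ ?_)⟩
      have h1 : ENNReal.ofReal (M / s) < ENNReal.ofReal ((F.massTree L hS B).weight Q) := by
        rw [ofReal_weight (Nat.zero_le _) hQ]
        obtain ⟨i, hi, rfl⟩ := Finset.mem_image.1 hQ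
        have := hL i hi
        simpa [NonregularFiltration.massTree] using this
      have h2 := (ENNReal.ofReal_lt_ofReal_iff
        (MassTree.weight_pos_of_mem (Nat.zero_le _) hQ)).1 h1
      rw [div_lt_iff₀ hs] at h2
      change M < _
      linarith
    · obtain ⟨L, hL⟩ := exists_generation_lt (τ := ((c / 2 : ℝ≥0) : ℝ≥0∞) * μ univ) (c := c)
        (by
          refine (ENNReal.mul_lt_mul_iff_left hpos.ne' hfin).2 ?_
          exact_mod_cast half_lt_self hc)
        hF hS
      refine ⟨L, fun Q hQ => Or.inr ?_⟩
      have hQa : F.IsAtom Q := ⟨_, mem_atoms_of_mem_nodes (Nat.zero_le _) hQ⟩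
      have h1 : ((c / 2 : ℝ≥0) : ℝ≥0∞) * μ univ ≤ μ Q := by
        obtain ⟨i, hi, rfl⟩ := Finset.mem_image.1 hQ
        have := hL i hi
        simpa [NonregularFiltration.massTree] using this.le
      have h2 : μ univ ≤ ((2 / c : ℝ≥0) : ℝ≥0∞) * μ Q := by
        calc μ univ = ((2 / c : ℝ≥0) : ℝ≥0∞) * (((c / 2 : ℝ≥0) : ℝ≥0∞) * μ univ) := by
              rw [← mul_assoc, ← ENNReal.coe_mul, div_mul_div_comm, mul_comm 2 c,
                div_self (mul_ne_zero hc.ne' two_ne_zero), ENNReal.coe_one, one_mul]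
          _ ≤ _ := by gcongr
      have h3 := setLIntegral_enorm_image_le T hQa.measurableSet hQa.lt_top.ne h2
      rw [setLIntegral_univ] at h3
      refine h3.trans_eq ?_
      rw [hC₀]; push_cast; rfl
  set t := F.massTree L hS B with ht
  obtain ⟨Ψ₁, m₁, p₁, i₁⟩ := exists_majorant_martingalePart T hs ht
  obtain ⟨Ψ₂, m₂, p₂, i₂⟩ := exists_majorant_start hs ht hL
  obtain ⟨Ψ₃, m₃, p₃, i₃⟩ := exists_majorant_parents hC₁ hs ht
  obtain ⟨Ψ₄, m₄, p₄, i₄⟩ := exists_majorant_terms hk hT hsize hH hs ht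
  refine ⟨fun x => Ψ₁ x + Ψ₂ x + Ψ₃ x + Ψ₄ x, ((m₁.add m₂).add m₃).add m₄, ?_, ?_⟩
  · filter_upwards [p₁, p₄] with x h₁ h₄
    refine le_trans ?_ (add_le_add (add_le_add (add_le_add h₁ (p₂ x)) (p₃ x)) h₄)
    rw [← mul_add, ← mul_add, ← mul_add]
    refine mul_le_mul' le_rfl ?_
    have e := MassTree.sum_leaves_eq (t := t) (lam := s) fun i => T (indL2 μ i) x
    change ENNReal.ofReal (traceLevel (∑ i ∈ t.leaves, T (indL2 μ i) x • t.val i) (4 * s)) ≤ _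
    rw [e, ← ENNReal.ofReal_add (traceLevel_nonneg _ _) (traceLevel_nonneg _ _),
      ← ENNReal.ofReal_add (add_nonneg (traceLevel_nonneg _ _) (traceLevel_nonneg _ _))
        (traceLevel_nonneg _ _), ← ENNReal.ofReal_add (add_nonneg (add_nonneg
        (traceLevel_nonneg _ _) (traceLevel_nonneg _ _)) (traceLevel_nonneg _ _))
        (traceLevel_nonneg _ _)]
    refine ENNReal.ofReal_le_ofReal ?_
    have e4 : 4 * s = s + s + s + s := by ring
    rw [e4]
    refine (traceLevel_add_le _ _ (by linarith) hs.le).trans (add_le_add ?_ le_rfl)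
    refine (traceLevel_add_le _ _ (by linarith) hs.le).trans (add_le_add ?_ le_rfl)
    exact traceLevel_add_le _ _ hs.le hs.le
  · have e : ∫⁻ x, (Ψ₁ x + Ψ₂ x + Ψ₃ x + Ψ₄ x) ∂μ =
        ∫⁻ x, Ψ₁ x ∂μ + ∫⁻ x, Ψ₂ x ∂μ + ∫⁻ x, Ψ₃ x ∂μ + ∫⁻ x, Ψ₄ x ∂μ := by
      rw [lintegral_add_right _ m₄, lintegral_add_right _ m₃, lintegral_add_right _ m₂]
    refine e.trans_le ?_
    refine (add_le_add (add_le_add (add_le_add i₁ i₂) i₃) i₄).trans_eq ?_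
    rw [ht, hmass, ← add_mul, ← add_mul, ← add_mul]
    congr 1

end positive

/-! ### Finite sums with general coefficients, and functions without means on the atoms -/

section atomic

variable {d n : ℕ} {μ : Measure (EuclideanSpace ℝ (Fin d))}
  {k : EuclideanSpace ℝ (Fin d) → EuclideanSpace ℝ (Fin d) → ℂ}
  {T : Lp ℂ 2 μ →L[ℂ] Lp ℂ 2 μ}

theorem traceLevel_smul_of_norm_eq_one {m : ℕ} {c : ℂ} (hc : ‖c‖ = 1)
    (A : Matrix (Fin m) (Fin m) ℂ) (s : ℝ) : traceLevel (c • A) s = traceLevel A s := by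
  have h : (c • A)ᴴ * (c • A) = Aᴴ * A := by
    rw [Matrix.conjTranspose_smul, Matrix.smul_mul, Matrix.mul_smul, smul_smul,
      Complex.star_def, Complex.conj_mul', hc]
    simp
  rw [traceLevel, traceLevel, matrixAbs, matrixAbs, h]

/-- The weak type inequality for functions with finitely many values, on atoms of a common
generation. -/
theorem exists_weakType_atomic [IsLocallyFiniteMeasure μ] (F : NonregularFiltration n μ)
    (hk : Measurable (Function.uncurry k)) (hT : HasKernel T k)
    (hsize : KernelSize n k) (hreg : L2Hormander F k) :
    ∃ C : ℝ≥0, ∀ (N : ℤ) (S : Finset (Set (EuclideanSpace ℝ (Fin d))))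
      (_ : ∀ i ∈ S, i ∈ F.atoms N) (m : ℕ)
      (A : Set (EuclideanSpace ℝ (Fin d)) → Matrix (Fin m) (Fin m) ℂ) (s : ℝ), 0 < s →
      ENNReal.ofReal s *
        ∫⁻ x, ENNReal.ofReal (traceLevel (∑ i ∈ S, T (indL2 μ i) x • A i) s) ∂μ ≤
      C * ∑ i ∈ S, μ i * ENNReal.ofReal (traceAbs (A i)) := by
  obtain ⟨C, hC⟩ := exists_majorant_psd F hk hT hsize hreg
  refine ⟨16 * (4 * C), fun N S hS m A s hs => ?_⟩
  choose B hB hB' using fun i => exists_polarization (A i)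
  have hs' : 0 < s / 16 := by positivity
  choose Ψ hm hp hi using fun l : Fin 4 => hC N S hS m (fun i => B i l) (s / 16) hs'
  have key : ENNReal.ofReal (s / 16) *
      ∫⁻ x, ENNReal.ofReal (traceLevel (∑ i ∈ S, T (indL2 μ i) x • A i) s) ∂μ ≤
      ∫⁻ x, ∑ l, Ψ l x ∂μ := by
    rw [← lintegral_const_mul' _ _ ENNReal.ofReal_ne_top]
    refine lintegral_mono_ae ?_
    filter_upwards [ae_all_iff.2 hp] with x hx
    refine le_trans ?_ (Finset.sum_le_sum fun l _ => hx l)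
    rw [← Finset.mul_sum, ← ENNReal.ofReal_sum_of_nonneg fun _ _ => traceLevel_nonneg _ _]
    refine mul_le_mul' le_rfl (ENNReal.ofReal_le_ofReal ?_)
    set Z : Fin 4 → Matrix (Fin m) (Fin m) ℂ := fun l =>
      ∑ i ∈ S, T (indL2 μ i) x • ((B i l)ᴴ * B i l) with hZ
    have e : ∑ i ∈ S, T (indL2 μ i) x • A i = ∑ l : Fin 4, Complex.I ^ (l : ℕ) • Z l := by
      simp only [hZ, Finset.smul_sum]
      rw [Finset.sum_comm]
      refine Finset.sum_congr rfl fun i _ => ?_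
      conv_lhs => rw [hB i]
      rw [Finset.smul_sum]
      exact Finset.sum_congr rfl fun l _ => smul_comm _ _ _
    have hc : ∀ l : Fin 4, traceLevel (Complex.I ^ (l : ℕ) • Z l) (4 * (s / 16)) =
        traceLevel (Z l) (4 * (s / 16)) := fun l =>
      traceLevel_smul_of_norm_eq_one (by simp) _ _
    have e4 : s = 4 * (s / 16) + 4 * (s / 16) + 4 * (s / 16) + 4 * (s / 16) := by ring
    rw [e]
    conv_lhs => rw [e4]
    refine le_of_le_of_eq ?_ (Finset.sum_congr rfl fun l _ => hc l)
    rw [Fin.sum_univ_four, Fin.sum_univ_four]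
    refine (traceLevel_add_le _ _ (by linarith) (by linarith)).trans (add_le_add ?_ le_rfl)
    refine (traceLevel_add_le _ _ (by linarith) (by linarith)).trans (add_le_add ?_ le_rfl)
    exact traceLevel_add_le _ _ (by linarith) (by linarith)
  have h16 : ENNReal.ofReal s = 16 * ENNReal.ofReal (s / 16) := by
    rw [show (16 : ℝ≥0∞) = ENNReal.ofReal 16 by norm_num, ← ENNReal.ofReal_mul (by norm_num)]
    congr 1; ring
  have hl : ∀ l, ∫⁻ x, Ψ l x ∂μ ≤ C * ∑ i ∈ S, μ i * ENNReal.ofReal (traceAbs (A i)) := by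
    intro l
    refine (hi l).trans ?_
    gcongr with i _
    exact hB' i l
  rw [h16, mul_assoc]
  calc _ ≤ 16 * ∑ l : Fin 4, C * ∑ i ∈ S, μ i * ENNReal.ofReal (traceAbs (A i)) := by
        refine mul_le_mul' le_rfl (key.trans ?_)
        rw [lintegral_finsetSum _ fun l _ => hm l]
        exact Finset.sum_le_sum fun l _ => hl l
    _ = _ := by
        rw [Finset.sum_const, Finset.card_univ, Fintype.card_fin, nsmul_eq_mul]
        push_cast; ring

end atomic

namespace NonregularFiltration

variable {d n : ℕ} {μ : Measure (EuclideanSpace ℝ (Fin d))} {F : NonregularFiltration n μ}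

/-- Up to a null set, an atom is the union of its descendants of a given generation. -/
theorem ae_eq_iUnion_atoms {N N' : ℤ} (hN : N ≤ N') {Q : Set (EuclideanSpace ℝ (Fin d))}
    (hQ : Q ∈ F.atoms N) :
    Q =ᵐ[μ] (⋃ q : {q // q ∈ F.atoms N' ∧ q ⊆ Q}, (q : Set (EuclideanSpace ℝ (Fin d)))) := by
  filter_upwards [F.cover N'] with x ⟨q, hq, hxq⟩
  refine propext ⟨fun hx => ?_, fun hx => ?_⟩
  · refine mem_iUnion.2 ⟨⟨q, hq, ?_⟩, hxq⟩
    exact (subset_or_disjoint hN hq hQ).resolve_right fun h => disjoint_left.1 h hxq hx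
  · obtain ⟨q, hxq⟩ := mem_iUnion.1 hx
    exact q.2.2 hxq

/-- Vanishing integrals pass from atoms to the earlier atoms that contain them. -/
theorem setIntegral_eq_zero_of_forall [SigmaFinite μ] {N N' : ℤ} (hN : N ≤ N')
    {Q : Set (EuclideanSpace ℝ (Fin d))} (hQ : Q ∈ F.atoms N)
    {g : EuclideanSpace ℝ (Fin d) → ℂ} (hg : IntegrableOn g Q μ)
    (h : ∀ q ∈ F.atoms N', q ⊆ Q → ∫ x in q, g x ∂μ = 0) : ∫ x in Q, g x ∂μ = 0 := by
  have : Countable {q // q ∈ F.atoms N' ∧ q ⊆ Q} :=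
    ((countable_atoms (F := F) N').mono fun q hq => hq.1).to_subtype
  have e := ae_eq_iUnion_atoms hN hQ
  rw [setIntegral_congr_set e, integral_iUnion
    (s := fun q : {q // q ∈ F.atoms N' ∧ q ⊆ Q} => (q : Set (EuclideanSpace ℝ (Fin d))))
    (fun q => F.measurableSet_atom _ _ q.2.1)
    (fun q q' hne => F.disjoint_atoms N' q.2.1 q'.2.1 fun h => hne (Subtype.ext h))
    (hg.congr_set_ae e.symm)]
  simp [fun q : {q // q ∈ F.atoms N' ∧ q ⊆ Q} => h q q.2.1 q.2.2]

theorem aestronglyMeasurable_of_const [SigmaFinite μ] {N : ℤ} {ψ : EuclideanSpace ℝ (Fin d) → ℂ}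
    (h : ∀ Q ∈ F.atoms N, ∀ x ∈ Q, ∀ y ∈ Q, ψ x = ψ y) : AEStronglyMeasurable ψ μ := by
  have : Countable (F.atoms N) := (countable_atoms (F := F) N).to_subtype
  have hu : (⋃ q : F.atoms N, (q : Set (EuclideanSpace ℝ (Fin d)))) =ᵐ[μ] univ := by
    filter_upwards [F.cover N] with x ⟨q, hq, hxq⟩
    exact propext ⟨fun _ => mem_univ x, fun _ => mem_iUnion.2 ⟨⟨q, hq⟩, hxq⟩⟩
  rw [← Measure.restrict_univ (μ := μ), ← Measure.restrict_congr_set hu,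
    aestronglyMeasurable_iUnion_iff]
  rintro ⟨q, hq⟩
  obtain ⟨y, hy⟩ := nonempty_of_mem_atoms hq
  refine (aestronglyMeasurable_const (b := ψ y)).congr ?_
  filter_upwards [ae_restrict_mem (F.measurableSet_atom _ _ hq)] with x hx
  exact h q hq y hy x hx

/-- A function without mean on the small atoms in an atom vanishes there. -/
theorem ae_eq_zero_of_forall_integral [SigmaFinite μ] {R : Set (EuclideanSpace ℝ (Fin d))}
    (hR : R ∈ F.atoms 0) {g : EuclideanSpace ℝ (Fin d) → ℂ} (hgm : Measurable g)
    (hg : IntegrableOn g R μ)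
    (h : ∀ N : ℕ, ∀ q ∈ F.atoms N, q ⊆ R → ∫ x in q, g x ∂μ = 0) :
    ∀ᵐ x ∂μ, x ∈ R → g x = 0 := by
  have hRm := F.measurableSet_atom _ _ hR
  -- the conjugate sign of `g`, which is `0` where `g` vanishes; `φ * g` is the modulus of `g`
  set φ : EuclideanSpace ℝ (Fin d) → ℂ := fun x => star (g x) / (‖g x‖ : ℂ) with hφ
  have hφm : Measurable φ := (Complex.measurable_ofReal.comp hgm.norm |> fun h1 =>
    (continuous_star.measurable.comp hgm).div h1)
  have hφb : ∀ x, ‖φ x‖ ≤ 1 := fun x => by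
    rw [hφ]; simp only [norm_div, norm_star, Complex.norm_real, norm_norm]
    exact div_self_le_one _
  have hφg : ∀ x, φ x * g x = (‖g x‖ : ℂ) := fun x => by
    rw [hφ]
    rcases eq_or_ne (g x) 0 with h0 | h0
    · simp [h0]
    · have : (‖g x‖ : ℂ) ≠ 0 := by simpa using h0
      simp only [Complex.star_def]
      rw [div_mul_eq_mul_div, Complex.conj_mul', sq, mul_div_assoc, div_self this, mul_one]
  have hgi : Integrable (R.indicator g) μ := (integrable_indicator_iff hRm).2 hg
  have key : ∫ x in R, ‖g x‖ ∂μ = 0 := by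
    refine le_antisymm (le_of_forall_pos_lt_add fun ε hε => ?_)
      (integral_nonneg fun _ => norm_nonneg _)
    obtain ⟨k, ψ, ⟨b, hb⟩, hψ, hlt⟩ := F.weakStar_dense φ hφm ⟨1, hφb⟩ 1
      (fun _ => R.indicator g) (fun _ => hgi) ε hε
    have hψm := aestronglyMeasurable_of_const hψ
    -- a function that is constant on the atoms of generation `k` is so on those of later ones
    set N := k.toNat with hN
    have hψ' : ∀ Q ∈ F.atoms N, ∀ x ∈ Q, ∀ y ∈ Q, ψ x = ψ y := by
      intro Q hQ x hx y hy
      obtain ⟨P, hP, hQP⟩ := exists_ancestor (j := k) (by omega) hQ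
      exact hψ P hP x (hQP hx) y (hQP hy)
    have hψi : Integrable (fun x => ψ x * R.indicator g x) μ :=
      hgi.bdd_mul hψm (Filter.Eventually.of_forall hb)
    have hφi : Integrable (fun x => φ x * R.indicator g x) μ :=
      hgi.bdd_mul hφm.aestronglyMeasurable (Filter.Eventually.of_forall hφb)
    have hz : ∫ x in R, ψ x * g x ∂μ = 0 := by
      refine setIntegral_eq_zero_of_forall (N' := N) (by omega) hR ?_ fun q hq hqR => ?_
      · refine (integrable_indicator_iff hRm).1
          (hψi.congr (Filter.Eventually.of_forall fun x => ?_))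
        by_cases hx : x ∈ R <;> simp [hx]
      · obtain ⟨y, hy⟩ := nonempty_of_mem_atoms hq
        rw [setIntegral_congr_fun (g := fun x => ψ y * g x) (F.measurableSet_atom _ _ hq)
          fun x hx => by simp only [hψ' q hq x hx y hy], integral_const_mul, h N q hq hqR, mul_zero]
    have e : ∫ x, (φ x - ψ x) * R.indicator g x ∂μ = ((∫ x in R, ‖g x‖ ∂μ : ℝ) : ℂ) := by
      simp only [sub_mul]
      rw [integral_sub hφi hψi]
      have e1 : (fun x => ψ x * R.indicator g x) = R.indicator fun x => ψ x * g x := by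
        ext x; by_cases hx : x ∈ R <;> simp [hx]
      have e2 : (fun x => φ x * R.indicator g x) = R.indicator fun x => (‖g x‖ : ℂ) := by
        ext x; by_cases hx : x ∈ R <;> simp [hx, hφg]
      rw [e1, e2, integral_indicator hRm, integral_indicator hRm, hz, sub_zero]
      exact integral_ofReal
    have := hlt 0
    rw [e, Complex.norm_real, Real.norm_eq_abs] at this
    rw [zero_add]
    exact lt_of_abs_lt this
  rw [setIntegral_eq_zero_iff_of_nonneg_ae (Filter.Eventually.of_forall fun _ => norm_nonneg _)
    hg.norm] at key
  filter_upwards [(ae_restrict_iff' hRm).1 key] with x hx hxR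
  simpa using hx hxR

end NonregularFiltration

/-! ### Density of the finite sums in `L_1` and `L_2` -/

namespace NonregularFiltration

variable {d n : ℕ} {μ : Measure (EuclideanSpace ℝ (Fin d))} {F : NonregularFiltration n μ}

/-- The functions with finitely many values on the atoms of generation `N` contained in `X`. -/
def atomSpan (F : NonregularFiltration n μ) (X : Set (EuclideanSpace ℝ (Fin d))) (N : ℕ) :
    Submodule ℂ (Lp ℂ 2 μ) :=
  Submodule.span ℂ (indL2 μ '' {Q | Q ∈ F.atoms N ∧ Q ⊆ X})

open scoped Classical in
theorem exists_sum_of_mem_atomSpan {ι : Type*} [Finite ι] {X : Set (EuclideanSpace ℝ (Fin d))}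
    {N : ℕ} {v : ι → Lp ℂ 2 μ}
    (hv : ∀ i, v i ∈ F.atomSpan X N) :
    ∃ (S : Finset (Set (EuclideanSpace ℝ (Fin d))))
      (a : Set (EuclideanSpace ℝ (Fin d)) → ι → ℂ), (∀ Q ∈ S, Q ∈ F.atoms N ∧ Q ⊆ X) ∧
      ∀ i, v i = ∑ Q ∈ S, a Q i • indL2 μ Q := by
  have h : ∀ i, ∃ l ∈ Finsupp.supported ℂ ℂ {Q | Q ∈ F.atoms N ∧ Q ⊆ X},
      Finsupp.linearCombination ℂ (indL2 μ) l = v i := fun i =>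
    (Finsupp.mem_span_image_iff_linearCombination ℂ).1 (hv i)
  choose l hl hlv using h
  cases nonempty_fintype ι
  refine ⟨Finset.univ.biUnion fun i => (l i).support, fun Q i => l i Q, fun Q hQ => ?_,
    fun i => ?_⟩
  · obtain ⟨i, _, hi⟩ := Finset.mem_biUnion.1 hQ
    exact hl i hi
  · rw [← hlv i, Finsupp.linearCombination_apply]
    exact Finsupp.sum_of_support_subset _ (Finset.subset_biUnion_of_mem
      (fun i => (l i).support) (Finset.mem_univ i)) _ fun _ _ => zero_smul _ _

variable [IsLocallyFiniteMeasure μ] {X : Set (EuclideanSpace ℝ (Fin d))}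

theorem IsAtom.inner_indL2 {Q : Set (EuclideanSpace ℝ (Fin d))} (hQ : F.IsAtom Q)
    (u : Lp ℂ 2 μ) : inner ℂ (indL2 μ Q) u = ∫ x in Q, u x ∂μ := by
  rw [indL2_of hQ.measurableSet hQ.lt_top.ne]
  exact L2.inner_indicatorConstLp_one hQ.measurableSet hQ.lt_top.ne u

theorem integrableOn_of_isAtom {Q : Set (EuclideanSpace ℝ (Fin d))} (hQ : F.IsAtom Q)
    (u : Lp ℂ 2 μ) : IntegrableOn u Q μ := by
  have : IsFiniteMeasure (μ.restrict Q) := ⟨by simpa using hQ.lt_top⟩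
  exact ((Lp.memLp u).restrict Q).integrable (by norm_num)

theorem setIntegral_eq_zero_of_mem_orthogonal {N : ℕ} {u : Lp ℂ 2 μ}
    (hu : u ∈ (F.atomSpan X N)ᗮ) {q : Set (EuclideanSpace ℝ (Fin d))} (hq : q ∈ F.atoms N)
    (hqX : q ⊆ X) : ∫ x in q, u x ∂μ = 0 := by
  rw [← IsAtom.inner_indL2 ⟨_, hq⟩]
  exact (Submodule.mem_orthogonal _ _).1 hu _ (Submodule.subset_span ⟨q, ⟨hq, hqX⟩, rfl⟩)

theorem topologicalClosure_atomSpan_mono (F : NonregularFiltration n μ)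
    (X : Set (EuclideanSpace ℝ (Fin d))) :
    Monotone fun N => (F.atomSpan X N).topologicalClosure := by
  intro N N' hN
  refine Submodule.topologicalClosure_minimal _ ?_ (Submodule.isClosed_topologicalClosure _)
  refine Submodule.span_le.2 ?_
  rintro _ ⟨Q, ⟨hQ, hQX⟩, rfl⟩
  change indL2 μ Q ∈ (F.atomSpan X N').topologicalClosure
  rw [← Submodule.orthogonal_orthogonal_eq_closure, Submodule.mem_orthogonal]
  intro u hu
  rw [inner_eq_zero_symm, IsAtom.inner_indL2 ⟨_, hQ⟩]
  refine setIntegral_eq_zero_of_forall (N' := N') (by exact_mod_cast hN) hQ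
    (integrableOn_of_isAtom ⟨_, hQ⟩ u) fun q hq hqQ => ?_
  exact setIntegral_eq_zero_of_mem_orthogonal hu hq (hqQ.trans hQX)

/-- Density in `L_2`: what is orthogonal to all atoms has vanishing integrals over them, and so is
zero by the weak-* density of the functions that are constant on atoms. -/
theorem mem_topologicalClosure_iSup {P : Finset (Set (EuclideanSpace ℝ (Fin d)))}
    (hP : ∀ R ∈ P, R ∈ F.atoms 0) {f : Lp ℂ 2 μ}
    (hf : ∀ᵐ x ∂μ, x ∉ (⋃ R ∈ P, R) → f x = 0) :
    f ∈ (⨆ N, F.atomSpan (⋃ R ∈ P, R) N).topologicalClosure := by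
  rw [← Submodule.orthogonal_orthogonal_eq_closure, Submodule.mem_orthogonal]
  intro u hu
  have h0 : ∀ᵐ x ∂μ, ∀ R ∈ P, x ∈ R → u x = 0 := by
    refine (ae_ball_iff P.countable_toSet).2 fun R hR => ?_
    refine ae_eq_zero_of_forall_integral (hP R hR) (Lp.stronglyMeasurable u).measurable
      (integrableOn_of_isAtom ⟨_, hP R hR⟩ u) fun N q hq hqR => ?_
    refine setIntegral_eq_zero_of_mem_orthogonal (X := ⋃ R ∈ P, R) (N := N)
      (Submodule.orthogonal_le (le_iSup _ N) hu) hq (hqR.trans ?_)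
    exact subset_biUnion_of_mem (u := fun R => R) hR
  rw [L2.inner_def]
  refine integral_eq_zero_of_ae ?_
  filter_upwards [h0, hf] with x h1 h2
  by_cases hx : x ∈ ⋃ R ∈ P, R
  · obtain ⟨R, hR, hxR⟩ := mem_iUnion₂.1 hx
    simp [h1 R hR hxR]
  · simp [h2 hx]

/-- Finitely many atoms of generation `0` carry a given integral, up to a small error. -/
theorem exists_finset_setLIntegral_compl_le (F : NonregularFiltration n μ)
    {G : EuclideanSpace ℝ (Fin d) → ℝ≥0∞} (hG : ∫⁻ x, G x ∂μ ≠ ∞) {ε : ℝ≥0∞} (hε : 0 < ε) :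
    ∃ P : Finset (Set (EuclideanSpace ℝ (Fin d))), (∀ R ∈ P, R ∈ F.atoms 0) ∧
      ∫⁻ x in (⋃ R ∈ P, R)ᶜ, G x ∂μ ≤ ε := by
  have hc : Countable (F.atoms 0) := (countable_atoms (F := F) 0).to_subtype
  have hm : ∀ q : F.atoms 0, MeasurableSet (q : Set (EuclideanSpace ℝ (Fin d))) := fun q =>
    F.measurableSet_atom _ _ q.2
  have hd : Pairwise (Function.onFun Disjoint fun q : F.atoms 0 =>
      (q : Set (EuclideanSpace ℝ (Fin d)))) := fun q q' hne =>
    F.disjoint_atoms 0 q.2 q'.2 fun h => hne (Subtype.ext h)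
  have hsum : ∑' q : F.atoms 0, ∫⁻ x in q, G x ∂μ ≠ ∞ := by
    rw [← lintegral_iUnion hm hd]
    exact ((setLIntegral_le_lintegral _ _).trans_lt hG.lt_top).ne
  obtain ⟨P, hP⟩ := ((ENNReal.tendsto_tsum_compl_atTop_zero hsum).eventually
    (Iic_mem_nhds hε)).exists
  refine ⟨P.map (Function.Embedding.subtype _), fun R hR => ?_, le_trans ?_ hP⟩
  · obtain ⟨q, _, rfl⟩ := Finset.mem_map.1 hR
    exact q.2
  · refine le_trans ?_ (lintegral_iUnion_le (fun q : {q // q ∉ P} =>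
      (q.1 : Set (EuclideanSpace ℝ (Fin d)))) G)
    refine lintegral_mono' (Measure.restrict_mono_ae ?_) le_rfl
    filter_upwards [F.cover 0] with x ⟨q, hq, hxq⟩ hx
    refine mem_iUnion.2 ⟨⟨⟨q, hq⟩, fun h => hx ?_⟩, hxq⟩
    exact mem_iUnion₂.2 ⟨q, Finset.mem_map.2 ⟨⟨q, hq⟩, h, rfl⟩, hxq⟩

/-- Approximation in `L_2` by sums over atoms, with one generation for all entries of a matrix. -/
theorem exists_atomSpan_approx {ι : Type*} [Finite ι]
    {P : Finset (Set (EuclideanSpace ℝ (Fin d)))}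
    (hP : ∀ R ∈ P, R ∈ F.atoms 0) {f : ι → Lp ℂ 2 μ}
    (hf : ∀ i, ∀ᵐ x ∂μ, x ∉ (⋃ R ∈ P, R) → f i x = 0) {ε : ℝ} (hε : 0 < ε) :
    ∃ N : ℕ, ∃ v : ι → Lp ℂ 2 μ, ∀ i, v i ∈ F.atomSpan (⋃ R ∈ P, R) N ∧ ‖f i - v i‖ < ε := by
  have h1 : ∀ i, ∃ N : ℕ, ∃ u ∈ (F.atomSpan (⋃ R ∈ P, R) N).topologicalClosure,
      ‖f i - u‖ < ε / 2 := by
    intro i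
    have h := mem_topologicalClosure_iSup hP (hf i)
    rw [← SetLike.mem_coe, Submodule.topologicalClosure_coe, Metric.mem_closure_iff] at h
    obtain ⟨u, hu, hd⟩ := h (ε / 2) (half_pos hε)
    have hu' := iSup_mono (fun N => Submodule.le_topologicalClosure
      (F.atomSpan (⋃ R ∈ P, R) N)) hu
    obtain ⟨N, hN⟩ := (Submodule.mem_iSup_of_directed _
      (topologicalClosure_atomSpan_mono F _).directed_le).1 hu'
    exact ⟨N, u, hN, by rwa [← dist_eq_norm]⟩
  choose N u hu hd using h1
  cases nonempty_fintype ι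
  have h2 : ∀ i, ∃ v ∈ F.atomSpan (⋃ R ∈ P, R) (Finset.univ.sup N), ‖u i - v‖ < ε / 2 := by
    intro i
    have h := topologicalClosure_atomSpan_mono F _ (Finset.le_sup (Finset.mem_univ i)) (hu i)
    rw [← SetLike.mem_coe, Submodule.topologicalClosure_coe, Metric.mem_closure_iff] at h
    obtain ⟨v, hv, hd⟩ := h (ε / 2) (half_pos hε)
    exact ⟨v, hv, by rwa [← dist_eq_norm]⟩
  choose v hv hd' using h2
  refine ⟨_, v, fun i => ⟨hv i, ?_⟩⟩
  have := norm_sub_le_norm_sub_add_norm_sub (f i) (u i) (v i)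
  linarith [hd i, hd' i]

theorem indL2_ae_eq {Q : Set (EuclideanSpace ℝ (Fin d))} (hQ : F.IsAtom Q) :
    indL2 μ Q =ᵐ[μ] Q.indicator fun _ => (1 : ℂ) := by
  rw [indL2_of hQ.measurableSet hQ.lt_top.ne]
  exact indicatorConstLp_coeFn

/-- Integrable functions in `L_2` are approximated in `L_1` and in `L_2` by functions with finitely
many values on atoms, with the same atoms for finitely many functions. -/
theorem exists_atomic_approx (F : NonregularFiltration n μ) {ι : Type*} [Finite ι]
    (f : ι → Lp ℂ 2 μ) (hf : ∀ i, Integrable (f i) μ) {ε : ℝ≥0} (hε : 0 < ε) :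
    ∃ (N : ℤ) (S : Finset (Set (EuclideanSpace ℝ (Fin d))))
      (a : Set (EuclideanSpace ℝ (Fin d)) → ι → ℂ), (∀ Q ∈ S, Q ∈ F.atoms N) ∧
      ∀ i, ‖f i - ∑ Q ∈ S, a Q i • indL2 μ Q‖ₑ ≤ ε ∧
        ∫⁻ x, ‖f i x - (∑ Q ∈ S, a Q i • indL2 μ Q : Lp ℂ 2 μ) x‖ₑ ∂μ ≤ ε := by
  cases nonempty_fintype ι
  have hm1 : ∀ i, Measurable fun x => ‖f i x‖ₑ := fun i =>
    (Lp.stronglyMeasurable (f i)).measurable.enorm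
  have hm : ∀ i, Measurable fun x => ‖f i x‖ₑ + ‖f i x‖ₑ ^ 2 := fun i =>
    (hm1 i).add ((hm1 i).pow_const 2)
  have hG : ∫⁻ x, ∑ i, (‖f i x‖ₑ + ‖f i x‖ₑ ^ 2) ∂μ ≠ ∞ := by
    rw [lintegral_finsetSum _ fun i _ => hm i]
    refine ENNReal.sum_ne_top.2 fun i _ => ?_
    rw [lintegral_add_left (hm1 i), enorm_sq_Lp]
    exact ENNReal.add_ne_top.2 ⟨(hf i).2.ne, by simp⟩
  set δ : ℝ≥0 := min (ε / 2) ((ε / 2) ^ 2) with hδ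
  have hδ0 : 0 < δ := lt_min (by positivity) (by positivity)
  obtain ⟨P, hP, hPε⟩ := exists_finset_setLIntegral_compl_le F hG (ε := δ) (by exact_mod_cast hδ0)
  set X := ⋃ R ∈ P, R with hX
  have hXm : MeasurableSet X :=
    P.measurableSet_biUnion fun R hR => F.measurableSet_atom _ _ (hP R hR)
  have hXfin : μ X ≠ ∞ := (measure_biUnion_lt_top P.finite_toSet fun R hR =>
    IsAtom.lt_top (F := F) ⟨_, hP R hR⟩).ne
  set g : ι → Lp ℂ 2 μ := fun i => ((Lp.memLp (f i)).indicator hXm).toLp _ with hg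
  have hgf : ∀ i, g i =ᵐ[μ] X.indicator (f i) := fun i => MemLp.coeFn_toLp _
  have hg0 : ∀ i, ∀ᵐ x ∂μ, x ∉ X → g i x = 0 := by
    intro i
    filter_upwards [hgf i] with x hx hxX
    rw [hx, indicator_of_notMem hxX]
  -- the constant makes the error small in `L_1`, by the Cauchy-Schwarz inequality on `X`
  set η : ℝ≥0 := (ε / 2) / (1 + (μ X).toNNReal) with hη
  have hη0 : 0 < η := by positivity
  obtain ⟨N, v, hv⟩ := exists_atomSpan_approx hP hg0 (ε := η) (by exact_mod_cast hη0)
  obtain ⟨S, a, hS, hav⟩ := exists_sum_of_mem_atomSpan fun i => (hv i).1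
  refine ⟨N, S, a, fun Q hQ => (hS Q hQ).1, fun i => ?_⟩
  rw [← hav i]
  have hηε : η ≤ ε / 2 := div_le_self (zero_le (a := ε / 2)) (by simp)
  have hfg : ∫⁻ x in Xᶜ, (‖f i x‖ₑ + ‖f i x‖ₑ ^ 2) ∂μ ≤ δ := by
    refine le_trans (lintegral_mono fun x => ?_) hPε
    exact Finset.single_le_sum (f := fun i => ‖f i x‖ₑ + ‖f i x‖ₑ ^ 2) (fun _ _ => zero_le)
      (Finset.mem_univ i)
  have hsub : ∀ᵐ x ∂μ, ‖f i x - g i x‖ₑ = Xᶜ.indicator (fun x => ‖f i x‖ₑ) x := by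
    filter_upwards [hgf i] with x hx
    rw [hx]
    by_cases h : x ∈ X <;> simp [h]
  have hgv : ‖g i - v i‖ₑ ≤ η := by
    exact_mod_cast (hv i).2.le
  constructor
  · have h2 : ‖f i - g i‖ₑ ≤ (ε / 2 : ℝ≥0) := by
      refine (ENNReal.pow_le_pow_left_iff two_ne_zero).1 ?_
      rw [← enorm_sq_Lp]
      calc ∫⁻ x, ‖(f i - g i : Lp ℂ 2 μ) x‖ₑ ^ 2 ∂μ
          = ∫⁻ x in Xᶜ, ‖f i x‖ₑ ^ 2 ∂μ := by
            rw [← lintegral_indicator hXm.compl]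
            refine lintegral_congr_ae ?_
            filter_upwards [hsub, Lp.coeFn_sub (f i) (g i)] with x h1 h2
            rw [h2, Pi.sub_apply, h1]
            by_cases h : x ∈ X <;> simp [h]
        _ ≤ δ := le_trans (lintegral_mono fun x => le_add_self) hfg
        _ ≤ _ := by exact_mod_cast min_le_right _ _
    calc ‖f i - v i‖ₑ = ‖(f i - g i) + (g i - v i)‖ₑ := by rw [sub_add_sub_cancel]
      _ ≤ ‖f i - g i‖ₑ + ‖g i - v i‖ₑ := enorm_add_le _ _
      _ ≤ (ε / 2 : ℝ≥0) + (ε / 2 : ℝ≥0) := by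
        gcongr; exact hgv.trans (by exact_mod_cast hηε)
      _ = ε := by rw [← ENNReal.coe_add, add_halves]
  · have hv0 : ∀ᵐ x ∂μ, x ∉ X → v i x = 0 := by
      have h : ∀ᵐ x ∂μ, ∀ Q ∈ S, indL2 μ Q x = Q.indicator (fun _ => (1 : ℂ)) x :=
        (ae_ball_iff S.countable_toSet).2 fun Q hQ => indL2_ae_eq (F := F) ⟨_, (hS Q hQ).1⟩
      filter_upwards [h, ae_sum_smul_apply S (fun Q => a Q i) (indL2 μ)] with x h1 h2 hxX
      rw [hav i, h2]
      refine Finset.sum_eq_zero fun Q hQ => ?_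
      rw [h1 Q hQ, indicator_of_notMem fun h => hxX ((hS Q hQ).2 h), smul_zero]
    have h1 : ∫⁻ x, ‖g i x - v i x‖ₑ ∂μ ≤ (ε / 2 : ℝ≥0) := by
      have e : ∫⁻ x, ‖g i x - v i x‖ₑ ∂μ = ∫⁻ x in X, ‖(g i - v i : Lp ℂ 2 μ) x‖ₑ ∂μ := by
        rw [← lintegral_indicator hXm]
        refine lintegral_congr_ae ?_
        filter_upwards [hg0 i, hv0, Lp.coeFn_sub (g i) (v i)] with x h1 h2 h3
        by_cases h : x ∈ X
        · rw [indicator_of_mem h, h3, Pi.sub_apply]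
        · simp [h, h1 h, h2 h]
      rw [e]
      refine (ENNReal.pow_le_pow_left_iff two_ne_zero).1 ?_
      refine (setLIntegral_sq_le (Lp.aestronglyMeasurable _).enorm X).trans ?_
      calc μ X * ∫⁻ x in X, ‖(g i - v i : Lp ℂ 2 μ) x‖ₑ ^ 2 ∂μ ≤ μ X * (η : ℝ≥0∞) ^ 2 := by
            refine mul_le_mul' le_rfl ((setLIntegral_le_lintegral _ _).trans ?_)
            rw [enorm_sq_Lp]; gcongr
        _ = (((μ X).toNNReal * η ^ 2 : ℝ≥0) : ℝ≥0∞) := by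
            rw [ENNReal.coe_mul, ENNReal.coe_toNNReal hXfin, ENNReal.coe_pow]
        _ ≤ _ := by
            rw [← ENNReal.coe_pow]
            refine ENNReal.coe_le_coe.2 ?_
            set y := (μ X).toNNReal
            rw [hη, div_pow, mul_div_assoc', div_le_iff₀ (by positivity)]
            rw [mul_comm]
            gcongr
            nlinarith [zero_le (a := y)]
    calc ∫⁻ x, ‖f i x - v i x‖ₑ ∂μ ≤ ∫⁻ x, (‖f i x - g i x‖ₑ + ‖g i x - v i x‖ₑ) ∂μ := by
          refine lintegral_mono fun x => ?_
          rw [← sub_add_sub_cancel (f i x) (g i x) (v i x)]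
          exact enorm_add_le _ _
      _ = ∫⁻ x, ‖f i x - g i x‖ₑ ∂μ + ∫⁻ x, ‖g i x - v i x‖ₑ ∂μ :=
          lintegral_add_left ((Lp.stronglyMeasurable _).measurable.sub
            (Lp.stronglyMeasurable _).measurable).enorm _
      _ ≤ (ε / 2 : ℝ≥0) + (ε / 2 : ℝ≥0) := by
          refine add_le_add ?_ h1
          rw [lintegral_congr_ae hsub, lintegral_indicator hXm.compl]
          refine (lintegral_mono fun x => le_self_add).trans (hfg.trans ?_)
          exact_mod_cast min_le_left _ _
      _ = ε := by rw [← ENNReal.coe_add, add_halves]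

end NonregularFiltration

/-! ### Convergence in measure and the weak type inequality for integrable functions in `L_2` -/

section inMeasure

open Filter Topology

variable {α : Type*} [MeasurableSpace α] {ν : Measure α} {m : ℕ}

theorem tendstoInMeasure_smul_add {u v : ℕ → α → ℂ} {u' v' : α → ℂ}
    (hu : TendstoInMeasure ν u atTop u') (hv : TendstoInMeasure ν v atTop v') (c : ℂ) :
    TendstoInMeasure ν (fun i x => c * u i x + v i x) atTop fun x => c * u' x + v' x := by
  rw [tendstoInMeasure_iff_norm] at hu hv ⊢
  intro ε hε
  have hc : 0 < 2 * (‖c‖ + 1) := by positivity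
  have h := (hu (ε / (2 * (‖c‖ + 1))) (div_pos hε hc)).add (hv (ε / 2) (half_pos hε))
  rw [add_zero] at h
  refine tendsto_of_tendsto_of_tendsto_of_le_of_le tendsto_const_nhds h (fun _ => zero_le)
    fun i => (measure_mono fun x hx => ?_).trans (measure_union_le _ _)
  by_contra hcon
  simp only [mem_union, mem_ofPred_eq, not_or, not_le] at hcon hx
  rw [lt_div_iff₀ hc] at hcon
  have e : c * u i x + v i x - (c * u' x + v' x) = c * (u i x - u' x) + (v i x - v' x) := by ring
  have h1 := norm_add_le (c * (u i x - u' x)) (v i x - v' x)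
  rw [← e, norm_mul] at h1
  nlinarith [norm_nonneg c, norm_nonneg (u i x - u' x)]

/-- A sequence with summable jumps in measure converges in measure. -/
theorem exists_tendstoInMeasure {u : ℕ → α → ℂ} (hu : ∀ i, AEStronglyMeasurable (u i) ν)
    (h : ∑' i, ν {x | (2⁻¹ : ℝ≥0∞) ^ i < edist (u i x) (u (i + 1) x)} ≠ ∞) :
    ∃ v : α → ℂ, StronglyMeasurable v ∧ TendstoInMeasure ν u atTop v := by
  set B : ℕ → Set α := fun i => {x | (2⁻¹ : ℝ≥0∞) ^ i < edist (u i x) (u (i + 1) x)} with hB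
  have hstep : ∀ n x, x ∉ ⋃ i, B (i + n) → ∀ i,
      edist (u (i + n) x) (u (i + 1 + n) x) ≤ (2⁻¹ : ℝ≥0∞) ^ n * 2⁻¹ ^ i := by
    intro n x hx i
    have := not_lt.1 (fun h => hx (mem_iUnion.2 ⟨i, h⟩) : ¬ (2⁻¹ : ℝ≥0∞) ^ (i + n) <
      edist (u (i + n) x) (u (i + n + 1) x))
    rwa [pow_add, mul_comm, show i + n + 1 = i + 1 + n by ring] at this
  have hlim : ∀ᵐ x ∂ν, ∃ l, Tendsto (fun i => u i x) atTop (𝓝 l) := by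
    filter_upwards [ae_eventually_notMem h] with x hx
    obtain ⟨n, hn⟩ := eventually_atTop.1 hx
    have hc : CauchySeq fun i => u (i + n) x := by
      refine cauchySeq_of_edist_le_geometric 2⁻¹ (2⁻¹ ^ n) (by simp) (by simp)
        (hstep n x fun h => ?_)
      obtain ⟨i, hi⟩ := mem_iUnion.1 h
      exact hn (i + n) (Nat.le_add_left n i) hi
    obtain ⟨l, hl⟩ := cauchySeq_tendsto_of_complete hc
    exact ⟨l, (tendsto_add_atTop_iff_nat n).1 hl⟩
  obtain ⟨v, hv, hv'⟩ := exists_stronglyMeasurable_limit_of_tendsto_ae hu hlim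
  refine ⟨v, hv, fun ε hε => ?_⟩
  have htail := ENNReal.tendsto_sum_nat_add _ h
  have hsmall : ∀ᶠ n in atTop, (2⁻¹ : ℝ≥0∞) ^ n / (1 - 2⁻¹) < ε := by
    have h1 := (ENNReal.tendsto_pow_atTop_nhds_zero_of_lt_one (r := 2⁻¹) (by simp))
    have h2 := ENNReal.Tendsto.div_const h1 (b := 1 - 2⁻¹) (Or.inr (by simp))
    rw [ENNReal.zero_div] at h2
    exact h2.eventually (gt_mem_nhds hε)
  refine tendsto_of_tendsto_of_tendsto_of_le_of_le' tendsto_const_nhds htail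
    (Eventually.of_forall fun _ => zero_le) ?_
  filter_upwards [hsmall] with n hn
  refine le_trans (measure_mono_ae ?_) (measure_iUnion_le fun i => B (i + n))
  filter_upwards [hv'] with x hx hxε
  by_contra hcon
  have := edist_le_of_edist_le_geometric_of_tendsto₀ (f := fun i => u (i + n) x) 2⁻¹ (2⁻¹ ^ n)
    (hstep n x hcon) ((tendsto_add_atTop_iff_nat n).2 hx)
  rw [zero_add] at this
  exact absurd (lt_of_le_of_lt this hn) (not_lt.2 hxε)

/-- The `L_1` norm of a matrix-valued function depends continuously on the entries in `L_1`. -/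
theorem lintegral_traceAbs_le {u v : Fin m → Fin m → α → ℂ} (hu : ∀ i j, Measurable (u i j))
    (hv : ∀ i j, Measurable (v i j)) :
    ∫⁻ x, ENNReal.ofReal (traceAbs (Matrix.of fun i j => u i j x)) ∂ν ≤
      ∫⁻ x, ENNReal.ofReal (traceAbs (Matrix.of fun i j => v i j x)) ∂ν +
        ∑ i, ∑ j, ∫⁻ x, ‖v i j x - u i j x‖ₑ ∂ν := by
  have hm : ∀ i j, Measurable fun x => ‖v i j x - u i j x‖ₑ := fun i j =>
    ((hv i j).sub (hu i j)).enorm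
  have e : ∑ i, ∑ j, ∫⁻ x, ‖v i j x - u i j x‖ₑ ∂ν =
      ∫⁻ x, ∑ i, ∑ j, ‖v i j x - u i j x‖ₑ ∂ν := by
    rw [lintegral_finsetSum _ fun i _ => Finset.measurable_sum _ fun j _ => hm i j]
    exact Finset.sum_congr rfl fun i _ => (lintegral_finsetSum _ fun j _ => hm i j).symm
  rw [e, ← lintegral_add_right _ (Finset.measurable_sum _ fun i _ =>
    Finset.measurable_sum _ fun j _ => hm i j)]
  refine lintegral_mono fun x => ?_
  have h1 := traceAbs_add_le (Matrix.of fun i j => v i j x) (Matrix.of fun i j => u i j x - v i j x)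
  have h2 := traceAbs_le_sum_entries (Matrix.of fun i j => u i j x - v i j x)
  have e2 : (Matrix.of fun i j => v i j x) + (Matrix.of fun i j => u i j x - v i j x) =
      Matrix.of fun i j => u i j x := by ext; simp
  have e3 : ∑ i, ∑ j, ‖v i j x - u i j x‖ₑ = ENNReal.ofReal (∑ i, ∑ j, ‖u i j x - v i j x‖) := by
    rw [ENNReal.ofReal_sum_of_nonneg fun _ _ => by positivity]
    refine Finset.sum_congr rfl fun i _ => ?_
    rw [ENNReal.ofReal_sum_of_nonneg fun _ _ => by positivity]
    exact Finset.sum_congr rfl fun j _ => by rw [ofReal_norm, ← enorm_neg, neg_sub]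
  rw [e2] at h1
  simp only [e3]
  rw [← ENNReal.ofReal_add (traceAbs_nonneg _) (by positivity)]
  exact ENNReal.ofReal_le_ofReal (h1.trans (by simpa using h2))

/-- The level function changes little, at the cost of a factor 2 in the level, when the entries
change little in measure. The dependence on `m` is harmless, as it disappears in the limit. -/
theorem lintegral_traceLevel_le {u v : Fin m → Fin m → α → ℂ} (hu : ∀ i j, Measurable (u i j))
    (hv : ∀ i j, Measurable (v i j)) {s : ℝ} (hs : 0 < s) :
    ∫⁻ x, ENNReal.ofReal (traceLevel (Matrix.of fun i j => v i j x) s) ∂ν ≤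
      ∫⁻ x, ENNReal.ofReal (traceLevel (Matrix.of fun i j => u i j x) (s / 2)) ∂ν +
        m * ∑ i, ∑ j, ν {x | s / (2 * (m + 1)) ≤ ‖u i j x - v i j x‖} := by
  set δ : ℝ := s / (2 * (m + 1)) with hδ
  have hδ0 : 0 < δ := by positivity
  set E : Fin m → Fin m → Set α := fun i j => {x | δ ≤ ‖u i j x - v i j x‖} with hE
  have hEm : ∀ i j, MeasurableSet (E i j) := fun i j =>
    measurableSet_le measurable_const ((hu i j).sub (hv i j)).norm
  have hind : ∀ i j, Measurable ((E i j).indicator fun _ => (1 : ℝ≥0∞)) := fun i j =>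
    measurable_const.indicator (hEm i j)
  have hind' : Measurable fun x => (m : ℝ≥0∞) * ∑ i, ∑ j, (E i j).indicator (fun _ => 1) x :=
    (Finset.measurable_sum _ fun i _ => Finset.measurable_sum _ fun j _ => hind i j).const_mul _
  have e : (m : ℝ≥0∞) * ∑ i, ∑ j, ν (E i j) =
      ∫⁻ x, (m : ℝ≥0∞) * ∑ i, ∑ j, (E i j).indicator (fun _ => 1) x ∂ν := by
    rw [lintegral_const_mul _ (Finset.measurable_sum _ fun i _ =>
      Finset.measurable_sum _ fun j _ => hind i j),
      lintegral_finsetSum _ fun i _ => Finset.measurable_sum _ fun j _ => hind i j]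
    congr 1
    refine Finset.sum_congr rfl fun i _ => ?_
    rw [lintegral_finsetSum _ fun j _ => hind i j]
    refine Finset.sum_congr rfl fun j _ => ?_
    rw [lintegral_indicator_const (hEm i j), one_mul]
  rw [e, ← lintegral_add_right _ hind']
  refine lintegral_mono fun x => ?_
  set U : Matrix (Fin m) (Fin m) ℂ := Matrix.of fun i j => u i j x with hU
  set D : Matrix (Fin m) (Fin m) ℂ := Matrix.of fun i j => v i j x - u i j x with hD
  have hUD : (Matrix.of fun i j => v i j x) = U + D := by ext; simp [hU, hD]
  have h1 := traceLevel_add_le U D (half_pos hs).le (half_pos hs).le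
  rw [add_halves] at h1
  simp only [hUD]
  refine (ENNReal.ofReal_le_ofReal h1).trans ?_
  rw [ENNReal.ofReal_add (traceLevel_nonneg _ _) (traceLevel_nonneg _ _)]
  refine add_le_add le_rfl ?_
  by_cases hx : ∃ i j, x ∈ E i j
  · obtain ⟨i, j, hij⟩ := hx
    have h2 : (1 : ℝ≥0∞) ≤ ∑ i, ∑ j, (E i j).indicator (fun _ => 1) x := by
      calc (1 : ℝ≥0∞) = (E i j).indicator (fun _ => 1) x := by rw [indicator_of_mem hij]
        _ ≤ ∑ j, (E i j).indicator (fun _ => 1) x :=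
          Finset.single_le_sum (f := fun j => (E i j).indicator (fun _ => (1 : ℝ≥0∞)) x)
            (fun _ _ => zero_le) (Finset.mem_univ j)
        _ ≤ _ := Finset.single_le_sum
            (f := fun i => ∑ j, (E i j).indicator (fun _ => (1 : ℝ≥0∞)) x)
            (fun _ _ => zero_le) (Finset.mem_univ i)
    calc ENNReal.ofReal (traceLevel D (s / 2)) ≤ ENNReal.ofReal m :=
          ENNReal.ofReal_le_ofReal (traceLevel_le _ _)
      _ = m * 1 := by simp
      _ ≤ _ := by gcongr
  · have h2 : traceLevel D (s / 2) = 0 := by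
      refine traceLevel_eq_zero (half_pos hs).le ?_
      have h3 : ∀ i j, ‖D i j‖ ^ 2 ≤ δ ^ 2 := by
        intro i j
        have : ¬ δ ≤ ‖u i j x - v i j x‖ := fun h => hx ⟨i, j, h⟩
        rw [hD, Matrix.of_apply, norm_sub_rev]
        exact pow_le_pow_left₀ (norm_nonneg _) (not_le.1 this).le 2
      calc frobSq D ≤ ∑ _i : Fin m, ∑ _j : Fin m, δ ^ 2 :=
            Finset.sum_le_sum fun i _ => Finset.sum_le_sum fun j _ => h3 i j
        _ = (m * δ) ^ 2 := by simp; ring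
        _ ≤ _ := by
            refine pow_le_pow_left₀ (by positivity) ?_ 2
            rw [hδ, mul_div_assoc', div_le_div_iff₀ (by positivity) (by positivity)]
            nlinarith
    rw [h2, ENNReal.ofReal_zero]
    exact zero_le

/-- Bounds for the level function survive convergence in measure of the entries. -/
theorem mul_lintegral_traceLevel_le_of_tendsto {u : ℕ → Fin m → Fin m → α → ℂ}
    {v : Fin m → Fin m → α → ℂ} (hu : ∀ l i j, Measurable (u l i j))
    (hv : ∀ i j, Measurable (v i j))
    (huv : ∀ i j, TendstoInMeasure ν (fun l => u l i j) atTop (v i j)) {s : ℝ} (hs : 0 < s)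
    {b : ℕ → ℝ≥0∞} {B : ℝ≥0∞} (hb : Tendsto b atTop (𝓝 B))
    (h : ∀ l, ENNReal.ofReal (s / 2) * ∫⁻ x, ENNReal.ofReal
      (traceLevel (Matrix.of fun i j => u l i j x) (s / 2)) ∂ν ≤ b l) :
    ENNReal.ofReal s *
      ∫⁻ x, ENNReal.ofReal (traceLevel (Matrix.of fun i j => v i j x) s) ∂ν ≤ 2 * B := by
  have hδ0 : 0 < s / (2 * (m + 1)) := by positivity
  have hE : Tendsto (fun l => ∑ i, ∑ j, ν {x | s / (2 * (m + 1)) ≤ ‖u l i j x - v i j x‖})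
      atTop (𝓝 0) := by
    have := tendsto_finsetSum Finset.univ fun i _ => tendsto_finsetSum Finset.univ fun j _ =>
      tendstoInMeasure_iff_norm.1 (huv i j) _ hδ0
    simpa using this
  have hR : Tendsto (fun l => 2 * b l + ENNReal.ofReal s * (m *
      ∑ i, ∑ j, ν {x | s / (2 * (m + 1)) ≤ ‖u l i j x - v i j x‖})) atTop
      (𝓝 (2 * B + ENNReal.ofReal s * (m * 0))) :=
    (ENNReal.Tendsto.const_mul hb (Or.inr (by simp))).add
      (ENNReal.Tendsto.const_mul (ENNReal.Tendsto.const_mul hE (Or.inr (by simp)))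
        (Or.inr (by simp)))
  rw [mul_zero, mul_zero, add_zero] at hR
  refine ge_of_tendsto' hR fun l => ?_
  calc _ ≤ ENNReal.ofReal s * (∫⁻ x, ENNReal.ofReal
        (traceLevel (Matrix.of fun i j => u l i j x) (s / 2)) ∂ν + m *
        ∑ i, ∑ j, ν {x | s / (2 * (m + 1)) ≤ ‖u l i j x - v i j x‖}) := by
        gcongr; exact lintegral_traceLevel_le (hu l) hv hs
    _ ≤ _ := by
        rw [mul_add]
        refine add_le_add ?_ le_rfl
        have : ENNReal.ofReal s = 2 * ENNReal.ofReal (s / 2) := by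
          rw [show (2 : ℝ≥0∞) = ENNReal.ofReal 2 by norm_num, ← ENNReal.ofReal_mul (by norm_num)]
          congr 1; ring
        rw [this, mul_assoc]
        gcongr
        exact h l

end inMeasure

section integrableL2

open Filter Topology

variable {d n : ℕ} {μ : Measure (EuclideanSpace ℝ (Fin d))}
  {k : EuclideanSpace ℝ (Fin d) → EuclideanSpace ℝ (Fin d) → ℂ}
  {T : Lp ℂ 2 μ →L[ℂ] Lp ℂ 2 μ}

theorem measurable_Lp (f : Lp ℂ 2 μ) : Measurable f := (Lp.stronglyMeasurable f).measurable

theorem tendstoInMeasure_of_tendsto_enorm {f : ℕ → Lp ℂ 2 μ} {g : Lp ℂ 2 μ}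
    (h : Tendsto (fun l => ‖g - f l‖ₑ) atTop (𝓝 0)) :
    TendstoInMeasure μ (fun l => f l) atTop g := by
  refine tendstoInMeasure_of_tendsto_eLpNorm_of_ne_top (p := 2) (by simp) (by simp)
    (fun l => Lp.aestronglyMeasurable _) (Lp.aestronglyMeasurable _) ?_
  refine h.congr fun l => ?_
  rw [Lp.enorm_def, eLpNorm_congr_ae (Lp.coeFn_sub _ _), eLpNorm_sub_comm]

variable [IsLocallyFiniteMeasure μ]

/-- The trace norms of the coefficients of a finite sum over atoms are bounded by its `L_1` norm. -/
theorem sum_mul_traceAbs_le {F : NonregularFiltration n μ} {N : ℤ} {m : ℕ}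
    {S : Finset (Set (EuclideanSpace ℝ (Fin d)))} (hS : ∀ Q ∈ S, Q ∈ F.atoms N)
    (A : Set (EuclideanSpace ℝ (Fin d)) → Matrix (Fin m) (Fin m) ℂ) :
    ∑ Q ∈ S, μ Q * ENNReal.ofReal (traceAbs (A Q)) ≤ ∫⁻ x, ENNReal.ofReal (traceAbs
      (Matrix.of fun i j => (∑ Q ∈ S, A Q i j • indL2 μ Q : Lp ℂ 2 μ) x)) ∂μ := by
  have hm : ∀ Q ∈ S, MeasurableSet Q := fun Q hQ => F.measurableSet_atom _ _ (hS Q hQ)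
  have hae : ∀ᵐ x ∂μ, ∀ i j, (∑ Q ∈ S, A Q i j • indL2 μ Q : Lp ℂ 2 μ) x =
      ∑ Q ∈ S, A Q i j • Q.indicator (fun _ => (1 : ℂ)) x := by
    have h : ∀ᵐ x ∂μ, ∀ Q ∈ S, indL2 μ Q x = Q.indicator (fun _ => (1 : ℂ)) x :=
      (ae_ball_iff S.countable_toSet).2 fun Q hQ =>
        NonregularFiltration.indL2_ae_eq (F := F) ⟨_, hS Q hQ⟩
    filter_upwards [h, ae_all_iff.2 fun i => ae_all_iff.2 fun j =>
      ae_sum_smul_apply S (fun Q => A Q i j) (indL2 μ)] with x h1 h2 i j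
    rw [h2 i j]
    exact Finset.sum_congr rfl fun Q hQ => by rw [h1 Q hQ]
  calc ∑ Q ∈ S, μ Q * ENNReal.ofReal (traceAbs (A Q))
      = ∑ Q ∈ S, ∫⁻ x in Q, ENNReal.ofReal (traceAbs
          (Matrix.of fun i j => (∑ Q ∈ S, A Q i j • indL2 μ Q : Lp ℂ 2 μ) x)) ∂μ := by
        refine Finset.sum_congr rfl fun Q hQ => ?_
        rw [mul_comm, ← setLIntegral_const]
        refine setLIntegral_congr_fun_ae (hm Q hQ) ?_
        filter_upwards [hae] with x hx hxQ
        congr 2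
        ext i j
        rw [Matrix.of_apply, hx i j, Finset.sum_eq_single Q]
        · simp [hxQ]
        · intro R hR hne
          have : x ∉ R := fun hxR => hne
            (NonregularFiltration.eq_of_inter_nonempty (hS R hR) (hS Q hQ) ⟨x, hxR, hxQ⟩)
          simp [this]
        · exact fun h => absurd hQ h
    _ = ∫⁻ x in ⋃ Q ∈ S, Q, ENNReal.ofReal (traceAbs
          (Matrix.of fun i j => (∑ Q ∈ S, A Q i j • indL2 μ Q : Lp ℂ 2 μ) x)) ∂μ := by
        refine (lintegral_biUnion_finset (t := fun Q => Q) ?_ hm _).symm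
        exact fun Q hQ R hR hne => F.disjoint_atoms N (hS Q hQ) (hS R hR) hne
    _ ≤ _ := setLIntegral_le_lintegral _ _

/-- The weak type inequality for integrable functions with entries in `L_2`. -/
theorem exists_weakType_integrable (F : NonregularFiltration n μ)
    (hk : Measurable (Function.uncurry k)) (hT : HasKernel T k)
    (hsize : KernelSize n k) (hreg : L2Hormander F k) :
    ∃ C : ℝ≥0, ∀ (m : ℕ) (f : Fin m → Fin m → Lp ℂ 2 μ), (∀ i j, Integrable (f i j) μ) →
      ∀ s : ℝ, 0 < s → ENNReal.ofReal s *
        ∫⁻ x, ENNReal.ofReal (traceLevel (Matrix.of fun i j => T (f i j) x) s) ∂μ ≤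
      C * ∫⁻ x, ENNReal.ofReal (traceAbs (Matrix.of fun i j => f i j x)) ∂μ := by
  obtain ⟨C, hC⟩ := exists_weakType_atomic F hk hT hsize hreg
  refine ⟨2 * C, fun m f hf s hs => ?_⟩
  set ε : ℕ → ℝ≥0 := fun l => 1 / (l + 1) with hε
  have hε0 : ∀ l, 0 < ε l := fun l => by positivity
  have hεlim : Tendsto (fun l => (ε l : ℝ≥0∞)) atTop (𝓝 0) := by
    rw [← ENNReal.coe_zero, ENNReal.tendsto_coe]
    exact tendsto_one_div_add_atTop_nhds_zero_nat
  choose N S a hS ha using fun l => F.exists_atomic_approx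
    (fun p : Fin m × Fin m => f p.1 p.2) (fun p => hf p.1 p.2) (hε0 l)
  set A : ℕ → Set (EuclideanSpace ℝ (Fin d)) → Matrix (Fin m) (Fin m) ℂ :=
    fun l Q => Matrix.of fun i j => a l Q (i, j) with hA
  set v : ℕ → Fin m → Fin m → Lp ℂ 2 μ := fun l i j => ∑ Q ∈ S l, A l Q i j • indL2 μ Q with hv
  have h2 : ∀ l i j, ‖f i j - v l i j‖ₑ ≤ ε l := fun l i j => (ha l (i, j)).1
  have h1 : ∀ l i j, ∫⁻ x, ‖f i j x - v l i j x‖ₑ ∂μ ≤ ε l := fun l i j => (ha l (i, j)).2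
  set I := ∫⁻ x, ENNReal.ofReal (traceAbs (Matrix.of fun i j => f i j x)) ∂μ
  have hb : Tendsto (fun l => C * (I + ∑ _i : Fin m, ∑ _j : Fin m, (ε l : ℝ≥0∞))) atTop
      (𝓝 (C * I)) := by
    have h3 : Tendsto (fun l => ∑ _i : Fin m, ∑ _j : Fin m, (ε l : ℝ≥0∞)) atTop (𝓝 0) := by
      simpa using tendsto_finsetSum (Finset.univ : Finset (Fin m)) fun _ _ =>
        tendsto_finsetSum (Finset.univ : Finset (Fin m)) fun _ _ => hεlim
    simpa using ENNReal.Tendsto.const_mul ((tendsto_const_nhds (x := I)).add h3)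
      (Or.inr (ENNReal.coe_ne_top (r := C)))
  have hTv : ∀ i j, TendstoInMeasure μ (fun l => T (v l i j)) atTop (T (f i j)) := by
    intro i j
    refine tendstoInMeasure_of_tendsto_enorm ?_
    have h4 : Tendsto (fun l => ‖T‖ₑ * (ε l : ℝ≥0∞)) atTop (𝓝 0) := by
      simpa using ENNReal.Tendsto.const_mul hεlim (Or.inr (by simp : ‖T‖ₑ ≠ ∞))
    refine tendsto_of_tendsto_of_tendsto_of_le_of_le tendsto_const_nhds h4 (fun _ => zero_le)
      fun l => ?_
    rw [← map_sub]
    exact (T.le_opENorm _).trans (by gcongr; exact h2 l i j)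
  have key := mul_lintegral_traceLevel_le_of_tendsto (ν := μ) (u := fun l i j => T (v l i j))
    (v := fun i j => T (f i j)) (fun l i j => measurable_Lp _) (fun i j => measurable_Lp _)
    hTv hs hb fun l => ?_
  · refine key.trans_eq ?_
    push_cast; ring
  · have hae : ∀ᵐ x ∂μ, (Matrix.of fun i j => T (v l i j) x) =
        ∑ Q ∈ S l, T (indL2 μ Q) x • A l Q := by
      have : ∀ᵐ x ∂μ, ∀ i j, T (v l i j) x = ∑ Q ∈ S l, A l Q i j • T (indL2 μ Q) x := by
        refine ae_all_iff.2 fun i => ae_all_iff.2 fun j => ?_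
        rw [hv]
        simp only [map_sum, map_smul]
        exact ae_sum_smul_apply _ _ _
      filter_upwards [this] with x hx
      ext i j
      rw [Matrix.of_apply, hx i j, Matrix.sum_apply]
      exact Finset.sum_congr rfl fun Q _ => by rw [Matrix.smul_apply, smul_eq_mul, smul_eq_mul,
        mul_comm]
    have e : ∫⁻ x, ENNReal.ofReal (traceLevel (Matrix.of fun i j => T (v l i j) x) (s / 2)) ∂μ =
        ∫⁻ x, ENNReal.ofReal (traceLevel (∑ Q ∈ S l, T (indL2 μ Q) x • A l Q) (s / 2)) ∂μ := by
      refine lintegral_congr_ae ?_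
      filter_upwards [hae] with x hx
      rw [hx]
    rw [e]
    refine (hC (N l) (S l) (hS l) m (A l) (s / 2) (half_pos hs)).trans ?_
    refine mul_le_mul' le_rfl ((sum_mul_traceAbs_le (hS l) (A l)).trans ?_)
    refine (lintegral_traceAbs_le (u := fun i j => v l i j) (v := fun i j => f i j)
      (fun i j => measurable_Lp _) (fun i j => measurable_Lp _)).trans ?_
    gcongr with i _ j _
    exact h1 l i j

end integrableL2

/-! ### The extension to `L_1` -/

section extension

open Filter Topology

variable {d n : ℕ} {μ : Measure (EuclideanSpace ℝ (Fin d))} {T : Lp ℂ 2 μ →L[ℂ] Lp ℂ 2 μ}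

/-- The scalar weak type inequality with constant `C`, for integrable functions in `L_2`. -/
def ScalarWeakType (T : Lp ℂ 2 μ →L[ℂ] Lp ℂ 2 μ) (C : ℝ≥0) : Prop :=
  ∀ g : Lp ℂ 2 μ, Integrable g μ → ∀ s : ℝ, 0 < s →
    ENNReal.ofReal s * μ {x | s < ‖T g x‖} ≤ C * ∫⁻ x, ‖g x‖ₑ ∂μ

/-- The function `g` is a value at `f` of the extension of `T` by continuity, from `L_1` to
convergence in measure. -/
def IsExtensionValue (T : Lp ℂ 2 μ →L[ℂ] Lp ℂ 2 μ) (f : Lp ℂ 1 μ)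
    (g : EuclideanSpace ℝ (Fin d) →ₘ[μ] ℂ) : Prop :=
  ∃ φ : ℕ → Lp ℂ 2 μ, (∀ l, Integrable (φ l) μ) ∧
    Tendsto (fun l => ∫⁻ x, ‖f x - φ l x‖ₑ ∂μ) atTop (𝓝 0) ∧
    TendstoInMeasure μ (fun l => T (φ l)) atTop g

theorem scalarWeakType_of_weakType {C : ℝ≥0}
    (h : ∀ (m : ℕ) (f : Fin m → Fin m → Lp ℂ 2 μ), (∀ i j, Integrable (f i j) μ) →
      ∀ s : ℝ, 0 < s → ENNReal.ofReal s *
        ∫⁻ x, ENNReal.ofReal (traceLevel (Matrix.of fun i j => T (f i j) x) s) ∂μ ≤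
      C * ∫⁻ x, ENNReal.ofReal (traceAbs (Matrix.of fun i j => f i j x)) ∂μ) :
    ScalarWeakType T C := by
  intro g hg s hs
  have hm : MeasurableSet {x | s < ‖T g x‖} :=
    measurableSet_lt measurable_const (measurable_Lp (T g)).norm
  calc ENNReal.ofReal s * μ {x | s < ‖T g x‖}
      = ENNReal.ofReal s * ∫⁻ x, {x | s < ‖T g x‖}.indicator (fun _ => 1) x ∂μ := by
        rw [lintegral_indicator_const hm, one_mul]
    _ ≤ ENNReal.ofReal s * ∫⁻ x, ENNReal.ofReal
          (traceLevel (Matrix.of fun _ _ : Fin 1 => T g x) s) ∂μ := by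
        gcongr with x
        by_cases hx : x ∈ {x | s < ‖T g x‖}
        · rw [indicator_of_mem hx]
          exact ENNReal.one_le_ofReal.2 (one_le_traceLevel_of_lt hx)
        · rw [indicator_of_notMem hx]; exact zero_le
    _ ≤ C * ∫⁻ x, ENNReal.ofReal (traceAbs (Matrix.of fun _ _ : Fin 1 => g x)) ∂μ :=
        h 1 (fun _ _ => g) (fun _ _ => hg) s hs
    _ ≤ _ := by
        gcongr with x
        rw [← ofReal_norm]
        exact ENNReal.ofReal_le_ofReal ((traceAbs_le_sum_entries _).trans (by simp))

theorem integrable_smul_add {φ ψ : Lp ℂ 2 μ} (hφ : Integrable φ μ) (hψ : Integrable ψ μ) (c : ℂ) :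
    Integrable (c • φ + ψ : Lp ℂ 2 μ) μ := by
  refine ((hφ.const_mul c).add hψ).congr ?_
  filter_upwards [Lp.coeFn_add (c • φ) ψ, Lp.coeFn_smul c φ] with x h1 h2
  rw [h1, Pi.add_apply, Pi.add_apply, h2]; rfl

theorem IsExtensionValue.smul_add {f f' : Lp ℂ 1 μ} {g g' : EuclideanSpace ℝ (Fin d) →ₘ[μ] ℂ}
    (h : IsExtensionValue T f g) (h' : IsExtensionValue T f' g') (c : ℂ) :
    IsExtensionValue T (c • f + f') (c • g + g') := by
  obtain ⟨φ, h1, h2, h3⟩ := h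
  obtain ⟨φ', h1', h2', h3'⟩ := h'
  refine ⟨fun l => c • φ l + φ' l, fun l => integrable_smul_add (h1 l) (h1' l) c, ?_, ?_⟩
  · have hlim : Tendsto (fun l => ‖c‖ₑ * ∫⁻ x, ‖f x - φ l x‖ₑ ∂μ + ∫⁻ x, ‖f' x - φ' l x‖ₑ ∂μ)
        atTop (𝓝 0) := by
      simpa using (ENNReal.Tendsto.const_mul h2 (Or.inr (by simp : ‖c‖ₑ ≠ ∞))).add h2'
    refine tendsto_of_tendsto_of_tendsto_of_le_of_le tendsto_const_nhds hlim (fun _ => zero_le)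
      fun l => ?_
    have hm : Measurable fun x => ‖f x - φ l x‖ₑ :=
      ((Lp.stronglyMeasurable f).measurable.sub (measurable_Lp _)).enorm
    rw [← lintegral_const_mul _ hm, ← lintegral_add_left (hm.const_mul _)]
    refine lintegral_mono_ae ?_
    filter_upwards [Lp.coeFn_add (c • φ l) (φ' l), Lp.coeFn_smul c (φ l), Lp.coeFn_add (c • f) f',
      Lp.coeFn_smul c f] with x e1 e2 e3 e4
    rw [e1, e3, Pi.add_apply, Pi.add_apply, e2, e4, Pi.smul_apply, Pi.smul_apply, add_sub_add_comm,
      ← smul_sub, ← enorm_smul]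
    exact enorm_add_le _ _
  · refine (tendstoInMeasure_smul_add h3 h3' c).congr (fun l => ?_) ?_
    · rw [map_add, map_smul]
      filter_upwards [Lp.coeFn_add (c • T (φ l)) (T (φ' l)), Lp.coeFn_smul c (T (φ l))]
        with x e1 e2
      rw [e1, Pi.add_apply, e2]; rfl
    · filter_upwards [AEEqFun.coeFn_add (c • g) g', AEEqFun.coeFn_smul c g] with x e1 e2
      rw [e1, Pi.add_apply, e2]; rfl

theorem IsExtensionValue.eq_zero {C : ℝ≥0} (hC : ScalarWeakType T C)
    {g : EuclideanSpace ℝ (Fin d) →ₘ[μ] ℂ} (h : IsExtensionValue T 0 g) : g = 0 := by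
  obtain ⟨φ, h1, h2, h3⟩ := h
  have h4 : TendstoInMeasure μ (fun l => T (φ l)) atTop fun _ => (0 : ℂ) := by
    rw [tendstoInMeasure_iff_norm]
    intro ε hε
    have hlim : Tendsto (fun l => (ENNReal.ofReal (ε / 2))⁻¹ *
        (C * ∫⁻ x, ‖(0 : Lp ℂ 1 μ) x - φ l x‖ₑ ∂μ)) atTop (𝓝 0) := by
      simpa using ENNReal.Tendsto.const_mul (ENNReal.Tendsto.const_mul h2
        (Or.inr (ENNReal.coe_ne_top (r := C))))
        (Or.inr (ENNReal.inv_ne_top.2 (ENNReal.ofReal_pos.2 (half_pos hε)).ne'))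
    refine tendsto_of_tendsto_of_tendsto_of_le_of_le tendsto_const_nhds hlim (fun _ => zero_le)
      fun l => ?_
    have e : ∫⁻ x, ‖(0 : Lp ℂ 1 μ) x - φ l x‖ₑ ∂μ = ∫⁻ x, ‖φ l x‖ₑ ∂μ := by
      refine lintegral_congr_ae ?_
      filter_upwards [Lp.coeFn_zero ℂ 1 μ] with x hx
      rw [hx]; simp
    rw [e]
    refine le_trans (measure_mono fun x (hx : ε ≤ _) => ?_) ((ENNReal.mul_le_iff_le_inv
      (ENNReal.ofReal_pos.2 (half_pos hε)).ne' ENNReal.ofReal_ne_top).1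
      (hC (φ l) (h1 l) (ε / 2) (half_pos hε)))
    rw [sub_zero] at hx
    exact lt_of_lt_of_le (half_lt_self hε) hx
  refine AEEqFun.ext ((tendstoInMeasure_ae_unique h3 h4).trans ?_)
  exact AEEqFun.coeFn_zero.symm

/-- The extension is well defined: by the weak-type bound, it can only be `0` at `0`. -/
theorem IsExtensionValue.unique {C : ℝ≥0} (hC : ScalarWeakType T C) {f : Lp ℂ 1 μ}
    {g g' : EuclideanSpace ℝ (Fin d) →ₘ[μ] ℂ} (h : IsExtensionValue T f g)
    (h' : IsExtensionValue T f g') : g = g' := by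
  have h0 := h'.smul_add h (-1)
  rw [neg_one_smul, neg_add_cancel] at h0
  have := h0.eq_zero hC
  have e : (-1 : ℂ) • g' = -g' := neg_one_smul ℂ g'
  rw [e, neg_add_eq_zero] at this
  exact this.symm

theorem isExtensionValue_of_ae_eq {f : Lp ℂ 1 μ} {g : Lp ℂ 2 μ} (h : f =ᵐ[μ] g) :
    IsExtensionValue T f (T g : EuclideanSpace ℝ (Fin d) →ₘ[μ] ℂ) := by
  refine ⟨fun _ => g, fun _ => (memLp_one_iff_integrable.1 (Lp.memLp f)).congr h, ?_, ?_⟩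
  · have : ∫⁻ x, ‖f x - g x‖ₑ ∂μ = 0 := by
      rw [lintegral_congr_ae (g := fun _ => 0), lintegral_zero]
      filter_upwards [h] with x hx
      simp [hx]
    simp only [this]
    exact tendsto_const_nhds
  · intro ε hε
    simp [hε.ne']

theorem exists_integrable_L2_approx (f : Lp ℂ 1 μ) {ε : ℝ≥0∞} (hε : ε ≠ 0) :
    ∃ φ : Lp ℂ 2 μ, Integrable φ μ ∧ ∫⁻ x, ‖f x - φ x‖ₑ ∂μ ≤ ε := by
  obtain ⟨g, hg, hg1⟩ := (Lp.memLp f).exists_simpleFunc_eLpNorm_sub_lt ENNReal.one_ne_top hε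
  have hg2 : MemLp g 2 μ := (SimpleFunc.memLp_iff (by simp) (by simp)).2
    ((SimpleFunc.memLp_iff one_ne_zero ENNReal.one_ne_top).1 hg1)
  refine ⟨hg2.toLp g, (memLp_one_iff_integrable.1 hg1).congr hg2.coeFn_toLp.symm, ?_⟩
  rw [eLpNorm_one_eq_lintegral_enorm] at hg
  refine le_trans (lintegral_mono_ae ?_) hg.le
  filter_upwards [hg2.coeFn_toLp] with x hx
  rw [hx]; rfl

/-- The extension is defined everywhere. For approximations of geometric rate, the weak-type bound
makes the jumps of the images summable in measure. -/
theorem ScalarWeakType.exists_isExtensionValue {C : ℝ≥0} (hC : ScalarWeakType T C)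
    (f : Lp ℂ 1 μ) : ∃ g, IsExtensionValue T f g := by
  have h4 : ∀ l : ℕ, ((4⁻¹ : ℝ≥0∞)) ^ l ≠ 0 := fun l => by simp
  choose φ h1 h2 using fun l : ℕ => exists_integrable_L2_approx f (h4 l)
  have hm : ∀ l, Measurable fun x => ‖f x - φ l x‖ₑ := fun l =>
    ((Lp.stronglyMeasurable f).measurable.sub (measurable_Lp _)).enorm
  have hjump : ∀ l, μ {x | (2⁻¹ : ℝ≥0∞) ^ l < edist (T (φ l) x) (T (φ (l + 1)) x)} ≤
      2 * C * 2⁻¹ ^ l := by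
    intro l
    have hl := hC ((-1 : ℂ) • φ (l + 1) + φ l)
      (integrable_smul_add (h1 (l + 1)) (h1 l) (-1)) ((1 / 2) ^ l) (by positivity)
    have e1 : ENNReal.ofReal ((1 / 2) ^ l) = (2⁻¹ : ℝ≥0∞) ^ l := by
      rw [ENNReal.ofReal_pow (by norm_num), one_div, ENNReal.ofReal_inv_of_pos (by norm_num)]
      norm_num
    have e2 : ∫⁻ x, ‖((-1 : ℂ) • φ (l + 1) + φ l : Lp ℂ 2 μ) x‖ₑ ∂μ ≤ 2 * (4⁻¹ : ℝ≥0∞) ^ l := by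
      calc _ ≤ ∫⁻ x, (‖f x - φ (l + 1) x‖ₑ + ‖f x - φ l x‖ₑ) ∂μ := by
            refine lintegral_mono_ae ?_
            filter_upwards [Lp.coeFn_add ((-1 : ℂ) • φ (l + 1)) (φ l),
              Lp.coeFn_smul (-1 : ℂ) (φ (l + 1))] with x h1 h2
            rw [h1, Pi.add_apply, h2, Pi.smul_apply,
              show (-1 : ℂ) • φ (l + 1) x + φ l x =
                (f x - φ (l + 1) x) - (f x - φ l x) by rw [neg_one_smul]; ring]
            exact enorm_sub_le
        _ = ∫⁻ x, ‖f x - φ (l + 1) x‖ₑ ∂μ + ∫⁻ x, ‖f x - φ l x‖ₑ ∂μ :=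
            lintegral_add_left (hm _) _
        _ ≤ (4⁻¹ : ℝ≥0∞) ^ (l + 1) + 4⁻¹ ^ l := add_le_add (h2 _) (h2 _)
        _ ≤ 4⁻¹ ^ l + 4⁻¹ ^ l := by
            gcongr ?_ + _
            exact pow_le_pow_right_of_le_one' (by simp) (Nat.le_succ l)
        _ = _ := (two_mul _).symm
    have hae : μ {x | (2⁻¹ : ℝ≥0∞) ^ l < edist (T (φ l) x) (T (φ (l + 1)) x)} ≤
        μ {x | (1 / 2 : ℝ) ^ l < ‖T ((-1 : ℂ) • φ (l + 1) + φ l) x‖} := by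
      refine measure_mono_ae ?_
      rw [map_add, map_smul]
      filter_upwards [Lp.coeFn_add ((-1 : ℂ) • T (φ (l + 1))) (T (φ l)),
        Lp.coeFn_smul (-1 : ℂ) (T (φ (l + 1)))] with x h1 h2 hx
      have hx' : (2⁻¹ : ℝ≥0∞) ^ l < edist (T (φ l) x) (T (φ (l + 1)) x) := hx
      change (1 / 2 : ℝ) ^ l < _
      rw [h1, Pi.add_apply, h2, Pi.smul_apply, neg_one_smul, neg_add_eq_sub]
      rw [edist_dist, dist_eq_norm, ← e1] at hx'
      exact (ENNReal.ofReal_lt_ofReal_iff_of_nonneg (by positivity)).1 hx'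
    rw [e1] at hl
    have h2l : (2⁻¹ : ℝ≥0∞) ^ l ≠ 0 := by simp
    have h2l' : (2⁻¹ : ℝ≥0∞) ^ l ≠ ∞ := by finiteness
    refine hae.trans (((ENNReal.mul_le_iff_le_inv h2l h2l').1
      (hl.trans (mul_le_mul' le_rfl e2))).trans_eq ?_)
    have e4 : (4⁻¹ : ℝ≥0∞) ^ l = 2⁻¹ ^ l * 2⁻¹ ^ l := by
      rw [← mul_pow, ← ENNReal.mul_inv (by simp) (by simp)]; norm_num
    rw [e4]
    calc _ = (((2⁻¹ : ℝ≥0∞) ^ l)⁻¹ * 2⁻¹ ^ l) * (2 * C * 2⁻¹ ^ l) := by ring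
      _ = _ := by rw [ENNReal.inv_mul_cancel h2l h2l', one_mul]
  obtain ⟨v, hv, hTv⟩ := exists_tendstoInMeasure (ν := μ) (u := fun l => T (φ l))
    (fun l => Lp.aestronglyMeasurable _) (by
      refine ne_top_of_le_ne_top ?_ (ENNReal.tsum_le_tsum hjump)
      rw [ENNReal.tsum_mul_left, ENNReal.tsum_geometric, ENNReal.one_sub_inv_two, inv_inv]
      finiteness)
  refine ⟨AEEqFun.mk v hv.aestronglyMeasurable, φ, h1, ?_,
    hTv.congr_right (AEEqFun.coeFn_mk _ _).symm⟩
  refine tendsto_of_tendsto_of_tendsto_of_le_of_le tendsto_const_nhds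
    (ENNReal.tendsto_pow_atTop_nhds_zero_of_lt_one (r := 4⁻¹) ?_) (fun _ => zero_le) h2
  exact ENNReal.inv_lt_one.2 (by norm_num)

/-- The extension of an operator of weak type to `L_1`. -/
def ScalarWeakType.extension {C : ℝ≥0} (hC : ScalarWeakType T C) :
    Lp ℂ 1 μ →ₗ[ℂ] (EuclideanSpace ℝ (Fin d) →ₘ[μ] ℂ) where
  toFun f := (hC.exists_isExtensionValue f).choose
  map_add' f f' := by
    refine (hC.exists_isExtensionValue _).choose_spec.unique hC ?_
    have := (hC.exists_isExtensionValue f).choose_spec.smul_add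
      (hC.exists_isExtensionValue f').choose_spec 1
    rwa [one_smul, one_smul] at this
  map_smul' c f := by
    obtain ⟨g₀, h0⟩ := hC.exists_isExtensionValue 0
    rw [h0.eq_zero hC] at h0
    refine (hC.exists_isExtensionValue _).choose_spec.unique hC ?_
    have := (hC.exists_isExtensionValue f).choose_spec.smul_add h0 c
    rwa [add_zero, add_zero] at this

theorem ScalarWeakType.isExtensionValue_extension {C : ℝ≥0} (hC : ScalarWeakType T C)
    (f : Lp ℂ 1 μ) : IsExtensionValue T f (hC.extension f) :=
  (hC.exists_isExtensionValue f).choose_spec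

end extension

end

theorem theoremB {d n : ℕ} (μ : Measure (EuclideanSpace ℝ (Fin d))) [IsLocallyFiniteMeasure μ]
    (hμ : PolynomialGrowth n μ) (F : NonregularFiltration n μ)
    (k : EuclideanSpace ℝ (Fin d) → EuclideanSpace ℝ (Fin d) → ℂ)
    (hk : Measurable (Function.uncurry k))
    (T : Lp ℂ 2 μ →L[ℂ] Lp ℂ 2 μ) (hT : HasKernel T k)
    (hsize : KernelSize n k) (hreg : L2Hormander F k) :
    ∃ T₁ : Lp ℂ 1 μ →ₗ[ℂ] (EuclideanSpace ℝ (Fin d) →ₘ[μ] ℂ),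
      (∀ (f : Lp ℂ 1 μ) (g : Lp ℂ 2 μ), f =ᵐ[μ] g → T₁ f =ᵐ[μ] T g) ∧
      ∃ C : ℝ≥0, ∀ (m : ℕ) (f : Matrix (Fin m) (Fin m) (Lp ℂ 1 μ)) (s : ℝ), 0 < s →
        ENNReal.ofReal s *
            ∫⁻ x, ENNReal.ofReal (traceLevel (Matrix.of fun i j => T₁ (f i j) x) s) ∂μ ≤
          C * ∫⁻ x, ENNReal.ofReal (traceAbs (Matrix.of fun i j => f i j x)) ∂μ := by
  obtain ⟨C, hC⟩ := exists_weakType_integrable F hk hT hsize hreg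
  have hS := scalarWeakType_of_weakType hC
  refine ⟨hS.extension, fun f g hfg => ?_, 2 * C, fun m f s hs => ?_⟩
  · rw [(hS.isExtensionValue_extension f).unique hS (isExtensionValue_of_ae_eq hfg)]
  choose φ h1 h2 h3 using fun i j => hS.isExtensionValue_extension (f i j)
  set I := ∫⁻ x, ENNReal.ofReal (traceAbs (Matrix.of fun i j => f i j x)) ∂μ
  have hb : Filter.Tendsto (fun l => C * (I + ∑ i, ∑ j, ∫⁻ x, ‖f i j x - φ i j l x‖ₑ ∂μ))
      Filter.atTop (nhds (C * I)) := by
    have h4 : Filter.Tendsto (fun l => ∑ i, ∑ j, ∫⁻ x, ‖f i j x - φ i j l x‖ₑ ∂μ)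
        Filter.atTop (nhds 0) := by
      simpa using tendsto_finsetSum Finset.univ fun i _ =>
        tendsto_finsetSum Finset.univ fun j _ => h2 i j
    simpa using ENNReal.Tendsto.const_mul ((tendsto_const_nhds (x := I)).add h4)
      (Or.inr (ENNReal.coe_ne_top (r := C)))
  refine (mul_lintegral_traceLevel_le_of_tendsto (ν := μ) (u := fun l i j => T (φ i j l))
    (v := fun i j => hS.extension (f i j)) (fun l i j => measurable_Lp _)
    (fun i j => (AEEqFun.stronglyMeasurable _).measurable) h3 hs hb fun l => ?_).trans_eq ?_
  · refine (hC m (fun i j => φ i j l) (fun i j => h1 i j l) (s / 2) (half_pos hs)).trans ?_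
    refine mul_le_mul' le_rfl (lintegral_traceAbs_le (fun i j => measurable_Lp _)
      (fun i j => (Lp.stronglyMeasurable _).measurable))
  · push_cast; ring
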